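/- A rectilinear drawing of a plane graph is a planar drawing in which the vertices are distinct points and each edge is a horizontal or a vertical segment. A rectilinear representation $H$ of a plane graph is given by its embedding together with the geometric angle ($90$, $180$ or $270$ degrees; $360$ at a vertex of degree one) between consecutive edges at each vertex, such that at least one rectilinear drawing with this embedding and these angles exists; as usual, the rotation is fixed, so that for every edge $uv$ it is specified whether $u$ is to the left of, to the right of, above or below $v$. The rectilinear drawings with these data are the drawings of $H$. A drawing is greedy if for every ordered pair of vertices $u,v$ there is a path from $u$ to $v$ along which the Euclidean distance to $v$ strictly decreases from vertex to vertex. $H$ is universal greedy if every drawing of $H$ is greedy. $H$ is convex if (in its drawings) every internal face is a rectangle and the external face is bounded by an orthoconvex polygon, i.e. every horizontal or vertical line meets the closed polygonal region in the empty set or in a single segment. $D_x$ is the directed graph obtained from $H$ by orienting the horizontal edges from left to right and contracting each maximal path of vertical edges (possibly a single vertex) to a node; $D_y$ is defined symmetrically, with the vertical edges oriented from bottom to top. Theorem. Let $H$ be a rectilinear representation of an $n$-vertex biconnected plane graph (biconnected: connected and without cutvertices). (a) $H$ is universal greedy if and only if $H$ is convex and both $D_x$ and $D_y$ have a directed Hamiltonian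 path. (b) It can be tested in $O(n)$ time whether $H$ is universal greedy: there are a single program for a random access machine (with assignment, addition, subtraction, comparison, indirect addressing and jumps, each at unit cost) and a constant $C$ such that, on every such $H$, given by the table of the neighbours of each vertex in the four directions, the program stops after at most $Cn$ steps with the correct answer, while all numbers that it stores are at most $Cn$ (so that machine words of $\log n+O(1)$ bits suffice). -/

import Mathlib

namespace GreedyRectilinear

/-! ### Rectilinear representations and their drawings -/

/-- The Euclidean plane; `p 0` is the `x`-coordinate and `p 1` is the `y`-coordinate. -/
abbrev Plane : Type := EuclideanSpace ℝ (Fin 2)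

/-- The four directions in which an axis-parallel edge can leave a vertex. -/
inductive Dir : Type
  | east
  | north
  | west
  | south
  deriving DecidableEq

/-- The opposite direction. -/
def Dir.opp : Dir → Dir
  | .east => .west
  | .north => .south
  | .west => .east
  | .south => .north

/-- `Dir.Holds d p q`: the point `q` lies straight in direction `d` from the point `p`. -/
def Dir.Holds : Dir → Plane → Plane → Prop
  | .east, p, q => p 0 < q 0 ∧ p 1 = q 1
  | .north, p, q => p 0 = q 0 ∧ p 1 < q 1
  | .west, p, q => q 0 < p 0 ∧ p 1 = q 1
  | .south, p, q => p 0 = q 0 ∧ q 1 < p 1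

/-- A graph on the vertices `0, …, n - 1` in which it is fixed for each edge in which of the four
directions it leaves each of its end-vertices (`nbr u d = some v`: there is an edge `uv`, and `v`
lies in direction `d` from `u`). This fixes the cyclic order of the edges around every vertex (the
order east, north, west, south, restricted to the directions in use) and all the angles (one turns
by 90 degrees from each direction to the next one), hence the faces, and the external face among
them: an internal face with `k` vertices has angles of total size `180 (k - 2)` degrees if its
boundary is a simple cycle, and the external face has angles of total size `180 (k + 2)`. -/
structure Shape (n : ℕ) where
  nbr : Fin n → Dir → Option (Fin n)
  nbr_ne : ∀ u d, nbr u d ≠ some u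
  nbr_opp : ∀ u v d, nbr u d = some v → nbr v d.opp = some u

namespace Shape

/-- The underlying graph. -/
def graph {n : ℕ} (H : Shape n) : SimpleGraph (Fin n) where
  Adj u v := ∃ d, H.nbr u d = some v
  symm := ⟨fun u v ⟨d, h⟩ => ⟨d.opp, H.nbr_opp u v d h⟩⟩
  loopless := ⟨fun u ⟨d, h⟩ => H.nbr_ne u d h⟩

/-- `H.IsDrawing pos`: placing each vertex `v` at the point `pos v` and drawing the edges as
straight-line segments gives a planar rectilinear drawing in which every edge has the direction
prescribed by `H`. -/
structure IsDrawing {n : ℕ} (H : Shape n) (pos : Fin n → Plane) : Prop where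
  injective : Function.Injective pos
  direction : ∀ u v d, H.nbr u d = some v → d.Holds (pos u) (pos v)
  planar : ∀ u v w z, H.graph.Adj u v → H.graph.Adj w z → s(u, v) ≠ s(w, z) →
    ∀ p, p ∈ segment ℝ (pos u) (pos v) → p ∈ segment ℝ (pos w) (pos z) →
      ∃ t, t ∈ s(u, v) ∧ t ∈ s(w, z) ∧ p = pos t

/-- The subset of the plane covered by the vertices and the edges of a drawing. -/
def support {n : ℕ} (H : Shape n) (pos : Fin n → Plane) : Set Plane :=
  {p | (∃ v, p = pos v) ∨ ∃ u v, H.graph.Adj u v ∧ p ∈ segment ℝ (pos u) (pos v)}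

/-- The face of a drawing that contains the point `p` (empty if `p` lies on the drawing). -/
def face {n : ℕ} (H : Shape n) (pos : Fin n → Plane) (p : Plane) : Set Plane :=
  connectedComponentIn (H.support pos)ᶜ p

/-- The external (unbounded) face of a drawing. -/
def externalFace {n : ℕ} (H : Shape n) (pos : Fin n → Plane) : Set Plane :=
  {p | p ∉ H.support pos ∧ ¬ Bornology.IsBounded (H.face pos p)}

/-- The open axis-parallel rectangles. -/
def IsOpenRectangle (s : Set Plane) : Prop :=
  ∃ a b c d : ℝ, s = {p | a < p 0 ∧ p 0 < b ∧ c < p 1 ∧ p 1 < d}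

/-- Orthoconvexity: every vertical and every horizontal line meets `s` in an interval, that is, in
the empty set or in a single segment if `s` is compact. -/
def IsOrthoconvex (s : Set Plane) : Prop :=
  (∀ a : ℝ, {t : ℝ | !₂[a, t] ∈ s}.OrdConnected) ∧ (∀ b : ℝ, {t : ℝ | !₂[t, b] ∈ s}.OrdConnected)

/-- Every internal face of the drawing is a rectangle, and the polygon that bounds the external
face is orthoconvex. As a region of the plane, this polygon is the complement of the external
face. -/
def IsConvexDrawing {n : ℕ} (H : Shape n) (pos : Fin n → Plane) : Prop :=
  (∀ p, p ∉ H.support pos → Bornology.IsBounded (H.face pos p) → IsOpenRectangle (H.face pos p)) ∧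
    IsOrthoconvex (H.externalFace pos)ᶜ

/-- The drawing is greedy: for any ordered pair of vertices `u`, `v` there is a
distance-decreasing path from `u` to `v`. -/
def IsGreedyDrawing {n : ℕ} (H : Shape n) (pos : Fin n → Plane) : Prop :=
  ∀ u v, ∃ p : H.graph.Walk u v, p.IsPath ∧ ∀ i < p.length,
    dist (pos (p.getVert (i + 1))) (pos v) < dist (pos (p.getVert i)) (pos v)

/-- The vertical edges, as a graph on all the vertices. -/
def verticalGraph {n : ℕ} (H : Shape n) : SimpleGraph (Fin n) where
  Adj u v := H.nbr u .north = some v ∨ H.nbr u .south = some v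
  symm := ⟨fun u v h => h.elim (fun h => .inr (H.nbr_opp u v _ h)) fun h => .inl (H.nbr_opp u v _ h)⟩
  loopless := ⟨fun u h => h.elim (H.nbr_ne u _) (H.nbr_ne u _)⟩

/-- The horizontal edges, as a graph on all the vertices. -/
def horizontalGraph {n : ℕ} (H : Shape n) : SimpleGraph (Fin n) where
  Adj u v := H.nbr u .east = some v ∨ H.nbr u .west = some v
  symm := ⟨fun u v h => h.elim (fun h => .inr (H.nbr_opp u v _ h)) fun h => .inl (H.nbr_opp u v _ h)⟩
  loopless := ⟨fun u h => h.elim (H.nbr_ne u _) (H.nbr_ne u _)⟩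

/-- The digraph `D_x`: its nodes are the maximal vertical paths (possibly with a single vertex), and
every horizontal edge gives an arc from left to right. Parallel arcs are not distinguished. -/
def dagX {n : ℕ} (H : Shape n) : Digraph H.verticalGraph.ConnectedComponent where
  Adj a b := ∃ u v, H.nbr u .east = some v ∧
    H.verticalGraph.connectedComponentMk u = a ∧ H.verticalGraph.connectedComponentMk v = b

/-- The digraph `D_y`: its nodes are the maximal horizontal paths (possibly with a single vertex),
and every vertical edge gives an arc from bottom to top. -/
def dagY {n : ℕ} (H : Shape n) : Digraph H.horizontalGraph.ConnectedComponent where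
  Adj a b := ∃ u v, H.nbr u .north = some v ∧
    H.horizontalGraph.connectedComponentMk u = a ∧ H.horizontalGraph.connectedComponentMk v = b

end Shape

/-- A directed Hamiltonian path: a list of nodes in which each node appears exactly once and each
node but the last one has an arc to its successor. -/
def HasHamiltonianPath {α : Type*} (D : Digraph α) : Prop :=
  ∃ l : List α, l.IsChain D.Adj ∧ l.Nodup ∧ ∀ a, a ∈ l

/-- A connected graph without cutvertices. -/
def IsBiconnected {V : Type*} (G : SimpleGraph V) : Prop :=
  G.Connected ∧ ∀ v : V, (G.induce {v}ᶜ).Preconnected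

/-- A rectilinear representation, with its edges oriented: the (nonempty) class of all planar
rectilinear drawings with prescribed directions of the edges. -/
structure RectilinearRep (n : ℕ) extends Shape n where
  exists_drawing : ∃ pos, toShape.IsDrawing pos

namespace RectilinearRep

/-- Every rectilinear drawing of `H` is greedy. -/
def UniversalGreedy {n : ℕ} (H : RectilinearRep n) : Prop :=
  ∀ pos, H.IsDrawing pos → H.IsGreedyDrawing pos

/-- The internal faces of `H` are rectangular, and its external face is bounded by an orthoconvex
polygon. -/
def IsConvex {n : ℕ} (H : RectilinearRep n) : Prop :=
  ∀ pos, H.IsDrawing pos → H.IsConvexDrawing pos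

end RectilinearRep

/-! ### Random access machines -/

/-- The instructions of a random access machine. The machine has registers `r 0, r 1, …` and memory
cells `m 0, m 1, …`, which hold natural numbers. -/
inductive Instr : Type
  /-- `r i := c` -/
  | const (i c : ℕ)
  /-- `r i := r j` -/
  | copy (i j : ℕ)
  /-- `r i := r j + r k` -/
  | add (i j k : ℕ)
  /-- `r i := r j - r k`, truncated at zero -/
  | sub (i j k : ℕ)
  /-- `r i := m (r j)` -/
  | load (i j : ℕ)
  /-- `m (r i) := r j` -/
  | store (i j : ℕ)
  /-- go to instruction `l` -/
  | jump (l : ℕ)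
  /-- go to instruction `l` if `r j < r k` -/
  | jumpLt (j k l : ℕ)
  /-- stop with answer `b` -/
  | halt (b : Bool)

/-- A program is a finite list of instructions, numbered from zero. -/
abbrev Program : Type := List Instr

/-- The configurations of the machine: program counter, registers, memory. -/
structure Config where
  pc : ℕ
  reg : ℕ → ℕ
  mem : ℕ → ℕ

/-- The execution of one instruction. A halting instruction leaves the configuration unchanged. -/
def Instr.exec : Instr → Config → Config
  | .const i c, s => ⟨s.pc + 1, Function.update s.reg i c, s.mem⟩
  | .copy i j, s => ⟨s.pc + 1, Function.update s.reg i (s.reg j), s.mem⟩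
  | .add i j k, s => ⟨s.pc + 1, Function.update s.reg i (s.reg j + s.reg k), s.mem⟩
  | .sub i j k, s => ⟨s.pc + 1, Function.update s.reg i (s.reg j - s.reg k), s.mem⟩
  | .load i j, s => ⟨s.pc + 1, Function.update s.reg i (s.mem (s.reg j)), s.mem⟩
  | .store i j, s => ⟨s.pc + 1, s.reg, Function.update s.mem (s.reg i) (s.reg j)⟩
  | .jump l, s => ⟨l, s.reg, s.mem⟩
  | .jumpLt j k l, s => ⟨if s.reg j < s.reg k then l else s.pc + 1, s.reg, s.mem⟩
  | .halt _, s => s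

/-- One step of the machine. If there is no instruction to execute, the machine is stuck without an
answer. -/
def step (P : Program) (s : Config) : Config :=
  match P[s.pc]? with
  | some c => c.exec s
  | none => s

/-- The configuration after `t` steps. -/
def run (P : Program) (s : Config) (t : ℕ) : Config :=
  (step P)^[t] s

/-- Started from `s`, the program stops after at most `T` steps, its answer is `true` if and only if
`Q` holds, and no register and no memory cell ever holds a number larger than `W`. -/
def DecidesWithin (P : Program) (s : Config) (T W : ℕ) (Q : Prop) : Prop :=
  (∃ t ≤ T, ∃ b : Bool, P[(run P s t).pc]? = some (Instr.halt b) ∧ (b = true ↔ Q)) ∧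
    ∀ t i, (run P s t).reg i ≤ W ∧ (run P s t).mem i ≤ W

/-- The number of a direction: east, north, west, south are 0, 1, 2, 3. -/
def dirOfNat : ℕ → Dir
  | 0 => .east
  | 1 => .north
  | 2 => .west
  | _ => .south

/-- The input table: cell `4 v + d` holds `0` if no edge leaves the vertex `v` in direction number
`d`, and `u + 1` if the edge that leaves `v` in this direction ends at `u`. All other cells are
zero. -/
def inputTable {n : ℕ} (H : Shape n) (a : ℕ) : ℕ :=
  if h : a / 4 < n then
    match H.nbr ⟨a / 4, h⟩ (dirOfNat (a % 4)) with
    | some u => u.val + 1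
    | none => 0
  else 0

/-- The initial configuration on input `H`: the number `n` of vertices is in register `0`, and the
input table is in the memory. -/
def inputConfig {n : ℕ} (H : Shape n) : Config :=
  ⟨0, fun i => if i = 0 then n else 0, inputTable H⟩

/-- The program decides the property `Q` of rectilinear representations of biconnected plane graphs
in linear time: on `n`-vertex inputs it stops with the right answer after `O(n)` steps, and it only
uses numbers of size `O(n)`, that is, machine words of `log n + O(1)` bits. -/
def DecidesInLinearTime (P : Program) (Q : ∀ n : ℕ, RectilinearRep n → Prop) : Prop :=
  ∃ C : ℕ, ∀ (n : ℕ) (H : RectilinearRep n), IsBiconnected H.graph →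
    DecidesWithin P (inputConfig H.toShape) (C * n) (C * n) (Q n H)

end GreedyRectilinear

namespace GreedyRectilinear

/-! ### Lines of edges in one direction -/

/-! Call a drawing box-connected (`IsBoxConnected`) if for all `u ≠ v` some edge leads from `u` to a
vertex inside the bounding box of `u` and `v`. Such a step decreases the distance to `v`, so
box-connected drawings are greedy. Conversely, if every edge at `u` leaves the box of `u` and `v`,
both axes can be stretched so that each coordinate outside the box is at least as far from that of
`v` as the coordinate of `u`. The result is again a drawing of `H`, and no neighbour of `u` is
closer to `v` than `u`. Hence `H` is universal greedy iff all its drawings are box-connected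
(`RectilinearRep.universalGreedy_iff`).

Box-connectedness amounts to two conditions. First, the maximal vertical paths can be numbered so
that a horizontal edge leads from each to the next one, and likewise for the horizontal paths. Such
a `Ranking` is a Hamiltonian path of `dagX` or `dagY`, and it forces the same order of the
coordinates in every drawing. Second, no vertex lies in an open quadrant at a vertex that lacks the
edges in the two bounding directions (`IsCornerFree`). Necessity is `Frame.exists_ranking` and
`Frame.corner`, sufficiency is `Frame.exists_box_step`. As rankings fix the order of coordinates,
the second condition passes from one drawing to all others, and one drawing decides universal
greediness (`RectilinearRep.universalGreedy_iff_of_isDrawing`).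

For (a) it remains to compare corners with convexity. In a box-connected drawing the covered point
set is `ReflexFree`. A point off such a set that sees it in all four directions lies in a
rectangular face, and a point that sees it above and below also sees it on both sides. This gives
rectangular internal faces and orthoconvexity. Conversely, a face just outside a corner with two
missing edges is no rectangle, so it is external in a convex drawing; orthoconvexity then clears
both rays from the corner, and a connected graph cannot reach beyond them
(`IsConvexDrawing.isCornerFree`).

For (b), a program finds the lowest vertex of each line, sorts the lines topologically, verifies
that the result is a ranking, and tests each kind of corner by scanning the columns once. It is
written in a small language of loops over the vertices and compiled to the machine, with time and
word size controlled by `decidesWithin_compile`; `greedyStms_spec` is its correctness. -/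

theorem Dir.opp_opp (d : Dir) : d.opp.opp = d := by cases d <;> rfl

namespace Shape

variable {n : ℕ} {H : Shape n}

/-- The edges that leave their first vertex in direction `d`. -/
def Step (H : Shape n) (d : Dir) (u v : Fin n) : Prop := H.nbr u d = some v

/-- The vertices `u` and `v` lie on a common path of edges of direction `d`. -/
def SameLine (H : Shape n) (d : Dir) (u v : Fin n) : Prop :=
  Relation.ReflTransGen (H.Step d) u v ∨ Relation.ReflTransGen (H.Step d) v u

theorem Step.right_unique {d : Dir} {u v w : Fin n} (h : H.Step d u v) (h' : H.Step d u w) :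
    v = w := by
  unfold Step at h h'; rw [h] at h'; exact Option.some.inj h'

theorem Step.opp {d : Dir} {u v : Fin n} (h : H.Step d u v) : H.Step d.opp v u :=
  H.nbr_opp u v d h

theorem step_opp_iff {d : Dir} {u v : Fin n} : H.Step d.opp v u ↔ H.Step d u v :=
  ⟨fun h => by simpa [Dir.opp_opp] using h.opp, Step.opp⟩

theorem Step.left_unique {d : Dir} {u v w : Fin n} (h : H.Step d u w) (h' : H.Step d v w) :
    u = v :=
  h.opp.right_unique h'.opp

theorem Step.sameLine {d : Dir} {u v : Fin n} (h : H.Step d u v) : H.SameLine d u v :=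
  .inl (.single h)

theorem SameLine.refl (d : Dir) (u : Fin n) : H.SameLine d u u := .inl .refl

theorem SameLine.symm {d : Dir} {u v : Fin n} (h : H.SameLine d u v) : H.SameLine d v u :=
  Or.symm h

/-- Edges of one direction do not branch: a vertex has at most one successor and at most one
predecessor. So a chain that ends above `v` must pass through `w`. -/
theorem SameLine.step {d : Dir} {u v w : Fin n} (h : H.SameLine d u v) (hs : H.Step d v w) :
    H.SameLine d u w := by
  rcases h with h | h
  · exact .inl (h.tail hs)
  · rcases h.cases_head with rfl | ⟨c, hc, hcu⟩
    · exact hs.sameLine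
    · rw [hc.right_unique hs] at hcu
      exact .inr hcu

theorem SameLine.step_back {d : Dir} {u v w : Fin n} (h : H.SameLine d u v) (hs : H.Step d w v) :
    H.SameLine d u w := by
  rcases h with h | h
  · rcases h.cases_tail with rfl | ⟨c, hc, hcu⟩
    · exact hs.sameLine.symm
    · rw [hcu.left_unique hs] at hc
      exact .inl hc
  · exact .inr (h.head hs)

theorem SameLine.trans {d : Dir} {u v w : Fin n} (h : H.SameLine d u v) (h' : H.SameLine d v w) :
    H.SameLine d u w := by
  rcases h' with h' | h'
  · induction h' with
    | refl => exact h
    | tail _ hs ih => exact ih.step hs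
  · induction h' using Relation.ReflTransGen.head_induction_on with
    | refl => exact h
    | head hs _ ih => exact ih.step_back hs

/-- Identifies the nodes of `dagX` with classes of `SameLine`, the form in which rankings speak of
lines. -/
theorem verticalGraph_mk_eq_iff {u v : Fin n} :
    H.verticalGraph.connectedComponentMk u = H.verticalGraph.connectedComponentMk v ↔
      H.SameLine .north u v := by
  rw [SimpleGraph.ConnectedComponent.eq]
  have key : ∀ {u v}, Relation.ReflTransGen (H.Step .north) u v → H.verticalGraph.Reachable u v := by
    intro u v h
    induction h with
    | refl => exact .refl _
    | tail _ hs ih => exact ih.trans (SimpleGraph.Adj.reachable (.inl hs))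
  constructor
  · rintro ⟨p⟩
    induction p with
    | nil => exact .refl _ _
    | cons h p ih =>
      rcases h with h | h
      · exact SameLine.trans (Step.sameLine h) ih
      · exact SameLine.trans (Step.sameLine (d := .north) (step_opp_iff.1 h)).symm ih
  · rintro (h | h)
    · exact key h
    · exact (key h).symm

theorem horizontalGraph_mk_eq_iff {u v : Fin n} :
    H.horizontalGraph.connectedComponentMk u = H.horizontalGraph.connectedComponentMk v ↔
      H.SameLine .east u v := by
  rw [SimpleGraph.ConnectedComponent.eq]
  have key : ∀ {u v}, Relation.ReflTransGen (H.Step .east) u v →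
      H.horizontalGraph.Reachable u v := by
    intro u v h
    induction h with
    | refl => exact .refl _
    | tail _ hs ih => exact ih.trans (SimpleGraph.Adj.reachable (.inl hs))
  constructor
  · rintro ⟨p⟩
    induction p with
    | nil => exact .refl _ _
    | cons h p ih =>
      rcases h with h | h
      · exact SameLine.trans (Step.sameLine h) ih
      · exact SameLine.trans (Step.sameLine (d := .east) (step_opp_iff.1 h)).symm ih
  · rintro (h | h)
    · exact key h
    · exact (key h).symm

/-! ### Coordinates -/

/-- `x` and `y` are coordinates for which the edges of direction `e` go to the right and the edges
of direction `r` go up, without crossings. -/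
structure Frame (H : Shape n) (x y : Fin n → ℝ) (e r : Dir) : Prop where
  right : ∀ {u v}, H.Step e u v → x u < x v ∧ y u = y v
  up : ∀ {u v}, H.Step r u v → x u = x v ∧ y u < y v
  -- In each of the two conditions the contact point is interior to one of the edges, so that edges
  -- may still meet in common end-vertices.
  cross_right : ∀ {a b c d}, H.Step e a b → H.Step r c d → x a < x c → x c < x b →
    y c ≤ y a → y a ≤ y d → False
  cross_up : ∀ {a b c d}, H.Step e a b → H.Step r c d → x a ≤ x c → x c ≤ x b →
    y c < y a → y a < y d → False
  exhaust : ∀ d, d = e ∨ d = r ∨ d = e.opp ∨ d = r.opp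

variable {x y : Fin n → ℝ} {e r : Dir}

/-- Together with `Frame.flip` this generates the symmetries of the square, so that an argument for
one quadrant serves all four. -/
theorem Frame.transpose (F : Frame H x y e r) : Frame H y x r e where
  right h := ⟨(F.up h).2, (F.up h).1⟩
  up h := ⟨(F.right h).2, (F.right h).1⟩
  cross_right h h' h₁ h₂ h₃ h₄ := F.cross_up h' h h₃ h₄ h₁ h₂
  cross_up h h' h₁ h₂ h₃ h₄ := F.cross_right h' h h₃ h₄ h₁ h₂
  exhaust d := by have := F.exhaust d; tauto

theorem Frame.flip (F : Frame H x y e r) : Frame H (fun v => -x v) y e.opp r where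
  right h := by have := F.right (step_opp_iff.1 h); constructor <;> linarith
  up h := by have := F.up h; constructor <;> linarith
  cross_right h h' h₁ h₂ h₃ h₄ := by
    have := F.right (step_opp_iff.1 h)
    exact F.cross_right (step_opp_iff.1 h) h' (by linarith) (by linarith) (by linarith)
      (by linarith)
  cross_up h h' h₁ h₂ h₃ h₄ := by
    have := F.right (step_opp_iff.1 h)
    exact F.cross_up (step_opp_iff.1 h) h' (by linarith) (by linarith) (by linarith) (by linarith)
  exhaust d := by rw [Dir.opp_opp]; have := F.exhaust d; tauto

theorem Frame.le_of_chain (F : Frame H x y e r) {u v : Fin n}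
    (h : Relation.ReflTransGen (H.Step r) u v) : x u = x v ∧ y u ≤ y v := by
  induction h with
  | refl => exact ⟨rfl, le_rfl⟩
  | tail _ hs ih => exact ⟨ih.1.trans (F.up hs).1, ih.2.trans (F.up hs).2.le⟩

theorem Frame.eq_of_sameLine (F : Frame H x y e r) {u v : Fin n} (h : H.SameLine r u v) :
    x u = x v :=
  h.elim (fun h => (F.le_of_chain h).1) fun h => (F.le_of_chain h).1.symm

theorem Frame.exists_step (F : Frame H x y e r) {u v : Fin n} (h : H.SameLine r u v)
    (hy : y u < y v) : ∃ w, H.Step r u w ∧ y w ≤ y v := by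
  rcases h with h | h
  · rcases h.cases_head with rfl | ⟨c, hc, hcv⟩
    · exact absurd hy (lt_irrefl _)
    · exact ⟨c, hc, (F.le_of_chain hcv).2⟩
  · exact absurd (F.le_of_chain h).2 (not_le.2 hy)

theorem Frame.eq_of_eq (F : Frame H x y e r) {u v : Fin n} (h : H.SameLine r u v)
    (hy : y u = y v) : u = v := by
  wlog h' : Relation.ReflTransGen (H.Step r) u v generalizing u v
  · exact (this h.symm hy.symm (h.resolve_left h')).symm
  rcases h'.cases_head with rfl | ⟨c, hc, hcv⟩
  · rfl
  · have := (F.le_of_chain hcv).2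
    have := (F.up hc).2
    linarith

/-! ### Rankings -/

/-- `X` numbers the lines of direction `r` by `0, …, k - 1` such that an edge of direction `e` leads
from each line to the next one. -/
structure Ranking (H : Shape n) (e r : Dir) (X : Fin n → ℕ) (k : ℕ) : Prop where
  eq_iff : ∀ u v, X u = X v ↔ H.SameLine r u v
  lt : ∀ u, X u < k
  surj : ∀ i < k, ∃ u, X u = i
  next : ∀ i, i + 1 < k → ∃ u w, H.Step e u w ∧ X u = i ∧ X w = i + 1

/-- The edges between consecutive lines chain up to strict inequalities of coordinates. As this
holds in every frame, the order of the lines is the same in all drawings. -/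
theorem Ranking.lt_of_lt {X : Fin n → ℕ} {k : ℕ} (R : H.Ranking e r X k) (F : Frame H x y e r)
    {u v : Fin n} (h : X u < X v) : x u < x v := by
  obtain ⟨m, hm⟩ : ∃ m, X v = X u + 1 + m := ⟨X v - (X u + 1), by omega⟩
  induction m generalizing v with
  | zero =>
    obtain ⟨a, b, hab, ha, hb⟩ := R.next (X u) (by have := R.lt v; omega)
    have h₁ := F.eq_of_sameLine ((R.eq_iff a u).1 ha)
    have h₂ := F.eq_of_sameLine ((R.eq_iff b v).1 (by omega))
    have := (F.right hab).1
    linarith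
  | succ m ih =>
    obtain ⟨a, b, hab, ha, hb⟩ := R.next (X u + 1 + m) (by have := R.lt v; omega)
    have h₂ := F.eq_of_sameLine ((R.eq_iff b v).1 (by omega))
    have := (F.right hab).1
    have := ih (v := a) (by omega) ha
    linarith

theorem Ranking.eq_iff_eq {X : Fin n → ℕ} {k : ℕ} (R : H.Ranking e r X k) (F : Frame H x y e r)
    (u v : Fin n) : X u = X v ↔ x u = x v := by
  refine ⟨fun h => F.eq_of_sameLine ((R.eq_iff u v).1 h), fun h => ?_⟩
  rcases lt_trichotomy (X u) (X v) with h' | h' | h'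
  · exact absurd h (R.lt_of_lt F h').ne
  · exact h'
  · exact absurd h (R.lt_of_lt F h').ne'

theorem Ranking.lt_iff {X : Fin n → ℕ} {k : ℕ} (R : H.Ranking e r X k) (F : Frame H x y e r)
    (u v : Fin n) : X u < X v ↔ x u < x v := by
  refine ⟨R.lt_of_lt F, fun h => ?_⟩
  by_contra h'
  rcases (not_lt.1 h').eq_or_lt with h' | h'
  · exact h.ne' ((R.eq_iff_eq F v u).1 h')
  · exact lt_asymm h (R.lt_of_lt F h')

/-- The rank of a line is its index in the Hamiltonian path; conversely, listing the lines by rank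
gives the path. -/
theorem exists_ranking_iff {α : Type*} (D : Digraph α) (mk : Fin n → α)
    (hmk : Function.Surjective mk) (hline : ∀ u v, mk u = mk v ↔ H.SameLine r u v)
    (hadj : ∀ a b, D.Adj a b ↔ ∃ u v, H.Step e u v ∧ mk u = a ∧ mk v = b) :
    HasHamiltonianPath D ↔ ∃ X k, H.Ranking e r X k := by
  classical
  constructor
  · rintro ⟨l, hc, hn, ha⟩
    refine ⟨fun u => l.idxOf (mk u), l.length, ?_, ?_, ?_, ?_⟩
    · intro u v
      rw [← hline]
      exact List.idxOf_inj (ha _)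
    · intro u
      exact List.idxOf_lt_length_of_mem (ha _)
    · intro i hi
      obtain ⟨u, hu⟩ := hmk l[i]
      exact ⟨u, by simp only [hu]; exact hn.idxOf_getElem i hi⟩
    · intro i hi
      have := List.isChain_iff_getElem.1 hc i hi
      obtain ⟨u, v, huv, hu, hv⟩ := (hadj _ _).1 this
      exact ⟨u, v, huv, by simp only [hu]; exact hn.idxOf_getElem i _,
        by simp only [hv]; exact hn.idxOf_getElem (i + 1) hi⟩
  · rintro ⟨X, k, R⟩
    -- Extending the choice of a vertex of rank `i` to all natural numbers requires some vertex.
    rcases isEmpty_or_nonempty (Fin n) with h | h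
    · exact ⟨[], .nil, List.nodup_nil, fun a => (hmk a).elim fun u _ => isEmptyElim u⟩
    choose! f hf using R.surj
    refine ⟨(List.range k).map fun i => mk (f i), ?_, ?_, ?_⟩
    · rw [List.isChain_iff_getElem]
      intro i hi
      simp only [List.length_map, List.length_range] at hi
      simp only [List.getElem_map, List.getElem_range]
      obtain ⟨u, w, huw, hu, hw⟩ := R.next i hi
      refine (hadj _ _).2 ⟨u, w, huw, ?_, ?_⟩
      · rw [hline, ← R.eq_iff, hu, hf i (by omega)]
      · rw [hline, ← R.eq_iff, hw, hf (i + 1) (by omega)]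
    · refine List.Nodup.map_on ?_ List.nodup_range
      intro i hi j hj hij
      rw [List.mem_range] at hi hj
      rw [hline, ← R.eq_iff, hf i hi, hf j hj] at hij
      exact hij
    · intro a
      obtain ⟨u, rfl⟩ := hmk a
      refine List.mem_map.2 ⟨X u, List.mem_range.2 (R.lt u), ?_⟩
      rw [hline, ← R.eq_iff, hf _ (R.lt u)]

theorem hasHamiltonianPath_dagX_iff :
    HasHamiltonianPath H.dagX ↔ ∃ X k, H.Ranking .east .north X k :=
  exists_ranking_iff H.dagX H.verticalGraph.connectedComponentMk Quot.mk_surjective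
    (fun _ _ => verticalGraph_mk_eq_iff) fun _ _ => Iff.rfl

theorem hasHamiltonianPath_dagY_iff :
    HasHamiltonianPath H.dagY ↔ ∃ X k, H.Ranking .north .east X k :=
  exists_ranking_iff H.dagY H.horizontalGraph.connectedComponentMk Quot.mk_surjective
    (fun _ _ => horizontalGraph_mk_eq_iff) fun _ _ => Iff.rfl

end Shape
/-! ### Drawings in coordinates -/

open Set in
-- One coordinate is constant on the segment, so any convex weights suit it and those of the other
-- coordinate can be used for both.
theorem mem_segment_iff_of_axisParallel {a b p : Plane} (h : a 0 = b 0 ∨ a 1 = b 1) :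
    p ∈ segment ℝ a b ↔ p 0 ∈ uIcc (a 0) (b 0) ∧ p 1 ∈ uIcc (a 1) (b 1) := by
  rw [← segment_eq_uIcc, ← segment_eq_uIcc]
  constructor
  · rintro ⟨s, t, hs, ht, hst, rfl⟩
    exact ⟨⟨s, t, hs, ht, hst, by simp⟩, ⟨s, t, hs, ht, hst, by simp⟩⟩
  · rintro ⟨⟨s, t, hs, ht, hst, h₀⟩, ⟨s', t', hs', ht', hst', h₁⟩⟩
    simp only [smul_eq_mul] at h₀ h₁
    rcases h with h | h
    · refine ⟨s', t', hs', ht', hst', ?_⟩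
      ext i
      fin_cases i
      · simp only [Fin.zero_eta, PiLp.add_apply, PiLp.smul_apply, smul_eq_mul]
        rw [← h₀, ← h, ← add_mul, ← add_mul, hst, hst']
      · simpa using h₁
    · refine ⟨s, t, hs, ht, hst, ?_⟩
      ext i
      fin_cases i
      · simpa using h₀
      · simp only [Fin.mk_one, PiLp.add_apply, PiLp.smul_apply, smul_eq_mul]
        rw [← h₁, ← h, ← add_mul, ← add_mul, hst, hst']

theorem plane_ext {p q : Plane} (h₀ : p 0 = q 0) (h₁ : p 1 = q 1) : p = q := by
  ext i
  fin_cases i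
  · exact h₀
  · exact h₁

theorem dist_lt_dist_iff (p q r : Plane) : dist p r < dist q r ↔
    (p 0 - r 0) ^ 2 + (p 1 - r 1) ^ 2 < (q 0 - r 0) ^ 2 + (q 1 - r 1) ^ 2 := by
  rw [EuclideanSpace.dist_eq, EuclideanSpace.dist_eq, Real.sqrt_lt_sqrt_iff (by positivity)]
  simp [Fin.sum_univ_two, Real.dist_eq, sq_abs]

/-! ### Stretching the coordinate axes -/

theorem exists_stretch (c : ℝ) {A B : ℝ} (hA : 0 < A) (hB : 0 < B) :
    ∃ φ : ℝ ≃o ℝ, (∀ t ≤ c, φ t = c + A * (t - c)) ∧ ∀ t, c ≤ t → φ t = c + B * (t - c) := by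
  have hf : StrictMono fun t : ℝ => if t ≤ c then c + A * (t - c) else c + B * (t - c) := by
    intro s t hst
    dsimp only
    split_ifs with h₁ h₂ h₂
    · have := mul_pos hA (sub_pos.2 hst); linarith
    · have := mul_nonneg hA.le (sub_nonneg.2 h₁)
      have := mul_pos hB (sub_pos.2 (not_le.1 h₂)); linarith
    · linarith
    · have := mul_pos hB (sub_pos.2 hst); linarith
  have hs : Function.Surjective fun t : ℝ =>
      if t ≤ c then c + A * (t - c) else c + B * (t - c) := by
    intro t
    rcases le_or_gt t c with h | h
    · refine ⟨c + (t - c) / A, ?_⟩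
      have : (t - c) / A ≤ 0 := div_nonpos_of_nonpos_of_nonneg (by linarith) hA.le
      dsimp only
      rw [if_pos (by linarith)]
      field_simp
      ring
    · refine ⟨c + (t - c) / B, ?_⟩
      have : 0 < (t - c) / B := div_pos (by linarith) hB
      dsimp only
      rw [if_neg (by linarith)]
      field_simp
      ring
  refine ⟨hf.orderIsoOfSurjective _ hs, fun t ht => ?_, fun t ht => ?_⟩
  · simp [ht]
  · rcases ht.eq_or_lt with rfl | ht
    · simp
    · simp [not_le.2 ht]

open Set in
/-- All values outside the interval between `a` and `c` can be moved away from `c`. -/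
theorem exists_stretch_away {ι : Type*} [Finite ι] (f : ι → ℝ) (a c : ℝ) :
    ∃ φ : ℝ ≃o ℝ, ∀ i, f i ∉ uIcc a c → (φ a - φ c) ^ 2 ≤ (φ (f i) - φ c) ^ 2 := by
  rcases le_total a c with h | h
  -- The side of `c` that contains `a` is left alone. The other side is scaled by a factor of at
  -- least `(c - a) / (f i - c)` for each `f i` there, which puts it at distance at least `c - a`.
  -- The maximum with `1` keeps the factor positive.
  · obtain ⟨M, hM⟩ := Finite.exists_le fun i => (c - a) / (f i - c)
    obtain ⟨φ, h₁, h₂⟩ := exists_stretch c zero_lt_one (lt_max_of_lt_right zero_lt_one : 0 < max M 1)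
    refine ⟨φ, fun i hi => ?_⟩
    rw [uIcc_of_le h, mem_Icc, not_and_or, not_le, not_le] at hi
    rw [h₁ a h, h₁ c le_rfl]
    rcases hi with hi | hi
    · rw [h₁ _ (by linarith)]
      nlinarith
    · rw [h₂ _ hi.le]
      have h₃ : c - a ≤ max M 1 * (f i - c) :=
        (div_le_iff₀ (by linarith)).1 ((hM i).trans (le_max_left _ _))
      nlinarith
  · obtain ⟨M, hM⟩ := Finite.exists_le fun i => (a - c) / (c - f i)
    obtain ⟨φ, h₁, h₂⟩ := exists_stretch c (lt_max_of_lt_right zero_lt_one : 0 < max M 1) zero_lt_one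
    refine ⟨φ, fun i hi => ?_⟩
    rw [uIcc_of_ge h, mem_Icc, not_and_or, not_le, not_le] at hi
    rw [h₂ a h, h₂ c le_rfl]
    rcases hi with hi | hi
    · rw [h₁ _ hi.le]
      have h₃ : a - c ≤ max M 1 * (c - f i) :=
        (div_le_iff₀ (by linarith)).1 ((hM i).trans (le_max_left _ _))
      nlinarith
    · rw [h₂ _ (by linarith)]
      nlinarith

namespace Shape

variable {n : ℕ} {H : Shape n} {pos : Fin n → Plane}

theorem IsDrawing.east (h : H.IsDrawing pos) {u v : Fin n} (hs : H.Step .east u v) :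
    pos u 0 < pos v 0 ∧ pos u 1 = pos v 1 := h.direction u v _ hs

theorem IsDrawing.north (h : H.IsDrawing pos) {u v : Fin n} (hs : H.Step .north u v) :
    pos u 0 = pos v 0 ∧ pos u 1 < pos v 1 := h.direction u v _ hs

theorem adj_iff {u v : Fin n} : H.graph.Adj u v ↔ H.Step .east u v ∨ H.Step .east v u ∨
    H.Step .north u v ∨ H.Step .north v u := by
  constructor
  · rintro ⟨d, h⟩
    cases d
    · exact .inl h
    · exact .inr (.inr (.inl h))
    · exact .inr (.inl (H.nbr_opp u v _ h))
    · exact .inr (.inr (.inr (H.nbr_opp u v _ h)))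
  · rintro (h | h | h | h)
    exacts [⟨_, h⟩, ⟨_, h.opp⟩, ⟨_, h⟩, ⟨_, h.opp⟩]

theorem Step.adj {d : Dir} {u v : Fin n} (h : H.Step d u v) : H.graph.Adj u v := ⟨d, h⟩

theorem IsDrawing.axisParallel (h : H.IsDrawing pos) {u v : Fin n} (huv : H.graph.Adj u v) :
    pos u 0 = pos v 0 ∨ pos u 1 = pos v 1 := by
  rcases adj_iff.1 huv with hs | hs | hs | hs
  · exact .inr (h.east hs).2
  · exact .inr (h.east hs).2.symm
  · exact .inl (h.north hs).1
  · exact .inl (h.north hs).1.symm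

open Set in
theorem IsDrawing.mem_segment_iff (h : H.IsDrawing pos) {u v : Fin n} (huv : H.graph.Adj u v)
    {p : Plane} : p ∈ segment ℝ (pos u) (pos v) ↔
      p 0 ∈ uIcc (pos u 0) (pos v 0) ∧ p 1 ∈ uIcc (pos u 1) (pos v 1) :=
  mem_segment_iff_of_axisParallel (h.axisParallel huv)

theorem IsDrawing.no_crossing (h : H.IsDrawing pos) {a b c d : Fin n} (hab : H.Step .east a b)
    (hcd : H.Step .north c d) (h₁ : pos a 0 ≤ pos c 0) (h₂ : pos c 0 ≤ pos b 0)
    (h₃ : pos c 1 ≤ pos a 1) (h₄ : pos a 1 ≤ pos d 1) :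
    (a = c ∨ a = d ∨ b = c ∨ b = d) := by
  have h₅ := h.east hab
  have h₆ := h.north hcd
  have hne : s(a, b) ≠ s(c, d) := by
    intro he
    rcases Sym2.eq_iff.1 he with ⟨rfl, rfl⟩ | ⟨rfl, rfl⟩ <;> linarith
  obtain ⟨t, ht, ht', -⟩ := h.planar a b c d hab.adj hcd.adj hne !₂[pos c 0, pos a 1]
    ((h.mem_segment_iff hab.adj).2 ⟨by simpa using Set.mem_uIcc.2 (.inl ⟨h₁, h₂⟩),
      by simp⟩)
    ((h.mem_segment_iff hcd.adj).2 ⟨by simp,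
      by simpa using Set.mem_uIcc.2 (.inl ⟨h₃, h₄⟩)⟩)
  rw [Sym2.mem_iff] at ht ht'
  rcases ht with rfl | rfl <;> rcases ht' with rfl | rfl <;> simp

theorem IsDrawing.frame (h : H.IsDrawing pos) :
    H.Frame (fun v => pos v 0) (fun v => pos v 1) .east .north where
  right hs := h.east hs
  up hs := h.north hs
  cross_right hab hcd h₁ h₂ h₃ h₄ := by
    have h₅ := h.east hab
    have h₆ := h.north hcd
    rcases h.no_crossing hab hcd h₁.le h₂.le h₃ h₄ with rfl | rfl | rfl | rfl <;> linarith
  cross_up hab hcd h₁ h₂ h₃ h₄ := by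
    have h₅ := h.east hab
    have h₆ := h.north hcd
    rcases h.no_crossing hab hcd h₁ h₂ h₃.le h₄.le with rfl | rfl | rfl | rfl <;> linarith
  exhaust d := by cases d <;> simp [Dir.opp]

open Set in
/-- Order isomorphisms of the coordinate axes turn drawings into drawings. -/
theorem IsDrawing.reparametrize (h : H.IsDrawing pos) (φ ψ : ℝ ≃o ℝ) :
    H.IsDrawing fun v => !₂[φ (pos v 0), ψ (pos v 1)] := by
  have key : ∀ {u v}, H.graph.Adj u v → ∀ {p : Plane},
      p ∈ segment ℝ (!₂[φ (pos u 0), ψ (pos u 1)] : Plane) !₂[φ (pos v 0), ψ (pos v 1)] →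
        (!₂[φ.symm (p 0), ψ.symm (p 1)] : Plane) ∈ segment ℝ (pos u) (pos v) := by
    intro u v huv p hp
    rw [mem_segment_iff_of_axisParallel (by simpa using h.axisParallel huv)] at hp
    rw [h.mem_segment_iff huv]
    simpa [mem_uIcc, OrderIso.symm_apply_le, OrderIso.le_symm_apply] using hp
  refine ⟨fun u v huv => h.injective ?_, fun u v d hd => ?_, fun u v w z huv hwz hne p hp hp' => ?_⟩
  · have h₀ := congrArg (fun p : Plane => p 0) huv
    have h₁ := congrArg (fun p : Plane => p 1) huv
    exact plane_ext (by simpa using h₀) (by simpa using h₁)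
  · have := h.direction u v d hd
    cases d <;> simpa [Dir.Holds] using this
  · obtain ⟨t, ht, ht', he⟩ := h.planar u v w z huv hwz hne _ (key huv hp) (key hwz hp')
    refine ⟨t, ht, ht', ?_⟩
    rw [← he]
    apply plane_ext <;> simp

/-! ### Greediness of all drawings as box-connectedness -/

open Set in
/-- From every vertex, there is a step towards any other vertex within the bounding box of the two
vertices. -/
def IsBoxConnected (H : Shape n) (pos : Fin n → Plane) : Prop :=
  ∀ u v, u ≠ v → ∃ w, H.graph.Adj u w ∧
    pos w 0 ∈ uIcc (pos u 0) (pos v 0) ∧ pos w 1 ∈ uIcc (pos u 1) (pos v 1)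

open Set in
theorem IsDrawing.dist_lt_of_mem_box (h : H.IsDrawing pos) {u v w : Fin n}
    (huw : H.graph.Adj u w) (h₀ : pos w 0 ∈ uIcc (pos u 0) (pos v 0))
    (h₁ : pos w 1 ∈ uIcc (pos u 1) (pos v 1)) : dist (pos w) (pos v) < dist (pos u) (pos v) := by
  rw [dist_lt_dist_iff]
  have hne : pos u ≠ pos w := fun he => huw.ne (h.injective he)
  have key : ∀ {a b c : ℝ}, b ∈ uIcc a c → a ≠ b → (b - c) ^ 2 < (a - c) ^ 2 := by
    intro a b c hb hab
    rcases mem_uIcc.1 hb with ⟨h₁, h₂⟩ | ⟨h₁, h₂⟩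
    · have := h₁.lt_of_ne hab; nlinarith
    · have := h₂.lt_of_ne hab.symm; nlinarith
  rcases h.axisParallel huw with he | he
  · rw [he]
    have := key h₁ fun h' => hne (plane_ext he h')
    linarith
  · rw [he]
    have := key h₀ fun h' => hne (plane_ext h' he)
    linarith

theorem IsBoxConnected.isGreedyDrawing (hb : H.IsBoxConnected pos) (h : H.IsDrawing pos) :
    H.IsGreedyDrawing pos := by
  intro u v
  -- The path is also required to stay no farther from `v` than its start. Then a farther vertex can
  -- be prepended without being repeated.
  suffices hs : ∃ p : H.graph.Walk u v, p.IsPath ∧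
      (∀ z ∈ p.support, dist (pos z) (pos v) ≤ dist (pos u) (pos v)) ∧
      ∀ i < p.length, dist (pos (p.getVert (i + 1))) (pos v) < dist (pos (p.getVert i)) (pos v) by
    obtain ⟨p, hp, -, hd⟩ := hs
    exact ⟨p, hp, hd⟩
  have hwf : WellFounded fun a b : Fin n => dist (pos a) (pos v) < dist (pos b) (pos v) :=
    @Finite.wellFounded_of_trans_of_irrefl _ _ _ ⟨fun _ _ _ => lt_trans⟩ ⟨fun _ => lt_irrefl _⟩
  induction u using hwf.induction with
  | _ u ih =>
    rcases eq_or_ne u v with rfl | huv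
    · exact ⟨.nil, .nil, by simp, by simp⟩
    · obtain ⟨w, huw, h₀, h₁⟩ := hb u v huv
      have hlt := h.dist_lt_of_mem_box huw h₀ h₁
      obtain ⟨p, hp, hle, hd⟩ := ih w hlt
      refine ⟨.cons huw p, ?_, ?_, ?_⟩
      · rw [SimpleGraph.Walk.cons_isPath_iff]
        exact ⟨hp, fun hu => absurd (hle u hu) (not_le.2 hlt)⟩
      · intro z hz
        rw [SimpleGraph.Walk.support_cons, List.mem_cons] at hz
        rcases hz with rfl | hz
        · exact le_rfl
        · exact (hle z hz).trans hlt.le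
      · rintro (_ | i) hi
        · simpa using hlt
        · simpa using hd i (by simpa using hi)

end Shape

open Set in
-- Otherwise the stretched drawing makes `u` a local minimum of the distance to `v` among its
-- neighbours, so that no greedy path has a first edge.
theorem RectilinearRep.UniversalGreedy.isBoxConnected {n : ℕ} {H : RectilinearRep n}
    (hg : H.UniversalGreedy) {pos : Fin n → Plane} (h : H.IsDrawing pos) :
    H.IsBoxConnected pos := by
  intro u v huv
  by_contra hbox
  push Not at hbox
  obtain ⟨φ, hφ⟩ := exists_stretch_away (fun w => pos w 0) (pos u 0) (pos v 0)
  obtain ⟨ψ, hψ⟩ := exists_stretch_away (fun w => pos w 1) (pos u 1) (pos v 1)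
  obtain ⟨p, -, hd⟩ := hg _ (h.reparametrize φ ψ) u v
  cases p with
  | nil => exact huv rfl
  | @cons _ w _ huw p =>
    have hlt := hd 0 (by simp)
    rw [dist_lt_dist_iff] at hlt
    simp only [SimpleGraph.Walk.getVert_cons_succ, SimpleGraph.Walk.getVert_zero,
      Matrix.cons_val_zero, Matrix.cons_val_one, zero_add] at hlt
    -- The edge keeps one coordinate, which therefore lies in its interval. So the other coordinate
    -- lies outside, where the stretching applies.
    have hw := hbox w huw
    rcases h.axisParallel huw with he | he
    · have := hψ w (hw (by simp [← he]))
      rw [← he] at hlt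
      linarith
    · have := hφ w fun h' => hw h' (by simp [← he])
      rw [← he] at hlt
      linarith

theorem RectilinearRep.universalGreedy_iff {n : ℕ} {H : RectilinearRep n} :
    H.UniversalGreedy ↔ ∀ pos, H.IsDrawing pos → H.IsBoxConnected pos :=
  ⟨fun hg _ h => hg.isBoxConnected h, fun hb pos h => (hb pos h).isGreedyDrawing h⟩

namespace Shape

variable {n : ℕ} {H : Shape n} {x y : Fin n → ℝ} {e r : Dir}

/-! ### Box-connected drawings are ranked and have no reflex corners facing a vertex -/

theorem wellFounded_lt_comp {ι : Type*} [Finite ι] (f : ι → ℝ) :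
    WellFounded fun a b => f a < f b :=
  @Finite.wellFounded_of_trans_of_irrefl _ _ _ ⟨fun _ _ _ => lt_trans⟩ ⟨fun _ => lt_irrefl _⟩

theorem Frame.adj_cases (F : Frame H x y e r) {u w : Fin n} (h : H.graph.Adj u w) :
    H.Step e u w ∨ H.Step e w u ∨ H.Step r u w ∨ H.Step r w u := by
  obtain ⟨d, hd⟩ := h
  rcases F.exhaust d with rfl | rfl | rfl | rfl
  · exact .inl hd
  · exact .inr (.inr (.inl hd))
  · exact .inr (.inl (step_opp_iff.1 hd))
  · exact .inr (.inr (.inr (step_opp_iff.1 hd)))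

open Set in
-- The sum of the coordinate distances is the measure for recursion along box steps.
theorem Frame.dist_lt_of_mem_box (F : Frame H x y e r) {u v w : Fin n} (h : H.graph.Adj u w)
    (h₀ : x w ∈ uIcc (x u) (x v)) (h₁ : y w ∈ uIcc (y u) (y v)) :
    |x w - x v| + |y w - y v| < |x u - x v| + |y u - y v| := by
  have hle : ∀ {a b c : ℝ}, b ∈ uIcc a c → |b - c| ≤ |a - c| := by
    intro a b c hb
    rw [uIcc_comm] at hb
    rw [abs_sub_comm b, abs_sub_comm a]
    simpa [abs_sub_comm] using abs_sub_left_of_mem_uIcc hb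
  have hlt : ∀ {a b c : ℝ}, b ∈ uIcc a c → a ≠ b → |b - c| < |a - c| := by
    intro a b c hb hab
    rcases mem_uIcc.1 hb with ⟨h₁, h₂⟩ | ⟨h₁, h₂⟩
    · rw [abs_of_nonpos (by linarith), abs_of_nonpos (by linarith)]
      have := h₁.lt_of_ne hab; linarith
    · rw [abs_of_nonneg (by linarith), abs_of_nonneg (by linarith)]
      have := h₂.lt_of_ne hab.symm; linarith
  rcases F.adj_cases h with hs | hs | hs | hs
  · exact add_lt_add_of_lt_of_le (hlt h₀ (F.right hs).1.ne) (hle h₁)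
  · exact add_lt_add_of_lt_of_le (hlt h₀ (F.right hs).1.ne') (hle h₁)
  · exact add_lt_add_of_le_of_lt (hle h₀) (hlt h₁ (F.up hs).2.ne)
  · exact add_lt_add_of_le_of_lt (hle h₀) (hlt h₁ (F.up hs).2.ne')

open Set in
-- The rank is the number of smaller `x`-coordinates. Between vertices with equal `x` the box is a
-- segment, so box steps follow a single line. From a vertex of rank `i` towards one of rank `i +
-- 1`, box steps visit no other ranks, and the step that changes the rank is the edge required by
-- `next`.
theorem Frame.exists_ranking (F : Frame H x y e r)
    (hb : ∀ u v, u ≠ v → ∃ w, H.graph.Adj u w ∧ x w ∈ uIcc (x u) (x v) ∧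
      y w ∈ uIcc (y u) (y v)) : ∃ X k, H.Ranking e r X k := by
  classical
  have hwf := fun v => wellFounded_lt_comp fun u => |x u - x v| + |y u - y v|
  set A : Finset ℝ := Finset.univ.image x with hA
  set f : ℝ → ℕ := fun a => (A.filter (· < a)).card with hf
  have hmono : Monotone f := fun a b hab =>
    Finset.card_le_card fun c hc => by
      simp only [Finset.mem_filter] at hc ⊢
      exact ⟨hc.1, hc.2.trans_le hab⟩
  have hmem : ∀ u, x u ∈ A := fun u => Finset.mem_image_of_mem x (Finset.mem_univ u)
  have hstrict : ∀ a ∈ A, ∀ b, a < b → f a < f b := by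
    intro a ha b hab
    refine Finset.card_lt_card ⟨fun c hc => ?_, fun hsub => ?_⟩
    · simp only [Finset.mem_filter] at hc ⊢
      exact ⟨hc.1, hc.2.trans hab⟩
    · have := hsub (Finset.mem_filter.2 ⟨ha, hab⟩)
      simp at this
  have hle : ∀ u v, f (x u) ≤ f (x v) ↔ x u ≤ x v := fun u v =>
    ⟨fun h => not_lt.1 fun h' => absurd (hstrict _ (hmem v) _ h') (not_lt.2 h), fun h => hmono h⟩
  have heq : ∀ u v, f (x u) = f (x v) ↔ x u = x v := fun u v => by
    rw [le_antisymm_iff, hle, hle, ← le_antisymm_iff]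
  have hlt : ∀ u, f (x u) < A.card := fun u =>
    Finset.card_lt_card ⟨Finset.filter_subset _ _, fun hsub => by
      simpa using hsub (hmem u)⟩
  -- `f` is injective on `A` with values below `A.card`, hence it takes all of these values.
  have himg : A.image f = Finset.range A.card := by
    refine Finset.eq_of_subset_of_card_le (fun i hi => ?_) ?_
    · obtain ⟨a, ha, rfl⟩ := Finset.mem_image.1 hi
      obtain ⟨u, -, rfl⟩ := Finset.mem_image.1 ha
      exact Finset.mem_range.2 (hlt u)
    · have hinj : Set.InjOn f A := by
        intro a ha b hb' hab
        obtain ⟨u, -, rfl⟩ := Finset.mem_image.1 ha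
        obtain ⟨v, -, rfl⟩ := Finset.mem_image.1 hb'
        exact (heq u v).1 hab
      rw [Finset.card_range]
      exact (Finset.card_image_of_injOn hinj).ge
  have hsurj : ∀ i < A.card, ∃ u, f (x u) = i := by
    intro i hi
    rw [← Finset.mem_range, ← himg] at hi
    obtain ⟨a, ha, rfl⟩ := Finset.mem_image.1 hi
    obtain ⟨u, -, rfl⟩ := Finset.mem_image.1 ha
    exact ⟨u, rfl⟩
  refine ⟨fun u => f (x u), A.card, ⟨fun u v => ?_, hlt, hsurj, fun i hi => ?_⟩⟩
  · rw [heq]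
    refine ⟨fun h => ?_, F.eq_of_sameLine⟩
    induction u using (hwf v).induction with
    | _ u ih =>
      rcases eq_or_ne u v with rfl | huv
      · exact .refl _ _
      obtain ⟨w, huw, h₀, h₁⟩ := hb u v huv
      have hd := F.dist_lt_of_mem_box huw h₀ h₁
      rw [h, uIcc_self, mem_singleton_iff] at h₀
      have ihw := ih w hd h₀
      rcases F.adj_cases huw with hs | hs | hs | hs
      · exact absurd (F.right hs).1 (by linarith)
      · exact absurd (F.right hs).1 (by linarith)
      · exact hs.sameLine.trans ihw
      · exact hs.sameLine.symm.trans ihw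
  · obtain ⟨v, hv⟩ := hsurj (i + 1) hi
    obtain ⟨u, hu⟩ := hsurj i (by omega)
    induction u using (hwf v).induction with
    | _ u ih =>
      have huv : x u < x v := by
        by_contra hc
        have := (hle v u).2 (not_lt.1 hc)
        omega
      obtain ⟨w, huw, h₀, h₁⟩ := hb u v (by rintro rfl; exact lt_irrefl _ huv)
      have hd := F.dist_lt_of_mem_box huw h₀ h₁
      rw [uIcc_of_le huv.le] at h₀
      have h₂ := (hle u w).2 h₀.1
      have h₃ := (hle w v).2 h₀.2
      rcases eq_or_ne (f (x w)) i with hw | hw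
      · exact ih w hd hw
      · rcases F.adj_cases huw with hs | hs | hs | hs
        · exact ⟨u, w, hs, hu, by omega⟩
        · exact absurd (F.right hs).1 (not_lt.2 h₀.1)
        · exact absurd (congrArg f (F.up hs).1) (by omega)
        · exact absurd (congrArg f (F.up hs).1) (by omega)

open Set in
/-- In a box-connected drawing, no vertex lies in the quadrant spanned by two directions in which no
edges leave. -/
theorem Frame.corner (F : Frame H x y e r)
    (hb : ∀ u v, u ≠ v → ∃ w, H.graph.Adj u w ∧ x w ∈ uIcc (x u) (x v) ∧
      y w ∈ uIcc (y u) (y v)) {u v : Fin n} (he : H.nbr u e = none) (hr : H.nbr u r = none)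
    (h₀ : x u ≤ x v) (h₁ : y u ≤ y v) : v = u := by
  by_contra hne
  obtain ⟨w, huw, hx, hy⟩ := hb u v (Ne.symm hne)
  rw [uIcc_of_le h₀] at hx
  rw [uIcc_of_le h₁] at hy
  rcases F.adj_cases huw with hs | hs | hs | hs
  · simp [Step, he] at hs
  · exact absurd (F.right hs).1 (not_lt.2 hx.1)
  · simp [Step, hr] at hs
  · exact absurd (F.up hs).2 (not_lt.2 hy.1)

/-! ### Ranked drawings without reflex corners facing a vertex are box-connected -/

theorem sameLine_opp {d : Dir} {u v : Fin n} : H.SameLine d.opp u v ↔ H.SameLine d u v := by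
  have key : ∀ {d : Dir} {u v : Fin n}, Relation.ReflTransGen (H.Step d) u v →
      Relation.ReflTransGen (H.Step d.opp) v u := by
    intro d u v h
    induction h with
    | refl => exact .refl
    | tail _ hs ih => exact ih.head hs.opp
  constructor
  · rintro (h | h)
    · right; simpa [Dir.opp_opp] using key h
    · left; simpa [Dir.opp_opp] using key h
  · rintro (h | h)
    · exact .inr (key h)
    · exact .inl (key h)

theorem Ranking.opp_right {X : Fin n → ℕ} {k : ℕ} (R : H.Ranking e r X k) :
    H.Ranking e r.opp X k :=
  ⟨fun u v => by rw [R.eq_iff, sameLine_opp], R.lt, R.surj, R.next⟩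

theorem Ranking.opp_left {X : Fin n → ℕ} {k : ℕ} (R : H.Ranking e r X k) :
    H.Ranking e.opp r (fun u => k - 1 - X u) k where
  eq_iff u v := by
    have := R.lt u
    have := R.lt v
    rw [← R.eq_iff]
    omega
  lt u := by have := R.lt u; omega
  surj i hi := by
    obtain ⟨u, hu⟩ := R.surj (k - 1 - i) (by omega)
    exact ⟨u, by omega⟩
  next i hi := by
    obtain ⟨u, w, h, hu, hw⟩ := R.next (k - 1 - (i + 1)) (by omega)
    exact ⟨w, u, h.opp, by omega, by omega⟩

/-- No vertex lies in the open quadrant of directions `e` and `r` at a vertex that has no edges in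
these directions. -/
def CornerFree (H : Shape n) (x y : Fin n → ℝ) (e r : Dir) : Prop :=
  ∀ u v, H.nbr u e = none → H.nbr u r = none → x u < x v → y u < y v → False

theorem Frame.exists_crossing_step (F : Frame H x y e r) {u v : Fin n} {t : ℝ}
    (h : H.SameLine r u v) (hu : y u < t) (hv : t ≤ y v) :
    ∃ c d, H.Step r c d ∧ y c < t ∧ t ≤ y d ∧ x c = x u := by
  rcases h with h | h
  · induction h with
    | refl => exact absurd hu (not_lt.2 hv)
    | @tail b c hb hs ih =>
      rcases le_or_gt t (y b) with hb' | hb'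
      · exact ih hb'
      · exact ⟨b, c, hs, hb', hv, (F.le_of_chain hb).1.symm⟩
  · have := (F.le_of_chain h).2
    linarith

/-- Induction on the rank of `z`. The ranking supplies an edge from `a` on the preceding line to `b`
on the line of `z`, and `a` is lower than `u`: by induction, or because `u` is the top of its line
and its own edge skips the line of `z`. So the line of `z` has a vertex below the edge `uw`, and it
could reach the height of `u` only by crossing this edge. -/
theorem Frame.below_long_step (F : Frame H x y e r) {X : Fin n → ℕ} {k : ℕ}
    (R : H.Ranking e r X k) {u w z : Fin n} (huw : H.Step e u w) (hu : H.nbr u r = none)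
    (h₁ : x u < x z) (h₂ : x z < x w) : y z < y u := by
  obtain ⟨m, hm⟩ : ∃ m, X z = X u + m + 1 :=
    ⟨X z - X u - 1, by have := (R.lt_iff F u z).2 h₁; omega⟩
  induction m using Nat.strong_induction_on generalizing z with
  | _ m ih =>
    obtain ⟨a, b, hab, ha, hb⟩ := R.next (X u + m) (by have := R.lt z; omega)
    have hbz : H.SameLine r b z := (R.eq_iff b z).1 (by omega)
    have hxb := F.eq_of_sameLine hbz
    have hyab := F.right hab
    have hau : y a < y u := by
      rcases Nat.eq_zero_or_pos m with rfl | hm0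
      · have hua : H.SameLine r u a := (R.eq_iff u a).1 (by omega)
        refine lt_of_le_of_ne (not_lt.1 fun hlt => ?_) fun he => ?_
        · obtain ⟨c, hc, -⟩ := F.exists_step hua hlt
          simp [Step, hu] at hc
        · obtain rfl := F.eq_of_eq hua he.symm
          obtain rfl := hab.right_unique huw
          linarith
      · exact ih (m - 1) (by omega) ((R.lt_iff F u a).1 (by omega)) (by linarith) (by omega)
    by_contra hz
    obtain ⟨c, d, hcd, hc, hd, hx⟩ :=
      F.exists_crossing_step (t := y u) hbz (by linarith) (not_lt.1 hz)
    exact F.cross_right huw hcd (by linarith) (by linarith) hc.le hd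

/-- A vertex of the rectangle with minimal `x + y` has no edges in the two opposite directions: such
an edge would lead to a smaller vertex of the rectangle or run into one of the two edges at `u`. So
it would be a corner that faces `u`. This is why the corner condition of the opposite quadrant is
needed. -/
theorem Frame.empty_rectangle (F : Frame H x y e r)
    (hC : H.CornerFree (fun v => -x v) (fun v => -y v) e.opp r.opp) {u w z v : Fin n}
    (huw : H.Step e u w) (huz : H.Step r u z) (h₁ : x u < x v) (h₂ : x v < x w) (h₃ : y u < y v)
    (h₄ : y v < y z) : False := by
  induction v using (wellFounded_lt_comp fun v => x v + y v).induction with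
  | _ v ih =>
    refine hC v u ?_ ?_ (by simpa using h₁) (by simpa using h₃)
    · rw [Option.eq_none_iff_forall_ne_some]
      intro a ha
      have hs : H.Step e a v := step_opp_iff.1 ha
      have := F.right hs
      rcases le_or_gt (x a) (x u) with hau | hau
      · exact F.cross_up hs huz hau h₁.le (by linarith) (by linarith)
      · exact ih a (by linarith) hau (by linarith) (by linarith) (by linarith)
    · rw [Option.eq_none_iff_forall_ne_some]
      intro c hc
      have hs : H.Step r c v := step_opp_iff.1 hc
      have := F.up hs
      rcases le_or_gt (y c) (y u) with hcu | hcu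
      · exact F.cross_right huw hs (by linarith) (by linarith) hcu h₃.le
      · exact ih c (by linarith) (by linarith) (by linarith) hcu (by linarith)

/-- In a degenerate box one follows the common line. In a proper box, suppose that the edges of `u`
in directions `e` and `r` all overshoot `v`. If there is none, corner-freeness fails; if there is
one, `below_long_step` puts `v` on the wrong side of it; if there are two, `v` lies in the rectangle
excluded by `empty_rectangle`. -/
theorem Frame.exists_box_step (F : Frame H x y e r) {X Y : Fin n → ℕ} {k l : ℕ}
    (RX : H.Ranking e r X k) (RY : H.Ranking r e Y l) (h₁ : H.CornerFree x y e r)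
    (h₂ : H.CornerFree (fun v => -x v) (fun v => -y v) e.opp r.opp) {u v : Fin n} (huv : u ≠ v)
    (hx : x u ≤ x v) (hy : y u ≤ y v) :
    ∃ w, H.graph.Adj u w ∧ (x u ≤ x w ∧ x w ≤ x v) ∧ (y u ≤ y w ∧ y w ≤ y v) := by
  rcases hx.eq_or_lt with hx' | hx'
  · have hs := (RX.eq_iff u v).1 ((RX.eq_iff_eq F u v).2 hx')
    obtain ⟨w, hw, hwv⟩ := F.exists_step hs (hy.lt_of_ne fun h => huv (F.eq_of_eq hs h))
    have := F.up hw
    exact ⟨w, hw.adj, ⟨this.1.le, by linarith⟩, this.2.le, hwv⟩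
  rcases hy.eq_or_lt with hy' | hy'
  · have hs := (RY.eq_iff u v).1 ((RY.eq_iff_eq F.transpose u v).2 hy')
    obtain ⟨w, hw, hwv⟩ := F.transpose.exists_step hs hx'
    have := F.right hw
    exact ⟨w, hw.adj, ⟨this.1.le, hwv⟩, this.2.le, by linarith⟩
  by_contra hcon
  push Not at hcon
  have hE : ∀ w, H.Step e u w → x v < x w := by
    intro w hw
    by_contra hlt
    have := F.right hw
    exact absurd (hcon w hw.adj ⟨this.1.le, not_lt.1 hlt⟩ this.2.le) (by linarith)
  have hN : ∀ w, H.Step r u w → y v < y w := by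
    intro w hw
    have := F.up hw
    exact hcon w hw.adj ⟨this.1.le, by linarith⟩ this.2.le
  rcases he : H.nbr u e with _ | w <;> rcases hr : H.nbr u r with _ | z
  · exact h₁ u v he hr hx' hy'
  · exact lt_asymm hx' (F.transpose.below_long_step RY hr he hy' (hN z hr))
  · exact lt_asymm hy' (F.below_long_step RX he hr hx' (hE w he))
  · exact F.empty_rectangle h₂ he hr hx' (hE w he) hy' (hN z hr)

/-! ### The four quadrants -/

variable {pos : Fin n → Plane}

/-- In all four quadrants, there are no reflex corners facing a vertex. -/
structure IsCornerFree (H : Shape n) (pos : Fin n → Plane) : Prop where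
  ne : H.CornerFree (fun v => pos v 0) (fun v => pos v 1) .east .north
  nw : H.CornerFree (fun v => -pos v 0) (fun v => pos v 1) .west .north
  se : H.CornerFree (fun v => pos v 0) (fun v => -pos v 1) .east .south
  sw : H.CornerFree (fun v => -pos v 0) (fun v => -pos v 1) .west .south

theorem IsDrawing.isBoxConnected (h : H.IsDrawing pos) {X Y : Fin n → ℕ} {k l : ℕ}
    (RX : H.Ranking .east .north X k) (RY : H.Ranking .north .east Y l)
    (hC : H.IsCornerFree pos) : H.IsBoxConnected pos := by
  intro u v huv
  have F := h.frame
  rcases le_total (pos u 0) (pos v 0) with hx | hx <;>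
    rcases le_total (pos u 1) (pos v 1) with hy | hy
  · obtain ⟨w, hw, h₀, h₁⟩ := F.exists_box_step RX RY hC.ne hC.sw huv hx hy
    exact ⟨w, hw, Set.mem_uIcc.2 (.inl h₀), Set.mem_uIcc.2 (.inl h₁)⟩
  · obtain ⟨w, hw, h₀, h₁⟩ := F.transpose.flip.transpose.exists_box_step RX.opp_right RY.opp_left
      hC.se (by simpa [Dir.opp] using hC.nw) huv hx (neg_le_neg hy)
    exact ⟨w, hw, Set.mem_uIcc.2 (.inl h₀),
      Set.mem_uIcc.2 (.inr ⟨neg_le_neg_iff.1 h₁.2, neg_le_neg_iff.1 h₁.1⟩)⟩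
  · obtain ⟨w, hw, h₀, h₁⟩ := F.flip.exists_box_step RX.opp_left RY.opp_right
      hC.nw (by simpa [Dir.opp] using hC.se) huv (neg_le_neg hx) hy
    exact ⟨w, hw, Set.mem_uIcc.2 (.inr ⟨neg_le_neg_iff.1 h₀.2, neg_le_neg_iff.1 h₀.1⟩),
      Set.mem_uIcc.2 (.inl h₁)⟩
  · obtain ⟨w, hw, h₀, h₁⟩ := F.flip.transpose.flip.transpose.exists_box_step
      RX.opp_left.opp_right RY.opp_left.opp_right
      hC.sw (by simpa [Dir.opp] using hC.ne) huv (neg_le_neg hx) (neg_le_neg hy)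
    exact ⟨w, hw, Set.mem_uIcc.2 (.inr ⟨neg_le_neg_iff.1 h₀.2, neg_le_neg_iff.1 h₀.1⟩),
      Set.mem_uIcc.2 (.inr ⟨neg_le_neg_iff.1 h₁.2, neg_le_neg_iff.1 h₁.1⟩)⟩

theorem IsBoxConnected.exists_ranking_east (hb : H.IsBoxConnected pos) (h : H.IsDrawing pos) :
    ∃ X k, H.Ranking .east .north X k := h.frame.exists_ranking hb

theorem IsBoxConnected.exists_ranking_north (hb : H.IsBoxConnected pos) (h : H.IsDrawing pos) :
    ∃ X k, H.Ranking .north .east X k :=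
  h.frame.transpose.exists_ranking fun u v huv => by
    obtain ⟨w, hw, h₀, h₁⟩ := hb u v huv
    exact ⟨w, hw, h₁, h₀⟩

theorem mem_uIcc_neg {a b c : ℝ} : -b ∈ Set.uIcc (-a) (-c) ↔ b ∈ Set.uIcc a c := by
  simp only [Set.mem_uIcc, neg_le_neg_iff]; tauto

theorem IsBoxConnected.corner_ne (hb : H.IsBoxConnected pos) (h : H.IsDrawing pos) {u v : Fin n}
    (he : H.nbr u .east = none) (hr : H.nbr u .north = none) (h₀ : pos u 0 ≤ pos v 0)
    (h₁ : pos u 1 ≤ pos v 1) : v = u := h.frame.corner hb he hr h₀ h₁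

theorem IsBoxConnected.corner_nw (hb : H.IsBoxConnected pos) (h : H.IsDrawing pos) {u v : Fin n}
    (he : H.nbr u .west = none) (hr : H.nbr u .north = none) (h₀ : pos v 0 ≤ pos u 0)
    (h₁ : pos u 1 ≤ pos v 1) : v = u :=
  h.frame.flip.corner (fun u v huv => by simpa only [mem_uIcc_neg] using hb u v huv) he hr
    (neg_le_neg h₀) h₁

theorem IsBoxConnected.corner_se (hb : H.IsBoxConnected pos) (h : H.IsDrawing pos) {u v : Fin n}
    (he : H.nbr u .east = none) (hr : H.nbr u .south = none) (h₀ : pos u 0 ≤ pos v 0)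
    (h₁ : pos v 1 ≤ pos u 1) : v = u :=
  h.frame.transpose.flip.transpose.corner
    (fun u v huv => by simpa only [mem_uIcc_neg] using hb u v huv) he hr h₀ (neg_le_neg h₁)

theorem IsBoxConnected.corner_sw (hb : H.IsBoxConnected pos) (h : H.IsDrawing pos) {u v : Fin n}
    (he : H.nbr u .west = none) (hr : H.nbr u .south = none) (h₀ : pos v 0 ≤ pos u 0)
    (h₁ : pos v 1 ≤ pos u 1) : v = u :=
  h.frame.flip.transpose.flip.transpose.corner
    (fun u v huv => by simpa only [mem_uIcc_neg] using hb u v huv) he hr (neg_le_neg h₀)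
    (neg_le_neg h₁)

theorem IsBoxConnected.isCornerFree (hb : H.IsBoxConnected pos) (h : H.IsDrawing pos) :
    H.IsCornerFree pos where
  ne u v h₁ h₂ h₃ h₄ := by
    obtain rfl := hb.corner_ne h h₁ h₂ h₃.le h₄.le; exact lt_irrefl _ h₃
  nw u v h₁ h₂ h₃ h₄ := by
    obtain rfl := hb.corner_nw h h₁ h₂ (neg_le_neg_iff.1 h₃.le) h₄.le; exact lt_irrefl _ h₃
  se u v h₁ h₂ h₃ h₄ := by
    obtain rfl := hb.corner_se h h₁ h₂ h₃.le (neg_le_neg_iff.1 h₄.le); exact lt_irrefl _ h₃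
  sw u v h₁ h₂ h₃ h₄ := by
    obtain rfl := hb.corner_sw h h₁ h₂ (neg_le_neg_iff.1 h₃.le) (neg_le_neg_iff.1 h₄.le)
    exact lt_irrefl _ h₃

/-- Rankings and corner-freeness in one drawing yield box-connectedness in all drawings. -/
theorem IsDrawing.cornerFree_of_isDrawing {pos' : Fin n → Plane} (h : H.IsDrawing pos)
    (h' : H.IsDrawing pos') {X Y : Fin n → ℕ} {k l : ℕ}
    (RX : H.Ranking .east .north X k) (RY : H.Ranking .north .east Y l)
    (hC : H.IsCornerFree pos) : H.IsCornerFree pos' := by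
  have hx : ∀ {u v}, pos' u 0 < pos' v 0 → pos u 0 < pos v 0 := fun {u v} hlt =>
    (RX.lt_iff h.frame u v).1 ((RX.lt_iff h'.frame u v).2 hlt)
  have hy : ∀ {u v}, pos' u 1 < pos' v 1 → pos u 1 < pos v 1 := fun {u v} hlt =>
    (RY.lt_iff h.frame.transpose u v).1 ((RY.lt_iff h'.frame.transpose u v).2 hlt)
  exact ⟨fun u v h₁ h₂ h₃ h₄ => hC.ne u v h₁ h₂ (hx h₃) (hy h₄),
    fun u v h₁ h₂ h₃ h₄ => hC.nw u v h₁ h₂ (neg_lt_neg (hx (neg_lt_neg_iff.1 h₃))) (hy h₄),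
    fun u v h₁ h₂ h₃ h₄ => hC.se u v h₁ h₂ (hx h₃) (neg_lt_neg (hy (neg_lt_neg_iff.1 h₄))),
    fun u v h₁ h₂ h₃ h₄ => hC.sw u v h₁ h₂ (neg_lt_neg (hx (neg_lt_neg_iff.1 h₃)))
      (neg_lt_neg (hy (neg_lt_neg_iff.1 h₄)))⟩

end Shape

/-! ### A criterion that refers to a single drawing -/

theorem RectilinearRep.universalGreedy_iff_of_isDrawing {n : ℕ} {H : RectilinearRep n}
    {pos : Fin n → Plane} (h : H.IsDrawing pos) :
    H.UniversalGreedy ↔ (∃ X k, H.Ranking .east .north X k) ∧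
      (∃ Y l, H.Ranking .north .east Y l) ∧ H.IsCornerFree pos := by
  constructor
  · intro hg
    have hb := hg.isBoxConnected h
    exact ⟨hb.exists_ranking_east h, hb.exists_ranking_north h, hb.isCornerFree h⟩
  · rintro ⟨⟨X, k, RX⟩, ⟨Y, l, RY⟩, hC⟩
    exact universalGreedy_iff.2 fun pos' h' =>
      h'.isBoxConnected RX RY (h.cornerFree_of_isDrawing h' RX RY hC)

/-! ### Closed sets without reflex corners facing the set -/

/-- `m` is the infimum of the points from `a` on that lie outside `T`. It belongs to the closed set
`T`, and outside points accumulate at it from the right; this is the local condition that appears in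
`ReflexFree`. -/
theorem exists_last_mem {T : Set ℝ} (hT : IsClosed T) {a b : ℝ} (ha : a ∈ T) (hab : a ≤ b)
    (hb : b ∉ T) : ∃ m, a ≤ m ∧ m ∈ T ∧ m < b ∧ ∀ ε > 0, ∃ t, 0 < t ∧ t < ε ∧ m + t ∉ T := by
  set V : Set ℝ := {t | a ≤ t ∧ t ∉ T}
  have hV : b ∈ V := ⟨hab, hb⟩
  have hbdd : BddBelow V := ⟨a, fun t ht => ht.1⟩
  have ham : a ≤ sInf V := le_csInf ⟨b, hV⟩ fun t ht => ht.1
  have hm : sInf V ∈ T := by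
    by_contra hm
    have hlt : a < sInf V := ham.lt_of_ne fun h => hm (h ▸ ha)
    obtain ⟨l, u, ⟨hl, hu⟩, hsub⟩ := mem_nhds_iff_exists_Ioo_subset.1 (hT.isOpen_compl.mem_nhds hm)
    obtain ⟨t, ht, ht'⟩ := exists_between (max_lt hl hlt)
    rw [max_lt_iff] at ht
    exact absurd (csInf_le hbdd (⟨ht.2.le, hsub ⟨ht.1, ht'.trans hu⟩⟩ : t ∈ V)) (not_le.2 ht')
  refine ⟨sInf V, ham, hm, (csInf_le hbdd hV).lt_of_ne fun h => hb (h ▸ hm), fun ε hε => ?_⟩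
  obtain ⟨t, ht, htε⟩ := exists_lt_of_csInf_lt ⟨b, hV⟩ (lt_add_of_pos_right (sInf V) hε)
  have h₁ := (csInf_le hbdd ht).lt_of_ne fun h => ht.2 (h ▸ hm)
  exact ⟨t - sInf V, by linarith, by linarith, by simpa using ht.2⟩

theorem exists_first_mem {T : Set ℝ} (hT : IsClosed T) {a b : ℝ} (ha : a ∉ T) (hab : a ≤ b)
    (hb : b ∈ T) : ∃ m, a < m ∧ m ∈ T ∧ ∀ t, a ≤ t → t < m → t ∉ T := by
  have hcl : IsClosed (T ∩ Set.Ici a) := hT.inter isClosed_Ici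
  have hbdd : BddBelow (T ∩ Set.Ici a) := ⟨a, fun t ht => ht.2⟩
  have hm := hcl.csInf_mem ⟨b, hb, hab⟩ hbdd
  refine ⟨_, hm.2.lt_of_ne fun h => ha (h ▸ hm.1), hm.1, fun t h₁ h₂ ht => ?_⟩
  exact absurd (csInf_le hbdd ⟨ht, h₁⟩) (not_le.2 h₂)

/-- A closed set, given by a predicate of the coordinates, such that at each of its points, every
quadrant that is not bounded by the set on either side near the point contains no other point of the
set. -/
structure ReflexFree (S : ℝ → ℝ → Prop) : Prop where
  closed : IsClosed {p : ℝ × ℝ | S p.1 p.2}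
  quadrant : ∀ σ τ : ℝ, (σ = 1 ∨ σ = -1) → (τ = 1 ∨ τ = -1) → ∀ x y, S x y →
    (∀ ε > 0, ∃ t, 0 < t ∧ t < ε ∧ ¬ S (x + σ * t) y) →
    (∀ ε > 0, ∃ t, 0 < t ∧ t < ε ∧ ¬ S x (y + τ * t)) →
    ∀ s t, 0 ≤ s → 0 ≤ t → S (x + σ * s) (y + τ * t) → s = 0 ∧ t = 0

namespace ReflexFree

variable {S : ℝ → ℝ → Prop} {x y c d : ℝ}

theorem transpose (h : ReflexFree S) : ReflexFree fun x y => S y x where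
  closed := h.closed.preimage continuous_swap
  quadrant σ τ hσ hτ x y hxy h₁ h₂ s t hs ht hst :=
    (h.quadrant τ σ hτ hσ y x hxy h₂ h₁ t s ht hs hst).symm

theorem flip (h : ReflexFree S) : ReflexFree fun x y => S (-x) y where
  closed := h.closed.preimage (by fun_prop : Continuous fun p : ℝ × ℝ => (-p.1, p.2))
  quadrant σ τ hσ hτ x y hxy h₁ h₂ s t hs ht hst := by
    have he : ∀ t, -(x + σ * t) = -x + -σ * t := fun t => by ring
    simp only [he] at h₁ hst
    refine h.quadrant (-σ) τ (by rcases hσ with rfl | rfl <;> simp) hτ (-x) y hxy h₁ h₂ s t hs ht hst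

theorem isClosed_row (h : ReflexFree S) (y : ℝ) : IsClosed {x | S x y} :=
  h.closed.preimage (by fun_prop : Continuous fun x : ℝ => (x, y))

theorem isClosed_column (h : ReflexFree S) (x : ℝ) : IsClosed {y | S x y} :=
  h.closed.preimage (by fun_prop : Continuous fun y : ℝ => (x, y))

/-- `β` is the abscissa of a leftmost point of the set in the rectangle over `[z₁, z₂]` to the right
of the column `x`. If the wall at `β` ended before `z₁` or `z₂`, its end would have free space on
the left and beyond the end, yet `(x, c)` or `(x, d)` lies in the quadrant between these directions,
against `quadrant`. -/
theorem exists_wall (h : ReflexFree S) (hc : S x c) (hd : S x d)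
    (hfree : ∀ z, c < z → z < d → ¬ S x z) {z₁ z₂ : ℝ} (h₁ : c < z₁) (h₂ : z₂ < d) {x' y' : ℝ}
    (hx' : x ≤ x') (hy₁ : z₁ ≤ y') (hy₂ : y' ≤ z₂) (hS : S x' y') :
    ∃ β, x < β ∧ (∀ z, z₁ ≤ z → z ≤ z₂ → S β z) ∧
      ∀ w z, x ≤ w → w < β → z₁ ≤ z → z ≤ z₂ → ¬ S w z := by
  have hK : IsCompact ({p : ℝ × ℝ | S p.1 p.2} ∩ (Set.Icc x x' ×ˢ Set.Icc z₁ z₂)) :=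
    (isCompact_Icc.prod isCompact_Icc).inter_left h.closed
  obtain ⟨⟨β, y₀⟩, ⟨hβS, hβx, hβy⟩, hmin⟩ := hK.exists_isMinOn
    ⟨(x', y'), hS, ⟨hx', le_rfl⟩, ⟨hy₁, hy₂⟩⟩ continuous_fst.continuousOn
  simp only [Set.mem_ofPred_eq, Set.mem_Icc] at hβS hβx hβy
  have hfr : ∀ w z, x ≤ w → w < β → z₁ ≤ z → z ≤ z₂ → ¬ S w z := fun w z hw hwβ hz₁ hz₂ hwz =>
    absurd (hmin (show (w, z) ∈ _ from ⟨hwz, ⟨hw, by linarith⟩, ⟨hz₁, hz₂⟩⟩)) (not_le.2 hwβ)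
  have hxβ : x < β := hβx.1.lt_of_ne fun he =>
    hfree y₀ (by linarith) (by linarith) (he ▸ hβS)
  refine ⟨β, hxβ, fun z hz₁ hz₂ => ?_, hfr⟩
  by_contra hz
  have hleft : ∀ m, z₁ ≤ m → m ≤ z₂ → ∀ ε > 0, ∃ t, 0 < t ∧ t < ε ∧ ¬ S (β + -1 * t) m := by
    intro m hm₁ hm₂ ε hε
    obtain ⟨t, ht, ht'⟩ := exists_between (lt_min hε (sub_pos.2 hxβ))
    rw [lt_min_iff] at ht'
    exact ⟨t, ht, ht'.1, hfr _ _ (by linarith) (by linarith) hm₁ hm₂⟩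
  rcases le_total y₀ z with hle | hle
  · obtain ⟨m, hm₁, hm, hm₂, hgerm⟩ := exists_last_mem (h.isClosed_column β) hβS hle hz
    have := h.quadrant (-1) 1 (.inr rfl) (.inl rfl) β m hm
      (hleft m (by linarith) (by linarith)) (by simpa using hgerm) (β - x) (d - m) (by linarith)
      (by linarith) (by simpa using hd)
    linarith
  · obtain ⟨m, hm₁, hm, hm₂, hgerm⟩ := exists_last_mem
      ((h.isClosed_column β).preimage continuous_neg) (a := -y₀) (b := -z) (by simpa using hβS)
      (by linarith) (by simpa using hz)
    have := h.quadrant (-1) (-1) (.inr rfl) (.inr rfl) β (-m) hm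
      (hleft (-m) (by linarith) (by linarith))
      (fun ε hε => by
        obtain ⟨t, h₁, h₂, h₃⟩ := hgerm ε hε
        refine ⟨t, h₁, h₂, fun h₄ => h₃ ?_⟩
        simpa [add_comm] using h₄)
      (β - x) (-m - c) (by linarith) (by linarith) (by simpa using hc)
    linarith

/-- If one sees the set above, below and to the right, then the right side of the visible region is
a wall over the whole height of the region. -/
theorem wall_right (h : ReflexFree S) (hc : S x c) (hd : S x d)
    (hfree : ∀ z, c < z → z < d → ¬ S x z) (h₁ : c < y) (h₂ : y < d) {b : ℝ} (hxb : x < b)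
    (hb : S b y) (hbfree : ∀ w, x ≤ w → w < b → ¬ S w y) {z : ℝ} (hz₁ : c < z) (hz₂ : z < d) :
    S b z ∧ ∀ w, x ≤ w → w < b → ¬ S w z := by
  obtain ⟨β, h₅, hβ, hβfree⟩ := h.exists_wall hc hd hfree (lt_min h₁ hz₁) (max_lt h₂ hz₂) hxb.le
    (min_le_left y z) (le_max_left y z) hb
  have h₃ := hβ y (min_le_left y z) (le_max_left y z)
  have h₄ : β ≤ b := not_lt.1 fun hlt =>
    hβfree b y hxb.le hlt (min_le_left y z) (le_max_left y z) hb
  have h₆ : β = b := le_antisymm h₄ (not_lt.1 fun hlt => hbfree β h₅.le hlt h₃)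
  subst h₆
  exact ⟨hβ z (min_le_right y z) (le_max_right y z),
    fun w hw hwb => hβfree w z hw hwb (min_le_right y z) (le_max_right y z)⟩

/-- A point that sees the set above and below also sees it to the right. -/
theorem exists_right (h : ReflexFree S) (hc : S x c) (hd : S x d)
    (hfree : ∀ z, c < z → z < d → ¬ S x z) (h₁ : c < y) (h₂ : y < d) {B : ℝ}
    (hB : ∀ w z, S w z → w ≤ B) : ∃ w, x ≤ w ∧ S w y := by
  by_contra hcon
  push Not at hcon
  -- A point of the set anywhere in the strip would give a wall that also meets the height `y`.
  have hstrip : ∀ z, c < z → z < d → ∀ w, x ≤ w → ¬ S w z := by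
    intro z hz₁ hz₂ w hw hwz
    obtain ⟨β, hxβ, hβ, -⟩ := h.exists_wall hc hd hfree (lt_min h₁ hz₁) (max_lt h₂ hz₂) hw
      (min_le_right y z) (le_max_right y z) hwz
    exact hcon β hxβ.le (hβ y (min_le_left y z) (le_max_left y z))
  have hout : ∀ z, ¬ S (max x (B + 1)) z := fun z hz => by
    have := hB _ _ hz
    have := le_max_right x (B + 1)
    linarith
  -- Both boundary rows of the strip are followed to the right until they leave the set. The one
  -- that leaves first ends in a corner whose free quadrant contains the end of the other.
  obtain ⟨x₁, hx₁, hS₁, -, hgerm₁⟩ :=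
    exists_last_mem (h.isClosed_row d) hd (le_max_left x (B + 1)) (hout d)
  obtain ⟨x₂, hx₂, hS₂, -, hgerm₂⟩ :=
    exists_last_mem (h.isClosed_row c) hc (le_max_left x (B + 1)) (hout c)
  have hcd : 0 < d - c := by linarith
  rcases le_total x₁ x₂ with hle | hle
  · have := h.quadrant 1 (-1) (.inl rfl) (.inr rfl) x₁ d hS₁ (by simpa using hgerm₁)
      (fun ε hε => by
        obtain ⟨t, ht, ht'⟩ := exists_between (lt_min hε hcd)
        rw [lt_min_iff] at ht'
        exact ⟨t, ht, ht'.1, hstrip _ (by linarith) (by linarith) _ hx₁⟩)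
      (x₂ - x₁) (d - c) (by linarith) (by linarith) (by simpa using hS₂)
    linarith
  · have := h.quadrant 1 1 (.inl rfl) (.inl rfl) x₂ c hS₂ (by simpa using hgerm₂)
      (fun ε hε => by
        obtain ⟨t, ht, ht'⟩ := exists_between (lt_min hε hcd)
        rw [lt_min_iff] at ht'
        exact ⟨t, ht, ht'.1, hstrip _ (by linarith) (by linarith) _ hx₂⟩)
      (x₁ - x₂) (d - c) (by linarith) (by linarith) (by simpa using hS₁)
    linarith

theorem exists_left (h : ReflexFree S) (hc : S x c) (hd : S x d)
    (hfree : ∀ z, c < z → z < d → ¬ S x z) (h₁ : c < y) (h₂ : y < d) {B : ℝ}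
    (hB : ∀ w z, S w z → B ≤ w) : ∃ w, w ≤ x ∧ S w y := by
  obtain ⟨w, hw, hS⟩ := h.flip.exists_right (x := -x) (by simpa using hc) (by simpa using hd)
    (by simpa using hfree) h₁ h₂ (B := -B) fun w z hwz => by linarith [hB _ _ hwz]
  exact ⟨-w, by linarith, hS⟩

theorem wall_left (h : ReflexFree S) (hc : S x c) (hd : S x d)
    (hfree : ∀ z, c < z → z < d → ¬ S x z) (h₁ : c < y) (h₂ : y < d) {a : ℝ} (hax : a < x)
    (ha : S a y) (hafree : ∀ w, a < w → w ≤ x → ¬ S w y) {z : ℝ} (hz₁ : c < z) (hz₂ : z < d) :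
    S a z ∧ ∀ w, a < w → w ≤ x → ¬ S w z := by
  obtain ⟨h₃, h₄⟩ := h.flip.wall_right (x := -x) (b := -a) (by simpa using hc) (by simpa using hd)
    (by simpa using hfree) h₁ h₂ (by linarith) (by simpa using ha)
    (fun w hw hwb => hafree _ (by linarith) (by linarith)) hz₁ hz₂
  exact ⟨by simpa using h₃, fun w hw hwx => by
    simpa using h₄ (-w) (by linarith) (by linarith)⟩

/-- If one sees the set from a point in all four directions, then the region around the point is a
rectangle. -/
theorem exists_rectangle (h : ReflexFree S) (hp : ¬ S x y) (hE : ∃ w, x ≤ w ∧ S w y)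
    (hW : ∃ w, w ≤ x ∧ S w y) (hN : ∃ z, y ≤ z ∧ S x z) (hS : ∃ z, z ≤ y ∧ S x z) :
    ∃ a b c d, (a < x ∧ x < b ∧ c < y ∧ y < d) ∧
      (∀ w z, a < w → w < b → c < z → z < d → ¬ S w z) ∧
      (∀ z, c ≤ z → z ≤ d → S a z ∧ S b z) ∧ ∀ w, a ≤ w → w ≤ b → S w c ∧ S w d := by
  have first_right : ∀ {S : ℝ → ℝ → Prop}, ReflexFree S → ∀ {x y}, ¬ S x y →
      (∃ w, x ≤ w ∧ S w y) → ∃ b, x < b ∧ S b y ∧ ∀ w, x ≤ w → w < b → ¬ S w y := by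
    rintro S h x y hp ⟨w, hw, hwy⟩
    exact exists_first_mem (h.isClosed_row y) hp hw hwy
  have first_left : ∀ {S : ℝ → ℝ → Prop}, ReflexFree S → ∀ {x y}, ¬ S x y →
      (∃ w, w ≤ x ∧ S w y) → ∃ a, a < x ∧ S a y ∧ ∀ w, a < w → w ≤ x → ¬ S w y := by
    rintro S h x y hp ⟨w, hw, hwy⟩
    obtain ⟨b, hb, hby, hfree⟩ := first_right h.flip (x := -x) (y := y) (by simpa using hp)
      ⟨-w, by linarith, by simpa using hwy⟩
    exact ⟨-b, by linarith, hby, fun w hw hwx => by simpa using hfree (-w) (by linarith) (by linarith)⟩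
  obtain ⟨b, hb, hby, hbfree⟩ := first_right h hp hE
  obtain ⟨a, ha, hay, hafree⟩ := first_left h hp hW
  obtain ⟨d, hd, hdx, hdfree⟩ := first_right h.transpose (x := y) (y := x) hp hN
  obtain ⟨c, hc, hcx, hcfree⟩ := first_left h.transpose (x := y) (y := x) hp hS
  have hcol : ∀ z, c < z → z < d → ¬ S x z := fun z h₁ h₂ => by
    rcases le_total y z with h₃ | h₃
    exacts [hdfree z h₃ h₂, hcfree z h₁ h₃]
  have hrow : ∀ w, a < w → w < b → ¬ S w y := fun w h₁ h₂ => by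
    rcases le_total x w with h₃ | h₃
    exacts [hbfree w h₃ h₂, hafree w h₁ h₃]
  have hR := fun z => h.wall_right (z := z) hcx hdx hcol hc hd hb hby hbfree
  have hL := fun z => h.wall_left (z := z) hcx hdx hcol hc hd ha hay hafree
  have hU := fun w => h.transpose.wall_right (z := w) hay hby hrow ha hb hd hdx hdfree
  have hD := fun w => h.transpose.wall_left (z := w) hay hby hrow ha hb hc hcx hcfree
  have hclose : ∀ {T : Set ℝ}, IsClosed T → ∀ {s t}, s < t → (∀ z, s < z → z < t → z ∈ T) →
      ∀ z, s ≤ z → z ≤ t → z ∈ T := by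
    intro T hT s t hst hsub z h₁ h₂
    have : Set.Icc s t ⊆ T := by
      rw [← closure_Ioo hst.ne]
      exact closure_minimal (fun z hz => hsub z hz.1 hz.2) hT
    exact this ⟨h₁, h₂⟩
  refine ⟨a, b, c, d, ⟨ha, hb, hc, hd⟩, fun w z h₁ h₂ h₃ h₄ => ?_, fun z h₁ h₂ => ⟨?_, ?_⟩,
    fun w h₁ h₂ => ⟨?_, ?_⟩⟩
  · rcases le_total x w with h₅ | h₅
    exacts [(hR z h₃ h₄).2 w h₅ h₂, (hL z h₃ h₄).2 w h₁ h₅]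
  · exact hclose (h.isClosed_column a) (hc.trans hd) (fun z h₁ h₂ => (hL z h₁ h₂).1) z h₁ h₂
  · exact hclose (h.isClosed_column b) (hc.trans hd) (fun z h₁ h₂ => (hR z h₁ h₂).1) z h₁ h₂
  · exact hclose (h.isClosed_row c) (ha.trans hb) (fun z h₁ h₂ => (hD z h₁ h₂).1) w h₁ h₂
  · exact hclose (h.isClosed_row d) (ha.trans hb) (fun z h₁ h₂ => (hU z h₁ h₂).1) w h₁ h₂

end ReflexFree

/-! ### Faces -/

open Set in
-- The open rectangle and the exterior of its closure are disjoint and open, and they cover the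
-- complement of `A` because all four sides lie in `A`. A component that meets the rectangle
-- therefore stays in it.
theorem isRectangle_face {A : Set Plane} {p : Plane} {a b c d : ℝ}
    (hp : a < p 0 ∧ p 0 < b ∧ c < p 1 ∧ p 1 < d)
    (hfree : ∀ w z, a < w → w < b → c < z → z < d → !₂[w, z] ∉ A)
    (hside : ∀ z, c ≤ z → z ≤ d → !₂[a, z] ∈ A ∧ !₂[b, z] ∈ A)
    (hside' : ∀ w, a ≤ w → w ≤ b → !₂[w, c] ∈ A ∧ !₂[w, d] ∈ A) :
    connectedComponentIn Aᶜ p = {q | a < q 0 ∧ q 0 < b ∧ c < q 1 ∧ q 1 < d} := by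
  have heta : ∀ q : Plane, !₂[q 0, q 1] = q := fun q => plane_ext rfl rfl
  set R : Set Plane := {q | a < q 0 ∧ q 0 < b ∧ c < q 1 ∧ q 1 < d} with hR
  have hconv : Convex ℝ R := by
    intro q hq q' hq' s t hs ht hst
    simp only [hR, mem_ofPred_eq, PiLp.add_apply, PiLp.smul_apply, smul_eq_mul] at hq hq' ⊢
    obtain rfl : t = 1 - s := by linarith
    refine ⟨?_, ?_, ?_, ?_⟩ <;>
      rcases hs.eq_or_lt with rfl | hs' <;> first | (simp; linarith) | nlinarith
  have hsub : R ⊆ Aᶜ := fun q hq hA => hfree _ _ hq.1 hq.2.1 hq.2.2.1 hq.2.2.2 (by rwa [heta])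
  apply Subset.antisymm
  · have h0 : Continuous fun q : Plane => q 0 := by fun_prop
    have h1 : Continuous fun q : Plane => q 1 := by fun_prop
    have hRo : IsOpen R := (isOpen_lt continuous_const h0).inter ((isOpen_lt h0 continuous_const).inter
      ((isOpen_lt continuous_const h1).inter (isOpen_lt h1 continuous_const)))
    set R' : Set Plane := {q | q 0 < a ∨ b < q 0 ∨ q 1 < c ∨ d < q 1} with hR'
    have hRo' : IsOpen R' := (isOpen_lt h0 continuous_const).union ((isOpen_lt continuous_const h0).union
      ((isOpen_lt h1 continuous_const).union (isOpen_lt continuous_const h1)))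
    refine isPreconnected_connectedComponentIn.subset_left_of_subset_union hRo hRo' ?_ ?_
      ⟨p, mem_connectedComponentIn (hsub hp), hp⟩
    · rw [Set.disjoint_left]
      rintro q ⟨h₁, h₂, h₃, h₄⟩ (h | h | h | h) <;> linarith
    · intro q hq
      have hqA : q ∉ A := connectedComponentIn_subset _ _ hq
      rw [← heta q] at hqA
      by_contra hcon
      simp only [hR, hR', mem_union, mem_ofPred_eq, not_or, not_lt] at hcon
      obtain ⟨h₁, h₂, h₃, h₄, h₅⟩ := hcon
      apply h₁
      refine ⟨h₂.lt_of_ne fun he => hqA ?_, h₃.lt_of_ne fun he => hqA ?_,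
        h₄.lt_of_ne fun he => hqA ?_, h₅.lt_of_ne fun he => hqA ?_⟩
      · rw [← he]; exact (hside _ h₄ h₅).1
      · rw [he]; exact (hside _ h₄ h₅).2
      · rw [← he]; exact (hside' _ h₂ h₃).1
      · rw [he]; exact (hside' _ h₂ h₃).2
  · exact hconv.isPreconnected.subset_connectedComponentIn hp hsub

/-- Otherwise the unbounded ray would be a connected subset of the bounded face. -/
theorem exists_mem_ray {A : Set Plane} {p : Plane}
    (hb : Bornology.IsBounded (connectedComponentIn Aᶜ p)) {w : Plane} (hw : w ≠ 0) :
    ∃ t : ℝ, 0 ≤ t ∧ p + t • w ∈ A := by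
  by_contra hcon
  push Not at hcon
  have hpre : IsPreconnected ((fun t : ℝ => p + t • w) '' Set.Ici 0) :=
    isPreconnected_Ici.image _ (by fun_prop)
  have hsub := hpre.subset_connectedComponentIn (x := p) (F := Aᶜ) ⟨0, by simp, by simp⟩
    (by rintro _ ⟨t, ht, rfl⟩; exact hcon t ht)
  obtain ⟨C, hC⟩ := (hb.subset hsub).subset_closedBall p
  obtain ⟨t, ht⟩ := exists_gt (max C 0 / ‖w‖)
  have hw' : 0 < ‖w‖ := norm_pos_iff.2 hw
  have ht₀ : 0 ≤ t := (div_nonneg (le_max_right _ _) hw'.le).trans ht.le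
  have hmem : p + t • w ∈ Metric.closedBall p C := hC ⟨t, ht₀, rfl⟩
  rw [mem_closedBall_iff_norm, add_sub_cancel_left, norm_smul, Real.norm_of_nonneg ht₀] at hmem
  rw [div_lt_iff₀ hw'] at ht
  linarith [le_max_left C 0]

namespace Shape

variable {n : ℕ} {H : Shape n} {x y : Fin n → ℝ} {e r : Dir} {pos : Fin n → Plane}

/-! ### The points covered by a drawing -/

/-- The point with coordinates `s` and `t` lies on a vertex or on an edge. -/
def Covers (H : Shape n) (x y : Fin n → ℝ) (e r : Dir) (s t : ℝ) : Prop :=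
  (∃ v, x v = s ∧ y v = t) ∨ (∃ a b, H.Step e a b ∧ x a ≤ s ∧ s ≤ x b ∧ y a = t) ∨
    ∃ a b, H.Step r a b ∧ y a ≤ t ∧ t ≤ y b ∧ x a = s

theorem covers_transpose {s t : ℝ} : H.Covers y x r e t s ↔ H.Covers x y e r s t := by
  unfold Covers
  have : (∃ v, y v = t ∧ x v = s) ↔ ∃ v, x v = s ∧ y v = t := by simp only [and_comm]
  rw [this]
  exact or_congr Iff.rfl or_comm

theorem Frame.covers_flip (F : Frame H x y e r) {s t : ℝ} :
    H.Covers (fun v => -x v) y e.opp r s t ↔ H.Covers x y e r (-s) t := by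
  unfold Covers
  simp only [neg_eq_iff_eq_neg]
  have : (∃ a b, H.Step e.opp a b ∧ -x a ≤ s ∧ s ≤ -x b ∧ y a = t) ↔
      ∃ a b, H.Step e a b ∧ x a ≤ -s ∧ -s ≤ x b ∧ y a = t := by
    constructor
    · rintro ⟨a, b, h, h₁, h₂, h₃⟩
      have h := step_opp_iff.1 h
      exact ⟨b, a, h, by linarith, by linarith, (F.right h).2.trans h₃⟩
    · rintro ⟨a, b, h, h₁, h₂, h₃⟩
      exact ⟨b, a, h.opp, by linarith, by linarith, (F.right h).2.symm.trans h₃⟩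
  rw [this]

open Set in
theorem IsDrawing.mem_support_iff (h : H.IsDrawing pos) {s t : ℝ} : !₂[s, t] ∈ H.support pos ↔
    H.Covers (fun v => pos v 0) (fun v => pos v 1) .east .north s t := by
  have hE : ∀ {a b}, H.Step .east a b → (!₂[s, t] ∈ segment ℝ (pos a) (pos b) ↔
      pos a 0 ≤ s ∧ s ≤ pos b 0 ∧ pos a 1 = t) := by
    intro a b hs
    have := h.east hs
    rw [h.mem_segment_iff hs.adj, ← this.2, uIcc_self, uIcc_of_le this.1.le]
    simp [and_assoc, eq_comm]
  have hN : ∀ {a b}, H.Step .north a b → (!₂[s, t] ∈ segment ℝ (pos a) (pos b) ↔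
      pos a 1 ≤ t ∧ t ≤ pos b 1 ∧ pos a 0 = s) := by
    intro a b hs
    have := h.north hs
    rw [h.mem_segment_iff hs.adj, ← this.1, uIcc_self, uIcc_of_le this.2.le]
    simp only [Matrix.cons_val_zero, Matrix.cons_val_one, mem_singleton_iff, mem_Icc]
    rw [eq_comm]
    tauto
  constructor
  · rintro (⟨v, hv⟩ | ⟨u, v, huv, hp⟩)
    · exact .inl ⟨v, congrArg (fun q : Plane => q 0) hv.symm, congrArg (fun q : Plane => q 1) hv.symm⟩
    · rcases adj_iff.1 huv with hs | hs | hs | hs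
      · exact .inr (.inl ⟨u, v, hs, (hE hs).1 hp⟩)
      · exact .inr (.inl ⟨v, u, hs, (hE hs).1 (by rwa [segment_symm])⟩)
      · exact .inr (.inr ⟨u, v, hs, (hN hs).1 hp⟩)
      · exact .inr (.inr ⟨v, u, hs, (hN hs).1 (by rwa [segment_symm])⟩)
  · rintro (⟨v, rfl, rfl⟩ | ⟨a, b, hs, hp⟩ | ⟨a, b, hs, hp⟩)
    · exact .inl ⟨v, plane_ext rfl rfl⟩
    · exact .inr ⟨a, b, hs.adj, (hE hs).2 hp⟩
    · exact .inr ⟨a, b, hs.adj, (hN hs).2 hp⟩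

theorem isCompact_support : IsCompact (H.support pos) := by
  have : H.support pos = Set.range pos ∪ ⋃ p ∈ {p : Fin n × Fin n | H.graph.Adj p.1 p.2},
      segment ℝ (pos p.1) (pos p.2) := by
    ext q
    simp only [support, Set.mem_union, Set.mem_range, Set.mem_iUnion, Set.mem_ofPred_eq,
      exists_prop, Prod.exists, eq_comm]
  rw [this]
  refine (Set.finite_range pos).isCompact.union ((Set.toFinite _).isCompact_biUnion fun p _ => ?_)
  rw [segment_eq_image]
  exact isCompact_Icc.image (by fun_prop)

theorem Frame.covers_flip_transpose (F : Frame H x y e r) {s t : ℝ} :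
    H.Covers x (fun v => -y v) e r.opp s t ↔ H.Covers x y e r s (-t) := by
  rw [← covers_transpose, F.transpose.covers_flip, covers_transpose]

theorem Frame.covers_flip_flip (F : Frame H x y e r) {s t : ℝ} :
    H.Covers (fun v => -x v) (fun v => -y v) e.opp r.opp s t ↔ H.Covers x y e r (-s) (-t) := by
  rw [F.flip.covers_flip_transpose, F.covers_flip]

/-! ### Box-connected drawings are convex -/

/-- A covered point with free space to the right and above is a vertex `u` without edges in
directions `e` and `r`. If an edge covers a point of the closed quadrant, its end in direction `e`
or `r` is a vertex there, hence equal to `u`, and the point cannot be farther out than `u`. -/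
theorem Frame.eq_of_covers_quadrant (F : Frame H x y e r)
    (hC : ∀ u v, H.nbr u e = none → H.nbr u r = none → x u ≤ x v → y u ≤ y v → v = u) {s t : ℝ}
    (hst : H.Covers x y e r s t) (hE : ∀ ε > 0, ∃ w, 0 < w ∧ w < ε ∧ ¬ H.Covers x y e r (s + w) t)
    (hN : ∀ ε > 0, ∃ w, 0 < w ∧ w < ε ∧ ¬ H.Covers x y e r s (t + w)) {a b : ℝ} (ha : 0 ≤ a)
    (hb : 0 ≤ b) (hab : H.Covers x y e r (s + a) (t + b)) : a = 0 ∧ b = 0 := by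
  obtain ⟨u, hus, hut⟩ : ∃ u, x u = s ∧ y u = t := by
    rcases hst with h | ⟨p, q, h, h₁, h₂, h₃⟩ | ⟨p, q, h, h₁, h₂, h₃⟩
    · exact h
    · rcases h₂.eq_or_lt with rfl | h₂
      · exact ⟨q, rfl, (F.right h).2.symm.trans h₃⟩
      · obtain ⟨w, hw, hw', hn⟩ := hE _ (sub_pos.2 h₂)
        exact absurd (.inr (.inl ⟨p, q, h, by linarith, by linarith, h₃⟩)) hn
    · rcases h₂.eq_or_lt with rfl | h₂
      · exact ⟨q, (F.up h).1.symm.trans h₃, rfl⟩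
      · obtain ⟨w, hw, hw', hn⟩ := hN _ (sub_pos.2 h₂)
        exact absurd (.inr (.inr ⟨p, q, h, by linarith, by linarith, h₃⟩)) hn
  have hue : H.nbr u e = none := by
    rw [Option.eq_none_iff_forall_ne_some]
    intro v hv
    obtain ⟨w, hw, hw', hn⟩ := hE _ (sub_pos.2 (F.right hv).1)
    exact hn (.inr (.inl ⟨u, v, hv, by linarith, by linarith, hut⟩))
  have hur : H.nbr u r = none := by
    rw [Option.eq_none_iff_forall_ne_some]
    intro v hv
    obtain ⟨w, hw, hw', hn⟩ := hN _ (sub_pos.2 (F.up hv).2)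
    exact hn (.inr (.inr ⟨u, v, hv, by linarith, by linarith, hus⟩))
  rcases hab with ⟨v, h₁, h₂⟩ | ⟨p, q, h, h₁, h₂, h₃⟩ | ⟨p, q, h, h₁, h₂, h₃⟩
  · obtain rfl := hC u v hue hur (by linarith) (by linarith)
    constructor <;> linarith
  · have := F.right h
    obtain rfl := hC u q hue hur (by linarith) (by linarith)
    constructor <;> linarith
  · have := F.up h
    obtain rfl := hC u q hue hur (by linarith) (by linarith)
    constructor <;> linarith

theorem IsBoxConnected.reflexFree (hb : H.IsBoxConnected pos) (h : H.IsDrawing pos) :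
    ReflexFree fun s t => !₂[s, t] ∈ H.support pos where
  closed := isCompact_support.isClosed.preimage
    (by fun_prop : Continuous fun p : ℝ × ℝ => (!₂[p.1, p.2] : Plane))
  quadrant σ τ hσ hτ s t hst hE hN a b ha hb' hab := by
    have F := h.frame
    simp only [h.mem_support_iff] at hst hE hN hab
    rcases hσ with rfl | rfl <;> rcases hτ with rfl | rfl
    · simp only [one_mul] at hE hN hab
      exact F.eq_of_covers_quadrant (fun u v => hb.corner_ne h) hst hE hN ha hb' hab
    · have hc : ∀ {s t}, H.Covers (fun v => pos v 0) (fun v => -pos v 1) .east .south s t ↔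
          H.Covers (fun v => pos v 0) (fun v => pos v 1) .east .north s (-t) :=
        F.covers_flip_transpose
      simp only [one_mul, neg_mul, ← sub_eq_add_neg] at hE hN hab
      refine F.transpose.flip.transpose.eq_of_covers_quadrant (s := s) (t := -t)
        (fun u v h₁ h₂ h₃ h₄ => hb.corner_se h h₁ h₂ h₃ (neg_le_neg_iff.1 h₄)) ?_ ?_ ?_ ha hb' ?_ <;>
        simp only [Dir.opp, hc, neg_add, neg_neg, ← sub_eq_add_neg] <;> assumption
    · have hc : ∀ {s t}, H.Covers (fun v => -pos v 0) (fun v => pos v 1) .west .north s t ↔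
          H.Covers (fun v => pos v 0) (fun v => pos v 1) .east .north (-s) t := F.covers_flip
      simp only [one_mul, neg_mul, ← sub_eq_add_neg] at hE hN hab
      refine F.flip.eq_of_covers_quadrant (s := -s) (t := t)
        (fun u v h₁ h₂ h₃ h₄ => hb.corner_nw h h₁ h₂ (neg_le_neg_iff.1 h₃) h₄) ?_ ?_ ?_ ha hb' ?_ <;>
        simp only [Dir.opp, hc, neg_add, neg_neg, ← sub_eq_add_neg] <;> assumption
    · have hc : ∀ {s t}, H.Covers (fun v => -pos v 0) (fun v => -pos v 1) .west .south s t ↔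
          H.Covers (fun v => pos v 0) (fun v => pos v 1) .east .north (-s) (-t) :=
        F.covers_flip_flip
      simp only [one_mul, neg_mul, ← sub_eq_add_neg] at hE hN hab
      refine F.flip.transpose.flip.transpose.eq_of_covers_quadrant (s := -s) (t := -t)
        (fun u v h₁ h₂ h₃ h₄ => hb.corner_sw h h₁ h₂ (neg_le_neg_iff.1 h₃) (neg_le_neg_iff.1 h₄))
        ?_ ?_ ?_ ha hb' ?_ <;>
        simp only [Dir.opp, hc, neg_add, neg_neg, ← sub_eq_add_neg] <;> assumption

end Shape

/-! ### Convexity of drawings without facing reflex corners -/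

theorem eta_plane (p : Plane) : !₂[p 0, p 1] = p := plane_ext rfl rfl

section

variable {A : Set Plane} {p : Plane}

theorem ReflexFree.face_eq (h : ReflexFree fun s t => !₂[s, t] ∈ A) (hp : p ∉ A)
    (hE : ∃ w, p 0 ≤ w ∧ !₂[w, p 1] ∈ A) (hW : ∃ w, w ≤ p 0 ∧ !₂[w, p 1] ∈ A)
    (hN : ∃ z, p 1 ≤ z ∧ !₂[p 0, z] ∈ A) (hS : ∃ z, z ≤ p 1 ∧ !₂[p 0, z] ∈ A) :
    ∃ a b c d, connectedComponentIn Aᶜ p = {q | a < q 0 ∧ q 0 < b ∧ c < q 1 ∧ q 1 < d} := by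
  obtain ⟨a, b, c, d, ⟨h₁, h₂, h₃, h₄⟩, hfree, hside, hside'⟩ :=
    h.exists_rectangle (by rwa [eta_plane]) hE hW hN hS
  exact ⟨a, b, c, d, isRectangle_face ⟨h₁, h₂, h₃, h₄⟩ hfree hside hside'⟩

theorem isBounded_rectangle (a b c d : ℝ) :
    Bornology.IsBounded {q : Plane | a < q 0 ∧ q 0 < b ∧ c < q 1 ∧ q 1 < d} := by
  have : Bornology.IsBounded ((fun p : ℝ × ℝ => (!₂[p.1, p.2] : Plane)) ''
      (Set.Icc a b ×ˢ Set.Icc c d)) :=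
    ((isCompact_Icc.prod isCompact_Icc).image (by fun_prop)).isBounded
  refine this.subset fun q hq => ⟨(q 0, q 1), ⟨⟨hq.1.le, hq.2.1.le⟩, hq.2.2.1.le, hq.2.2.2.le⟩, ?_⟩
  exact eta_plane q

theorem ReflexFree.isOpenRectangle (h : ReflexFree fun s t => !₂[s, t] ∈ A) (hp : p ∉ A)
    (hb : Bornology.IsBounded (connectedComponentIn Aᶜ p)) :
    Shape.IsOpenRectangle (connectedComponentIn Aᶜ p) := by
  have ray : ∀ a b : ℝ, (a ≠ 0 ∨ b ≠ 0) → ∃ t, 0 ≤ t ∧ !₂[p 0 + t * a, p 1 + t * b] ∈ A := by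
    intro a b hab
    obtain ⟨t, ht, hA⟩ := exists_mem_ray hb (w := !₂[a, b]) (by
      intro h0
      have h₀ := congrArg (fun q : Plane => q 0) h0
      have h₁ := congrArg (fun q : Plane => q 1) h0
      simp at h₀ h₁
      tauto)
    refine ⟨t, ht, ?_⟩
    convert hA using 1
    exact plane_ext (by simp) (by simp)
  refine h.face_eq hp ?_ ?_ ?_ ?_
  · obtain ⟨t, ht, hA⟩ := ray 1 0 (by simp)
    exact ⟨p 0 + t, by linarith, by simpa using hA⟩
  · obtain ⟨t, ht, hA⟩ := ray (-1) 0 (by simp)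
    exact ⟨p 0 - t, by linarith, by simpa [sub_eq_add_neg] using hA⟩
  · obtain ⟨t, ht, hA⟩ := ray 0 1 (by simp)
    exact ⟨p 1 + t, by linarith, by simpa using hA⟩
  · obtain ⟨t, ht, hA⟩ := ray 0 (-1) (by simp)
    exact ⟨p 1 - t, by linarith, by simpa [sub_eq_add_neg] using hA⟩

/-- A point that sees a bounded set without reflex corners in two opposite vertical directions lies
in a bounded face. -/
theorem ReflexFree.exists_horizontal {S : ℝ → ℝ → Prop} (h : ReflexFree S) {B x y : ℝ}
    (hB : ∀ w z, S w z → |w| ≤ B) (hp : ¬ S x y) (hN : ∃ z, y ≤ z ∧ S x z)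
    (hS : ∃ z, z ≤ y ∧ S x z) : (∃ w, x ≤ w ∧ S w y) ∧ ∃ w, w ≤ x ∧ S w y := by
  obtain ⟨z, hz, hxz⟩ := hN
  obtain ⟨d, hd, hSd, hdfree⟩ := exists_first_mem (h.isClosed_column x) hp hz hxz
  obtain ⟨z', hz', hxz'⟩ := hS
  obtain ⟨c, hc, hSc, hcfree⟩ := exists_first_mem ((h.isClosed_column x).preimage continuous_neg)
    (a := -y) (b := -z') (by simpa using hp) (by linarith) (by simpa using hxz')
  have hfree : ∀ z, -c < z → z < d → ¬ S x z := by
    intro z h₁ h₂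
    rcases le_total y z with h₃ | h₃
    · exact hdfree z h₃ h₂
    · simpa using hcfree (-z) (by linarith) (by linarith)
  exact ⟨h.exists_right hSc hSd hfree (by linarith) hd fun w z hwz => (le_abs_self w).trans (hB w z hwz),
    h.exists_left hSc hSd hfree (by linarith) hd fun w z hwz => neg_le_of_abs_le (hB w z hwz)⟩

theorem coord_le_norm (w z : ℝ) : |w| ≤ ‖(!₂[w, z] : Plane)‖ ∧ |z| ≤ ‖(!₂[w, z] : Plane)‖ :=
  ⟨by simpa using PiLp.norm_apply_le (!₂[w, z] : Plane) 0,
    by simpa using PiLp.norm_apply_le (!₂[w, z] : Plane) 1⟩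

/-- An external point between two non-external points of its line would see the drawing on both
sides along this line, hence in all four directions, and so would lie in a bounded rectangle. -/
theorem isConvexDrawing_of_reflexFree {n : ℕ} {H : Shape n} {pos : Fin n → Plane}
    (h : ReflexFree fun s t => !₂[s, t] ∈ H.support pos) : H.IsConvexDrawing pos := by
  refine ⟨fun p hp hb => h.isOpenRectangle hp hb, ?_⟩
  obtain ⟨B, hB⟩ := (Shape.isCompact_support (H := H) (pos := pos)).isBounded.exists_norm_le
  have hsub : ∀ p ∈ H.support pos, p ∈ (H.externalFace pos)ᶜ := fun p hp hext => hext.1 hp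
  have hface : ∀ {p q}, p ∉ H.support pos → q ∈ H.face pos p → q ∈ H.externalFace pos →
      p ∈ H.externalFace pos := by
    intro p q hp hq hext
    refine ⟨hp, ?_⟩
    have := hext.2
    rwa [Shape.face, ← connectedComponentIn_eq hq] at this
  have hconn : ∀ {s : Set Plane}, IsPreconnected s → s ⊆ (H.support pos)ᶜ → ∀ p ∈ s, ∀ q ∈ s,
      q ∈ H.face pos p := fun hs hsA p hp q hq =>
    hs.subset_connectedComponentIn hp hsA hq
  have hE : ∀ {x y}, !₂[x, y] ∈ H.externalFace pos →
      ¬ ((∃ w, x ≤ w ∧ !₂[w, y] ∈ H.support pos) ∧ (∃ w, w ≤ x ∧ !₂[w, y] ∈ H.support pos) ∧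
        (∃ z, y ≤ z ∧ !₂[x, z] ∈ H.support pos) ∧ ∃ z, z ≤ y ∧ !₂[x, z] ∈ H.support pos) := by
    rintro x y hext ⟨h₁, h₂, h₃, h₄⟩
    obtain ⟨a, b, c, d, he⟩ := h.face_eq hext.1 h₁ h₂ h₃ h₄
    apply hext.2
    rw [Shape.face, he]
    exact isBounded_rectangle a b c d
  constructor
  · intro x
    rw [Set.ordConnected_iff]
    rintro c hc d hd - t ⟨hct, htd⟩ hext
    -- An upward ray that avoids the drawing would join the external point to `(x, d)`, which would
    -- then be external as well.
    have hN : ∃ z, t ≤ z ∧ !₂[x, z] ∈ H.support pos := by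
      by_contra hcon
      push Not at hcon
      refine hd (hface (hcon d htd) (hconn (s := (fun z : ℝ => (!₂[x, z] : Plane)) '' Set.Ici t)
        (isPreconnected_Ici.image _ (by fun_prop)) ?_ _ ⟨d, htd, rfl⟩ _ ⟨t, Set.self_mem_Ici, rfl⟩) hext)
      rintro _ ⟨z, hz, rfl⟩
      exact hcon z hz
    have hS : ∃ z, z ≤ t ∧ !₂[x, z] ∈ H.support pos := by
      by_contra hcon
      push Not at hcon
      refine hc (hface (hcon c hct) (hconn (s := (fun z : ℝ => (!₂[x, z] : Plane)) '' Set.Iic t)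
        (isPreconnected_Iic.image _ (by fun_prop)) ?_ _ ⟨c, hct, rfl⟩ _ ⟨t, Set.self_mem_Iic, rfl⟩) hext)
      rintro _ ⟨z, hz, rfl⟩
      exact hcon z hz
    obtain ⟨h₁, h₂⟩ := h.exists_horizontal (B := B)
      (fun w z hwz => (coord_le_norm w z).1.trans (hB _ hwz)) hext.1 hN hS
    exact hE hext ⟨h₁, h₂, hN, hS⟩
  · intro y
    rw [Set.ordConnected_iff]
    rintro c hc d hd - t ⟨hct, htd⟩ hext
    have hN : ∃ z, t ≤ z ∧ !₂[z, y] ∈ H.support pos := by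
      by_contra hcon
      push Not at hcon
      refine hd (hface (hcon d htd) (hconn (s := (fun z : ℝ => (!₂[z, y] : Plane)) '' Set.Ici t)
        (isPreconnected_Ici.image _ (by fun_prop)) ?_ _ ⟨d, htd, rfl⟩ _ ⟨t, Set.self_mem_Ici, rfl⟩) hext)
      rintro _ ⟨z, hz, rfl⟩
      exact hcon z hz
    have hS : ∃ z, z ≤ t ∧ !₂[z, y] ∈ H.support pos := by
      by_contra hcon
      push Not at hcon
      refine hc (hface (hcon c hct) (hconn (s := (fun z : ℝ => (!₂[z, y] : Plane)) '' Set.Iic t)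
        (isPreconnected_Iic.image _ (by fun_prop)) ?_ _ ⟨c, hct, rfl⟩ _ ⟨t, Set.self_mem_Iic, rfl⟩) hext)
      rintro _ ⟨z, hz, rfl⟩
      exact hcon z hz
    obtain ⟨h₁, h₂⟩ := h.transpose.exists_horizontal (B := B)
      (fun w z hwz => (coord_le_norm z w).2.trans (hB _ hwz)) hext.1 hN hS
    exact hE hext ⟨hN, hS, h₁, h₂⟩

end

theorem Shape.IsBoxConnected.isConvexDrawing {n : ℕ} {H : Shape n} {pos : Fin n → Plane}
    (hb : H.IsBoxConnected pos) (h : H.IsDrawing pos) : H.IsConvexDrawing pos :=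
  isConvexDrawing_of_reflexFree (hb.reflexFree h)

/-! ### Convex drawings have no reflex corners facing a vertex -/

theorem exists_gap {ι : Type*} [Finite ι] (f g : ι → ℝ) (c d : ℝ) :
    ∃ ε > 0, ∀ i, (c < f i → c + ε ≤ f i) ∧ (d < g i → d + ε ≤ g i) := by
  have key : ∀ a b : ℝ, ∀ᶠ ε in nhdsWithin (0 : ℝ) (Set.Ioi 0), a < b → a + ε ≤ b := by
    intro a b
    by_cases hab : a < b
    · filter_upwards [Ioo_mem_nhdsGT (sub_pos.2 hab)] with ε hε _
      linarith [hε.2]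
    · exact .of_forall fun ε h => absurd h hab
  have hpos : ∀ᶠ ε in nhdsWithin (0 : ℝ) (Set.Ioi 0), 0 < ε := self_mem_nhdsWithin
  have := hpos.and (Filter.eventually_all.2 fun i => (key c (f i)).and (key d (g i)))
  obtain ⟨ε, hε, h⟩ := this.exists
  exact ⟨ε, hε, h⟩

namespace Shape

variable {n : ℕ} {H : Shape n} {x y : Fin n → ℝ} {e r : Dir} {pos : Fin n → Plane}

/-- `ε` is so small that no vertex coordinate lies strictly between that of `u` and `ε` beyond it.
An edge that enters the small square would have to start at `u` or pass through `u`, and both are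
excluded. -/
theorem Frame.exists_free_corner (_F : Frame H x y e r)
    (hinj : ∀ u v, x u = x v → y u = y v → u = v)
    (hce : ∀ a b v, H.Step e a b → y v = y a → x a < x v → x v < x b → False)
    (hcr : ∀ a b v, H.Step r a b → x v = x a → y a < y v → y v < y b → False) {u : Fin n}
    (he : H.nbr u e = none) (hr : H.nbr u r = none) :
    ∃ ε > 0, ∀ s t, 0 ≤ s → s < ε → 0 ≤ t → t < ε → (s ≠ 0 ∨ t ≠ 0) →
      ¬ H.Covers x y e r (x u + s) (y u + t) := by
  obtain ⟨ε, hε, hgap⟩ := exists_gap x y (x u) (y u)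
  refine ⟨ε, hε, fun s t hs hsε ht htε hst => ?_⟩
  have hx : ∀ v, x v ≤ x u + s → x v ≤ x u := fun v hv => by
    by_contra h
    linarith [(hgap v).1 (not_le.1 h)]
  have hy : ∀ v, y v ≤ y u + t → y v ≤ y u := fun v hv => by
    by_contra h
    linarith [(hgap v).2 (not_le.1 h)]
  rintro (⟨v, h₁, h₂⟩ | ⟨a, b, h, h₁, h₂, h₃⟩ | ⟨a, b, h, h₁, h₂, h₃⟩)
  · have := hx v h₁.le
    have := hy v h₂.le
    rcases hst with hst | hst <;> apply hst <;> linarith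
  · have := hx a h₁
    have := hy a h₃.le
    obtain rfl : t = 0 := by linarith
    have hs' : 0 < s := hs.lt_of_ne fun h => by simp [← h] at hst
    rcases this.eq_or_lt with h' | h' <;> [skip; linarith]
    rcases (hx a h₁).eq_or_lt with h'' | h''
    · obtain rfl := hinj a u h'' h'
      simp [Step, he] at h
    · exact hce a b u h h'.symm h'' (by linarith)
  · have := hy a h₁
    have := hx a h₃.le
    obtain rfl : s = 0 := by linarith
    have ht' : 0 < t := ht.lt_of_ne fun h => by simp [← h] at hst
    rcases this.eq_or_lt with h' | h' <;> [skip; linarith]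
    rcases (hy a h₁).eq_or_lt with h'' | h''
    · obtain rfl := hinj a u h' h''
      simp [Step, hr] at h
    · exact hcr a b u h h'.symm h'' (by linarith)

/-- An edge that leaves the open quadrant meets one of the two rays. So a walk that starts in the
quadrant never gets to `u`. -/
theorem Frame.not_mem_quadrant (F : Frame H x y e r) (hconn : H.graph.Connected) {u : Fin n}
    (hE : ∀ s, 0 < s → ¬ H.Covers x y e r (x u + s) (y u))
    (hN : ∀ t, 0 < t → ¬ H.Covers x y e r (x u) (y u + t)) {v : Fin n} (hx : x u < x v)
    (hy : y u < y v) : False := by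
  obtain ⟨p⟩ := hconn.preconnected v u
  suffices ∀ a b, H.graph.Walk a b → x u < x a → y u < y a → x u < x b ∧ y u < y b from
    lt_irrefl _ (this v u p hx hy).1
  intro a b p
  induction p with
  | nil => exact fun h₁ h₂ => ⟨h₁, h₂⟩
  | @cons a c _ hac p ih =>
    intro h₁ h₂
    suffices x u < x c ∧ y u < y c from ih this.1 this.2
    rcases F.adj_cases hac with hs | hs | hs | hs
    · have := F.right hs
      constructor <;> linarith
    · have := F.right hs
      refine ⟨not_le.1 fun hle => hN (y a - y u) (by linarith) ?_, by linarith⟩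
      exact .inr (.inl ⟨c, a, hs, hle, h₁.le, by linarith⟩)
    · have := F.up hs
      constructor <;> linarith
    · have := F.up hs
      refine ⟨by linarith, not_le.1 fun hle => hE (x a - x u) (by linarith) ?_⟩
      exact .inr (.inr ⟨c, a, hs, hle, h₂.le, by linarith⟩)

/-- The points near `p` on both arms lie in a common face, which cannot be a rectangle and hence is
external. A covered point farther out on an arm would enclose such an external point between two
points of the orthoconvex region. -/
theorem IsConvexDrawing.rays_free (hc : H.IsConvexDrawing pos) {p : Plane} (hp : p ∈ H.support pos)
    {σ τ : ℝ} (hσ : σ = 1 ∨ σ = -1) (hτ : τ = 1 ∨ τ = -1) {ε : ℝ} (hε : 0 < ε)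
    (hfree : ∀ s t, 0 ≤ s → s < ε → 0 ≤ t → t < ε → (s ≠ 0 ∨ t ≠ 0) →
      !₂[p 0 + σ * s, p 1 + τ * t] ∉ H.support pos) :
    (∀ s, 0 < s → !₂[p 0 + σ * s, p 1] ∉ H.support pos) ∧
      ∀ t, 0 < t → !₂[p 0, p 1 + τ * t] ∉ H.support pos := by
  have hext : ∀ s, 0 < s → s < ε → !₂[p 0 + σ * s, p 1] ∈ H.externalFace pos ∧
      !₂[p 0, p 1 + τ * s] ∈ H.externalFace pos := by
    intro s hs hsε
    have h₁ : !₂[p 0 + σ * s, p 1] ∉ H.support pos := by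
      simpa using hfree s 0 hs.le hsε le_rfl hε (.inl hs.ne')
    have h₂ : !₂[p 0, p 1 + τ * s] ∉ H.support pos := by
      simpa using hfree 0 s le_rfl hε hs.le hsε (.inr hs.ne')
    -- A path of two segments goes around the corner, through the point at offset `s` in both
    -- directions.
    have hpre : IsPreconnected (((fun t => (!₂[p 0 + σ * s, p 1 + τ * t] : Plane)) '' Set.Icc 0 s) ∪
        (fun t => (!₂[p 0 + σ * t, p 1 + τ * s] : Plane)) '' Set.Icc 0 s) :=
      IsPreconnected.union !₂[p 0 + σ * s, p 1 + τ * s] ⟨s, ⟨hs.le, le_rfl⟩, rfl⟩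
        ⟨s, ⟨hs.le, le_rfl⟩, rfl⟩ (isPreconnected_Icc.image _ (by fun_prop))
        (isPreconnected_Icc.image _ (by fun_prop))
    have hsub := hpre.subset_connectedComponentIn (x := !₂[p 0 + σ * s, p 1]) (F := (H.support pos)ᶜ)
      (.inl ⟨0, ⟨le_rfl, hs.le⟩, by simp⟩) (by
        rintro _ (⟨t, ht, rfl⟩ | ⟨t, ht, rfl⟩)
        · exact hfree s t hs.le hsε ht.1 (ht.2.trans_lt hsε) (.inl hs.ne')
        · exact hfree t s ht.1 (ht.2.trans_lt hsε) hs.le hsε (.inr hs.ne'))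
    have hmem : !₂[p 0, p 1 + τ * s] ∈ H.face pos !₂[p 0 + σ * s, p 1] :=
      hsub (.inr ⟨0, ⟨le_rfl, hs.le⟩, by simp⟩)
    have hunb : ¬ Bornology.IsBounded (H.face pos !₂[p 0 + σ * s, p 1]) := by
      intro hb
      obtain ⟨a, b, c, d, he⟩ := hc.1 _ h₁ hb
      have hm₁ : !₂[p 0 + σ * s, p 1] ∈ H.face pos !₂[p 0 + σ * s, p 1] :=
        mem_connectedComponentIn h₁
      have hm₂ := hmem
      rw [he] at hm₁ hm₂
      -- `p` shares one coordinate with each of the two points, so a rectangle that contains both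
      -- contains `p`.
      have hpf : p ∈ H.face pos !₂[p 0 + σ * s, p 1] := by
        rw [he]
        exact ⟨hm₂.1, hm₂.2.1, hm₁.2.2.1, hm₁.2.2.2⟩
      exact connectedComponentIn_subset _ _ hpf hp
    refine ⟨⟨h₁, hunb⟩, h₂, ?_⟩
    rwa [face, ← connectedComponentIn_eq hmem]
  have hcompl : ∀ {q}, q ∈ H.support pos → q ∈ (H.externalFace pos)ᶜ := fun hq h => h.1 hq
  have hbetween : ∀ {σ c s s' : ℝ}, (σ = 1 ∨ σ = -1) → 0 < s' → s' < s →
      c + σ * s' ∈ Set.uIcc c (c + σ * s) := by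
    rintro σ c s s' (rfl | rfl) h h'
    · exact Set.mem_uIcc.2 (.inl ⟨by linarith, by linarith⟩)
    · exact Set.mem_uIcc.2 (.inr ⟨by linarith, by linarith⟩)
  constructor
  · intro s hs hmem
    obtain ⟨s', hs', hlt⟩ := exists_between (lt_min hε hs)
    rw [lt_min_iff] at hlt
    exact (hc.2.2 (p 1)).uIcc_subset (x := p 0) (y := p 0 + σ * s)
      (hcompl (by rwa [eta_plane])) (hcompl hmem) (hbetween hσ hs' hlt.2) (hext s' hs' hlt.1).1
  · intro s hs hmem
    obtain ⟨s', hs', hlt⟩ := exists_between (lt_min hε hs)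
    rw [lt_min_iff] at hlt
    exact (hc.2.1 (p 0)).uIcc_subset (x := p 1) (y := p 1 + τ * s)
      (hcompl (by rwa [eta_plane])) (hcompl hmem) (hbetween hτ hs' hlt.2) (hext s' hs' hlt.1).2

/-- Planarity speaks only of pairs of edges, so connectedness has to supply an edge at `u`. -/
theorem IsDrawing.eq_or_eq_of_mem_segment (h : H.IsDrawing pos) (hconn : H.graph.Connected)
    {a b u : Fin n} (hab : H.graph.Adj a b) (hu : pos u ∈ segment ℝ (pos a) (pos b)) :
    u = a ∨ u = b := by
  by_contra hne
  push Not at hne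
  obtain ⟨w, huw⟩ : ∃ w, H.graph.Adj u w := by
    obtain ⟨p⟩ := hconn.preconnected u a
    cases p with
    | nil => exact absurd rfl hne.1
    | cons h _ => exact ⟨_, h⟩
  obtain ⟨t, -, ht, he⟩ := h.planar u w a b huw hab (fun h => by
    have : u ∈ s(a, b) := h ▸ Sym2.mem_mk_left u w
    rw [Sym2.mem_iff] at this
    tauto) (pos u) (left_mem_segment ℝ _ _) hu
  rw [← h.injective he, Sym2.mem_iff] at ht
  tauto

theorem IsConvexDrawing.isCornerFree (hc : H.IsConvexDrawing pos) (h : H.IsDrawing pos)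
    (hconn : H.graph.Connected) : H.IsCornerFree pos := by
  have F := h.frame
  have hinj : ∀ u v, pos u 0 = pos v 0 → pos u 1 = pos v 1 → u = v := fun u v h₀ h₁ =>
    h.injective (plane_ext h₀ h₁)
  have hce : ∀ a b v, H.Step .east a b → pos v 1 = pos a 1 → pos a 0 < pos v 0 →
      pos v 0 < pos b 0 → False := by
    intro a b v hab h₁ h₂ h₃
    rcases h.eq_or_eq_of_mem_segment hconn hab.adj (u := v) ((h.mem_segment_iff hab.adj).2
      ⟨Set.mem_uIcc.2 (.inl ⟨h₂.le, h₃.le⟩), by simp [h₁]⟩) with rfl | rfl <;> linarith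
  have hcr : ∀ a b v, H.Step .north a b → pos v 0 = pos a 0 → pos a 1 < pos v 1 →
      pos v 1 < pos b 1 → False := by
    intro a b v hab h₁ h₂ h₃
    rcases h.eq_or_eq_of_mem_segment hconn hab.adj (u := v) ((h.mem_segment_iff hab.adj).2
      ⟨by simp [h₁], Set.mem_uIcc.2 (.inl ⟨h₂.le, h₃.le⟩)⟩) with rfl | rfl <;> linarith
  have hce' : ∀ a b v, H.Step .west a b → pos v 1 = pos a 1 → pos v 0 < pos a 0 →
      pos b 0 < pos v 0 → False := fun a b v hab h₁ h₂ h₃ =>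
    have hs : H.Step .east b a := hab.opp
    hce b a v hs (h₁.trans (h.east hs).2.symm) h₃ h₂
  have hcr' : ∀ a b v, H.Step .south a b → pos v 0 = pos a 0 → pos v 1 < pos a 1 →
      pos b 1 < pos v 1 → False := fun a b v hab h₁ h₂ h₃ =>
    have hs : H.Step .north b a := hab.opp
    hcr b a v hs (h₁.trans (h.north hs).1.symm) h₃ h₂
  have hmem : ∀ u, pos u ∈ H.support pos := fun u => .inl ⟨u, rfl⟩
  have one : (1 : ℝ) = 1 ∨ (1 : ℝ) = -1 := .inl rfl
  have negone : (-1 : ℝ) = 1 ∨ (-1 : ℝ) = -1 := .inr rfl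
  refine ⟨?_, ?_, ?_, ?_⟩
  · intro u v he hr hx hy
    obtain ⟨ε, hε, hfree⟩ := F.exists_free_corner hinj hce hcr he hr
    obtain ⟨h₁, h₂⟩ := hc.rays_free (hmem u) one one hε (by
      simpa only [one_mul, h.mem_support_iff] using hfree)
    simp only [one_mul, h.mem_support_iff] at h₁ h₂
    exact F.not_mem_quadrant hconn h₁ h₂ hx hy
  · intro u v he hr hx hy
    have G := F.flip
    have hcov : ∀ {s t}, H.Covers (fun v => -pos v 0) (fun v => pos v 1) .west .north s t ↔ _ :=
      F.covers_flip
    obtain ⟨ε, hε, hfree⟩ := G.exists_free_corner (fun u v h₀ h₁ => hinj u v (neg_inj.1 h₀) h₁)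
      (fun a b v h₁ h₂ h₃ h₄ => hce' a b v h₁ h₂ (neg_lt_neg_iff.1 h₃) (neg_lt_neg_iff.1 h₄))
      (fun a b v h₁ h₂ h₃ h₄ => hcr a b v h₁ (neg_inj.1 h₂) h₃ h₄) he hr
    simp only [Dir.opp, hcov, neg_add, neg_neg, ← sub_eq_add_neg] at hfree
    obtain ⟨h₁, h₂⟩ := hc.rays_free (hmem u) negone one hε (by
      simpa only [one_mul, neg_mul, ← sub_eq_add_neg, h.mem_support_iff] using hfree)
    simp only [one_mul, neg_mul, ← sub_eq_add_neg, h.mem_support_iff] at h₁ h₂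
    refine G.not_mem_quadrant hconn (u := u) ?_ ?_ hx hy <;>
      simpa only [Dir.opp, hcov, neg_add, neg_neg, ← sub_eq_add_neg]
  · intro u v he hr hx hy
    have G := F.transpose.flip.transpose
    have hcov : ∀ {s t}, H.Covers (fun v => pos v 0) (fun v => -pos v 1) .east .south s t ↔ _ :=
      F.covers_flip_transpose
    obtain ⟨ε, hε, hfree⟩ := G.exists_free_corner (fun u v h₀ h₁ => hinj u v h₀ (neg_inj.1 h₁))
      (fun a b v h₁ h₂ h₃ h₄ => hce a b v h₁ (neg_inj.1 h₂) h₃ h₄)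
      (fun a b v h₁ h₂ h₃ h₄ => hcr' a b v h₁ h₂ (neg_lt_neg_iff.1 h₃) (neg_lt_neg_iff.1 h₄)) he hr
    simp only [Dir.opp, hcov, neg_add, neg_neg, ← sub_eq_add_neg] at hfree
    obtain ⟨h₁, h₂⟩ := hc.rays_free (hmem u) one negone hε (by
      simpa only [one_mul, neg_mul, ← sub_eq_add_neg, h.mem_support_iff] using hfree)
    simp only [one_mul, neg_mul, ← sub_eq_add_neg, h.mem_support_iff] at h₁ h₂
    refine G.not_mem_quadrant hconn (u := u) ?_ ?_ hx hy <;>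
      simpa only [Dir.opp, hcov, neg_add, neg_neg, ← sub_eq_add_neg]
  · intro u v he hr hx hy
    have G := F.flip.transpose.flip.transpose
    have hcov : ∀ {s t}, H.Covers (fun v => -pos v 0) (fun v => -pos v 1) .west .south s t ↔ _ :=
      F.covers_flip_flip
    obtain ⟨ε, hε, hfree⟩ := G.exists_free_corner
      (fun u v h₀ h₁ => hinj u v (neg_inj.1 h₀) (neg_inj.1 h₁))
      (fun a b v h₁ h₂ h₃ h₄ => hce' a b v h₁ (neg_inj.1 h₂) (neg_lt_neg_iff.1 h₃)
        (neg_lt_neg_iff.1 h₄))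
      (fun a b v h₁ h₂ h₃ h₄ => hcr' a b v h₁ (neg_inj.1 h₂) (neg_lt_neg_iff.1 h₃)
        (neg_lt_neg_iff.1 h₄)) he hr
    simp only [Dir.opp, hcov, neg_add, neg_neg, ← sub_eq_add_neg] at hfree
    obtain ⟨h₁, h₂⟩ := hc.rays_free (hmem u) negone negone hε (by
      simpa only [one_mul, neg_mul, ← sub_eq_add_neg, h.mem_support_iff] using hfree)
    simp only [one_mul, neg_mul, ← sub_eq_add_neg, h.mem_support_iff] at h₁ h₂
    refine G.not_mem_quadrant hconn (u := u) ?_ ?_ hx hy <;>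
      simpa only [Dir.opp, hcov, neg_add, neg_neg, ← sub_eq_add_neg]

end Shape

/-! ### The characterization of universal greedy representations -/

theorem RectilinearRep.universalGreedy_iff_isConvex {n : ℕ} (H : RectilinearRep n)
    (hconn : H.graph.Connected) : H.UniversalGreedy ↔
      H.IsConvex ∧ HasHamiltonianPath H.dagX ∧ HasHamiltonianPath H.dagY := by
  obtain ⟨pos, h⟩ := H.exists_drawing
  rw [Shape.hasHamiltonianPath_dagX_iff, Shape.hasHamiltonianPath_dagY_iff]
  constructor
  · intro hg
    have hb := hg.isBoxConnected h
    exact ⟨fun pos' h' => (hg.isBoxConnected h').isConvexDrawing h', hb.exists_ranking_east h,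
      hb.exists_ranking_north h⟩
  · rintro ⟨hc, hx, hy⟩
    exact (universalGreedy_iff_of_isDrawing h).2 ⟨hx, hy, (hc pos h).isCornerFree h hconn⟩

/-! ### A small structured language -/

/-- A state of the structured language: registers and arrays. -/
structure State where
  reg : ℕ → ℕ
  arr : ℕ → ℕ → ℕ

/-- Basic operations. -/
inductive Op : Type
  /-- `r i := 0` or `r i := 1` -/
  | bit (i : ℕ) (b : Bool)
  /-- `r i := r j` -/
  | mov (i j : ℕ)
  /-- `r i := r j + 1`, but at most `n + 1` -/
  | inc (i j : ℕ)
  /-- `r i := r j - r k` -/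
  | sub (i j k : ℕ)
  /-- `r i := a (r j)` for an array `a` -/
  | ld (i a j : ℕ)
  /-- `a (r i) := r j` for an array `a` -/
  | st (a i j : ℕ)

/-- Commands without loops. -/
inductive Cmd : Type
  | skip
  | op (o : Op)
  | seq (c₁ c₂ : Cmd)
  /-- if `r j < r k` then `c₁` else `c₂` -/
  | ite (j k : ℕ) (c₁ c₂ : Cmd)

/-- Statements: commands, and loops that execute a command for `r 0 = 0, …, n - 1`. -/
inductive Stm : Type
  | cmd (c : Cmd)
  | loop (c : Cmd)

namespace State

/-- The assignment of a value to a register. -/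
def set (S : State) (i v : ℕ) : State := ⟨Function.update S.reg i v, S.arr⟩

/-- The assignment of a value to an array cell. -/
def put (S : State) (a i v : ℕ) : State :=
  ⟨S.reg, Function.update S.arr a (Function.update (S.arr a) i v)⟩

/-- All values are at most `n + 1`. -/
def Bounded (n : ℕ) (S : State) : Prop := (∀ i, S.reg i ≤ n + 1) ∧ ∀ a i, S.arr a i ≤ n + 1

theorem Bounded.set {n : ℕ} {S : State} (h : S.Bounded n) {v : ℕ} (i : ℕ) (hv : v ≤ n + 1) :
    (S.set i v).Bounded n :=
  ⟨fun j => by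
    simp only [State.set, Function.update_apply]
    split_ifs
    exacts [hv, h.1 j], h.2⟩

theorem Bounded.put {n : ℕ} {S : State} (h : S.Bounded n) {v : ℕ} (a i : ℕ) (hv : v ≤ n + 1) :
    (S.put a i v).Bounded n :=
  ⟨h.1, fun b j => by
    simp only [State.put, Function.update_apply]
    split_ifs with h₁
    · subst h₁
      simp only [Function.update_apply]
      split_ifs
      exacts [hv, h.2 _ _]
    · exact h.2 b j⟩

end State

/-- The semantics of the operations. -/
def Op.eval (n : ℕ) : Op → State → State
  | .bit i b, S => S.set i b.toNat
  | .mov i j, S => S.set i (S.reg j)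
  | .inc i j, S => S.set i (if S.reg j < n + 1 then S.reg j + 1 else S.reg j)
  | .sub i j k, S => S.set i (S.reg j - S.reg k)
  | .ld i a j, S => S.set i (S.arr a (S.reg j))
  | .st a i j, S => S.put a (S.reg i) (S.reg j)

/-- The semantics of the commands. -/
def Cmd.eval (n : ℕ) : Cmd → State → State
  | .skip, S => S
  | .op o, S => o.eval n S
  | .seq c₁ c₂, S => c₂.eval n (c₁.eval n S)
  | .ite j k c₁ c₂, S => if S.reg j < S.reg k then c₁.eval n S else c₂.eval n S

/-- The first `m` iterations of a loop. -/
def Cmd.iter (n : ℕ) (c : Cmd) (S : State) : ℕ → State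
  | 0 => S
  | m + 1 => c.eval n ((c.iter n S m).set 0 m)

/-- The semantics of the statements. -/
def Stm.eval (n : ℕ) : Stm → State → State
  | .cmd c, S => c.eval n S
  | .loop c, S => c.iter n S n

/-- The semantics of the lists of statements. -/
def evalList (n : ℕ) (l : List Stm) (S : State) : State := l.foldl (fun S s => s.eval n S) S

/-! ### Compilation -/

/-- The code that computes in register `3` the address of a cell of the array `a`. -/
def addrCode (a j : ℕ) : List Instr :=
  -- Register `i` of the language is machine register `i + 8`. Machine registers `0`, `1`, `2` hold
  -- `n`, `n + 1`, `n + 2`, registers `3` and `4` are scratch, `5` is the loop counter, and `6`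
  -- holds `1`.
  .copy 3 (j + 8) :: (List.replicate (a / 4) (.add 3 3 2) ++
    [.add 3 3 3, .add 3 3 3, .const 4 (a % 4), .add 3 3 4])

/-- The code of an operation. -/
def Op.code : Op → List Instr
  | .bit i b => [.const (i + 8) b.toNat]
  | .mov i j => [.copy (i + 8) (j + 8)]
  -- Subtracting twice from `1` turns `n + 1 - r j` into `1` if `r j < n + 1` and into `0`
  -- otherwise, so the cap needs no jump.
  | .inc i j => [.sub 3 1 (j + 8), .sub 3 6 3, .sub 3 6 3, .add (i + 8) (j + 8) 3]
  | .sub i j k => [.sub (i + 8) (j + 8) (k + 8)]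
  | .ld i a j => addrCode a j ++ [.load (i + 8) 3]
  | .st a i j => addrCode a i ++ [.store 3 (j + 8)]

/-- The largest number of an array block that is used. -/
def Op.block : Op → ℕ
  | .ld _ a _ => a / 4
  | .st a _ _ => a / 4
  | _ => 0

/-- The length of the code of a command. -/
def Cmd.len : Cmd → ℕ
  | .skip => 0
  | .op o => o.code.length
  | .seq c₁ c₂ => c₁.len + c₂.len
  | .ite _ _ c₁ c₂ => c₁.len + c₂.len + 2

/-- The code of a command that is to be placed at a given position. -/
def Cmd.code : Cmd → ℕ → List Instr
  | .skip, _ => []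
  | .op o, _ => o.code
  | .seq c₁ c₂, p => c₁.code p ++ c₂.code (p + c₁.len)
  | .ite j k c₁ c₂, p => .jumpLt (j + 8) (k + 8) (p + c₂.len + 2) :: (c₂.code (p + 1) ++
      .jump (p + c₁.len + c₂.len + 2) :: c₁.code (p + c₂.len + 2))

/-- The largest number of an array block that is used. -/
def Cmd.block : Cmd → ℕ
  | .skip => 0
  | .op o => o.block
  | .seq c₁ c₂ => max c₁.block c₂.block
  | .ite _ _ c₁ c₂ => max c₁.block c₂.block

/-- The length of the code of a statement. -/
def Stm.len : Stm → ℕ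
  | .cmd c => c.len
  | .loop c => c.len + 6

/-- The code of a statement that is to be placed at a given position. -/
def Stm.code : Stm → ℕ → List Instr
  | .cmd c, p => c.code p
  -- The counter is out of reach of the body, which only receives a copy of it in its register `0`.
  | .loop c, p => .const 5 0 :: .jumpLt 5 0 (p + 3) :: .jump (p + c.len + 6) :: .copy 8 5 ::
      (c.code (p + 4) ++ [.add 5 5 6, .jump (p + 1)])

/-- The largest number of an array block that is used. -/
def Stm.block : Stm → ℕ
  | .cmd c => c.block
  | .loop c => c.block

/-- The code of a list of statements that is to be placed at a given position. -/
def codeList : List Stm → ℕ → List Instr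
  | [], _ => []
  | s :: l, p => s.code p ++ codeList l (p + s.len)

theorem Cmd.length_code (c : Cmd) (p : ℕ) : (c.code p).length = c.len := by
  induction c generalizing p with
  | skip => rfl
  | op o => rfl
  | seq c₁ c₂ ih₁ ih₂ => simp [code, len, ih₁, ih₂]
  | ite j k c₁ c₂ ih₁ ih₂ => simp [code, len, ih₁, ih₂]; omega

theorem Stm.length_code (s : Stm) (p : ℕ) : (s.code p).length = s.len := by
  cases s with
  | cmd c => exact c.length_code p
  | loop c => simp [code, len, c.length_code]

/-- The code `l` stands at position `p` of the program `P`. -/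
def CodeAt (P : Program) (p : ℕ) (l : List Instr) : Prop :=
  ∀ i I, l[i]? = some I → P[p + i]? = some I

theorem codeAt_cons {P : Program} {p : ℕ} {I : Instr} {l : List Instr} :
    CodeAt P p (I :: l) ↔ P[p]? = some I ∧ CodeAt P (p + 1) l := by
  constructor
  · intro h
    refine ⟨h 0 I rfl, fun i J hJ => ?_⟩
    rw [add_assoc, add_comm 1]
    exact h (i + 1) J (by simpa using hJ)
  · rintro ⟨h₁, h₂⟩ (_ | i) J hJ
    · obtain rfl : I = J := by simpa using hJ
      exact h₁
    · rw [add_comm i, ← add_assoc]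
      exact h₂ i J (by simpa using hJ)

theorem codeAt_append {P : Program} {p : ℕ} {l₁ l₂ : List Instr} :
    CodeAt P p (l₁ ++ l₂) ↔ CodeAt P p l₁ ∧ CodeAt P (p + l₁.length) l₂ := by
  induction l₁ generalizing p with
  | nil => simp [CodeAt]
  | cons I l ih =>
    rw [List.cons_append, codeAt_cons, ih, codeAt_cons, List.length_cons, and_assoc, add_assoc,
      add_comm 1]

/-! ### Correctness of the compilation -/

/-- All values of a configuration are at most `W`. -/
def Config.Bounded (W : ℕ) (s : Config) : Prop := ∀ i, s.reg i ≤ W ∧ s.mem i ≤ W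

/-- The program leads from `s` to `s'` in `k` steps, and all values are at most `W`. -/
def Leads (P : Program) (W : ℕ) (s s' : Config) (k : ℕ) : Prop :=
  run P s k = s' ∧ ∀ t ≤ k, (run P s t).Bounded W

theorem run_add (P : Program) (s : Config) (t t' : ℕ) : run P s (t + t') = run P (run P s t) t' := by
  unfold run
  rw [add_comm, Function.iterate_add_apply]

theorem Leads.trans {P : Program} {W : ℕ} {s₁ s₂ s₃ : Config} {k k' : ℕ} (h : Leads P W s₁ s₂ k)
    (h' : Leads P W s₂ s₃ k') : Leads P W s₁ s₃ (k + k') := by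
  obtain ⟨rfl, h⟩ := h
  refine ⟨by rw [run_add, h'.1], fun t ht => ?_⟩
  rcases le_total t k with htk | htk
  · exact h t htk
  · obtain ⟨m, rfl⟩ := Nat.exists_eq_add_of_le htk
    rw [run_add]
    exact h'.2 m (by omega)

theorem Leads.refl {P : Program} {W : ℕ} {s : Config} (h : s.Bounded W) : Leads P W s s 0 :=
  ⟨rfl, fun t ht => by obtain rfl := Nat.le_zero.1 ht; exact h⟩

theorem Leads.exec {P : Program} {W : ℕ} {s : Config} {I : Instr} (hI : P[s.pc]? = some I)
    (h : s.Bounded W) (h' : (I.exec s).Bounded W) : Leads P W s (I.exec s) 1 := by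
  have hs : run P s 1 = I.exec s := by simp [run, step, hI]
  refine ⟨hs, fun t ht => ?_⟩
  interval_cases t
  · exact h
  · rwa [hs]

theorem Config.Bounded.update {W : ℕ} {s : Config} (h : s.Bounded W) (p : ℕ) {i v : ℕ} (hv : v ≤ W) :
    Config.Bounded W ⟨p, Function.update s.reg i v, s.mem⟩ := fun j =>
  ⟨by
    simp only [Function.update_apply]
    split_ifs
    exacts [hv, (h j).1], (h j).2⟩

theorem Config.Bounded.update_mem {W : ℕ} {s : Config} (h : s.Bounded W) (p : ℕ) {i v : ℕ}
    (hv : v ≤ W) : Config.Bounded W ⟨p, s.reg, Function.update s.mem i v⟩ := fun j =>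
  ⟨(h j).1, by
    simp only [Function.update_apply]
    split_ifs
    exacts [hv, (h j).2]⟩

/-- The address of a cell of an array. -/
def cellAddr (n a i : ℕ) : ℕ := 4 * (a / 4 * (n + 2) + i) + a % 4

/-- Four arrays are interleaved in each block of `4 (n + 2)` cells, so the input table is arrays `0,
…, 3` without any copying. All values of the language are at most `n + 1`, hence so are all indices,
and blocks do not overlap. -/
theorem cellAddr_inj {n a b i j : ℕ} (hi : i ≤ n + 1) (hj : j ≤ n + 1)
    (h : cellAddr n a i = cellAddr n b j) : a = b ∧ i = j := by
  unfold cellAddr at h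
  have h₁ : a % 4 = b % 4 := by omega
  have h₂ : a / 4 * (n + 2) + i = b / 4 * (n + 2) + j := by omega
  have h₃ : ∀ q k, k ≤ n + 1 → (q * (n + 2) + k) / (n + 2) = q := fun q k hk => by
    rw [mul_comm, Nat.mul_add_div (by omega), Nat.div_eq_of_lt (by omega), add_zero]
  have h₄ : a / 4 = b / 4 := by rw [← h₃ (a / 4) i hi, h₂, h₃ _ _ hj]
  rw [h₄] at h₂
  exact ⟨by omega, by omega⟩

/-- The bound for all numbers if `Q` is the number of the last array block. -/
def wordBound (n Q : ℕ) : ℕ := 4 * ((Q + 1) * (n + 2))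

/-- The configuration `s` represents the state `S`, and the current loop counter is `m`. -/
structure Represents (n Q m : ℕ) (S : State) (s : Config) : Prop where
  size : s.reg 0 = n
  cap : s.reg 1 = n + 1
  stride : s.reg 2 = n + 2
  counter : s.reg 5 = m
  one : s.reg 6 = 1
  reg : ∀ i, s.reg (i + 8) = S.reg i
  arr : ∀ a i, i ≤ n + 1 → s.mem (cellAddr n a i) = S.arr a i
  bounded : s.Bounded (wordBound n Q)
  bounded_state : S.Bounded n

theorem leads_replicate_add {P : Program} {W k p : ℕ} {s : Config} (hp : s.pc = p)
    (hP : CodeAt P p (List.replicate k (.add 3 3 2))) (hs : s.Bounded W)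
    (hW : s.reg 3 + k * s.reg 2 ≤ W) :
    Leads P W s ⟨p + k, Function.update s.reg 3 (s.reg 3 + k * s.reg 2), s.mem⟩ k := by
  induction k generalizing s p with
  | zero =>
    subst hp
    simpa using Leads.refl hs
  | succ k ih =>
    rw [List.replicate_succ, codeAt_cons] at hP
    subst hp
    have h₁ : s.reg 3 + s.reg 2 ≤ W := by nlinarith
    have hb : ((Instr.add 3 3 2).exec s).Bounded W := hs.update (s.pc + 1) (i := 3) h₁
    have hex := Leads.exec hP.1 hs hb
    have := ih (p := s.pc + 1) rfl hP.2 hb (by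
      simp only [Instr.exec, Function.update_apply]
      simp
      nlinarith)
    have h₂ := hex.trans this
    rw [add_comm 1 k] at h₂
    convert h₂ using 2
    · omega
    · simp only [Instr.exec, Function.update_idem]
      congr 1
      simp
      ring
    · rfl

/-- There is no multiplication: the constant factor `a / 4` is unrolled into additions of `n + 2`,
and two doublings produce the factor `4`. -/
theorem leads_addrCode {n Q m a j p : ℕ} {P : Program} {S : State} {s : Config}
    (h : Represents n Q m S s) (hp : s.pc = p) (hP : CodeAt P p (addrCode a j)) (ha : a / 4 ≤ Q) :
    ∃ s', Leads P (wordBound n Q) s s' (addrCode a j).length ∧ s'.pc = p + (addrCode a j).length ∧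
      s'.mem = s.mem ∧ s'.reg 3 = cellAddr n a (S.reg j) ∧ ∀ i, i ≠ 3 → i ≠ 4 → s'.reg i = s.reg i := by
  have hj := h.bounded_state.1 j
  have hW : 4 * (S.reg j + a / 4 * (n + 2)) + a % 4 ≤ wordBound n Q := by
    have : a % 4 < 4 := Nat.mod_lt _ (by norm_num)
    have : a / 4 * (n + 2) ≤ Q * (n + 2) := Nat.mul_le_mul_right _ ha
    unfold wordBound
    rw [add_mul]
    omega
  unfold addrCode at hP
  rw [codeAt_cons, codeAt_append, codeAt_cons, codeAt_cons, codeAt_cons, codeAt_cons,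
    List.length_replicate] at hP
  obtain ⟨h₁, h₂, h₃, h₄, h₅, h₆, -⟩ := hP
  subst hp
  have b₁ : ((Instr.copy 3 (j + 8)).exec s).Bounded (wordBound n Q) :=
    h.bounded.update _ (h.bounded _).1
  have l₁ := Leads.exec h₁ h.bounded b₁
  have l₂ := leads_replicate_add (s := (Instr.copy 3 (j + 8)).exec s) rfl h₂ b₁ (by
    simp [Instr.exec, h.reg, h.stride]; omega)
  have e₂ : ((Instr.copy 3 (j + 8)).exec s).reg 3 + a / 4 * ((Instr.copy 3 (j + 8)).exec s).reg 2 =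
      S.reg j + a / 4 * (n + 2) := by simp [Instr.exec, h.reg, h.stride]
  rw [e₂] at l₂
  have e₃ : Function.update ((Instr.copy 3 (j + 8)).exec s).reg 3 (S.reg j + a / 4 * (n + 2)) =
      Function.update s.reg 3 (S.reg j + a / 4 * (n + 2)) := by simp [Instr.exec]
  rw [e₃] at l₂
  set v := S.reg j + a / 4 * (n + 2) with hv
  set s₂ : Config := ⟨s.pc + 1 + a / 4, Function.update s.reg 3 v, s.mem⟩ with hs₂
  have b₂ : s₂.Bounded (wordBound n Q) := h.bounded.update _ (by omega)
  have b₃ : ((Instr.add 3 3 3).exec s₂).Bounded (wordBound n Q) := b₂.update _ (by simp [hs₂]; omega)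
  have l₃ := Leads.exec (s := s₂) h₃ b₂ b₃
  have b₄ : ((Instr.add 3 3 3).exec ((Instr.add 3 3 3).exec s₂)).Bounded (wordBound n Q) :=
    b₃.update _ (by simp [hs₂, Instr.exec]; omega)
  have l₄ := Leads.exec (s := (Instr.add 3 3 3).exec s₂) h₄ b₃ b₄
  have b₅ : ((Instr.const 4 (a % 4)).exec ((Instr.add 3 3 3).exec
      ((Instr.add 3 3 3).exec s₂))).Bounded (wordBound n Q) := b₄.update _ (by omega)
  have l₅ := Leads.exec (s := (Instr.add 3 3 3).exec ((Instr.add 3 3 3).exec s₂)) h₅ b₄ b₅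
  have b₆ : ((Instr.add 3 3 4).exec ((Instr.const 4 (a % 4)).exec ((Instr.add 3 3 3).exec
      ((Instr.add 3 3 3).exec s₂)))).Bounded (wordBound n Q) :=
    b₅.update _ (by simp [hs₂, Instr.exec]; omega)
  have l₆ := Leads.exec (s := (Instr.const 4 (a % 4)).exec ((Instr.add 3 3 3).exec
      ((Instr.add 3 3 3).exec s₂))) h₆ b₅ b₆
  have l := l₁.trans (l₂.trans (l₃.trans (l₄.trans (l₅.trans l₆))))
  have hlen : (addrCode a j).length = 1 + (a / 4 + (1 + (1 + (1 + 1)))) := by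
    simp [addrCode]; omega
  rw [hlen]
  refine ⟨_, l, ?_, rfl, ?_, fun i h₃ h₄ => ?_⟩
  · simp [Instr.exec, hs₂]; omega
  · simp [Instr.exec, hs₂, cellAddr, hv]; omega
  · simp [Instr.exec, hs₂, h₃, h₄]

theorem le_wordBound {n Q v : ℕ} (h : v ≤ n + 1) : v ≤ wordBound n Q := by
  unfold wordBound
  nlinarith

theorem Leads.bounded {P : Program} {W : ℕ} {s s' : Config} {k : ℕ} (h : Leads P W s s' k) :
    s'.Bounded W := h.1 ▸ h.2 k le_rfl

theorem Represents.set_reg {n Q m : ℕ} {S : State} {s s' : Config} (h : Represents n Q m S s)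
    (hm : s'.mem = s.mem) (hr : ∀ i, i ≠ 3 → i ≠ 4 → s'.reg i = s.reg i)
    (hb : s'.Bounded (wordBound n Q)) (p i : ℕ) {v : ℕ} (hv : v ≤ n + 1) :
    Represents n Q m (S.set i v) ⟨p, Function.update s'.reg (i + 8) v, s'.mem⟩ where
  size := by simp [hr, h.size]
  cap := by simp [hr, h.cap]
  stride := by simp [hr, h.stride]
  counter := by simp [hr, h.counter]
  one := by simp [hr, h.one]
  reg j := by simp [State.set, Function.update_apply, hr, h.reg]
  arr a j hj := by rw [hm]; exact h.arr a j hj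
  bounded := hb.update p (le_wordBound hv)
  bounded_state := h.bounded_state.set i hv

theorem Represents.set_mem {n Q m : ℕ} {S : State} {s s' : Config} (h : Represents n Q m S s)
    (hm : s'.mem = s.mem) (hr : ∀ i, i ≠ 3 → i ≠ 4 → s'.reg i = s.reg i)
    (hb : s'.Bounded (wordBound n Q)) (p a : ℕ) {i v : ℕ} (hi : i ≤ n + 1) (hv : v ≤ n + 1) :
    Represents n Q m (S.put a i v) ⟨p, s'.reg, Function.update s'.mem (cellAddr n a i) v⟩ where
  size := by simp [hr, h.size]
  cap := by simp [hr, h.cap]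
  stride := by simp [hr, h.stride]
  counter := by simp [hr, h.counter]
  one := by simp [hr, h.one]
  reg j := by simp [State.put, hr, h.reg]
  arr b j hj := by
    simp only [hm, State.put, Function.update_apply]
    by_cases hba : b = a
    · subst hba
      by_cases hji : j = i
      · simp [hji]
      · simp only [if_true, Function.update_apply, if_neg hji]
        rw [if_neg fun he => hji (cellAddr_inj hj hi he).2, h.arr _ _ hj]
    · rw [if_neg fun he => hba (cellAddr_inj hj hi he).1, if_neg hba, h.arr _ _ hj]
  bounded := hb.update_mem p (le_wordBound hv)
  bounded_state := h.bounded_state.put a i hv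

theorem Op.leads {n Q m p : ℕ} {P : Program} {S : State} {s : Config} (o : Op)
    (h : Represents n Q m S s) (hp : s.pc = p) (hP : CodeAt P p o.code) (ho : o.block ≤ Q) :
    ∃ s', Leads P (wordBound n Q) s s' o.code.length ∧ s'.pc = p + o.code.length ∧
      Represents n Q m (o.eval n S) s' := by
  have single : ∀ {I : Instr} {s₁ : Config} {i v : ℕ}, P[s₁.pc]? = some I → s₁.mem = s.mem →
      (∀ i, i ≠ 3 → i ≠ 4 → s₁.reg i = s.reg i) → s₁.Bounded (wordBound n Q) →
      I.exec s₁ = ⟨s₁.pc + 1, Function.update s₁.reg (i + 8) v, s₁.mem⟩ → v ≤ n + 1 →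
      Leads P (wordBound n Q) s₁ ⟨s₁.pc + 1, Function.update s₁.reg (i + 8) v, s₁.mem⟩ 1 ∧
        Represents n Q m (S.set i v) ⟨s₁.pc + 1, Function.update s₁.reg (i + 8) v, s₁.mem⟩ := by
    intro I s₁ i v hI hm hr hb he hv
    have hR := h.set_reg hm hr hb (s₁.pc + 1) i hv
    exact ⟨he ▸ Leads.exec hI hb (he ▸ hR.bounded), hR⟩
  have single' : ∀ {I : Instr} {i v : ℕ}, P[s.pc]? = some I →
      I.exec s = ⟨s.pc + 1, Function.update s.reg (i + 8) v, s.mem⟩ → v ≤ n + 1 →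
      ∃ s', Leads P (wordBound n Q) s s' 1 ∧ s'.pc = s.pc + 1 ∧ Represents n Q m (S.set i v) s' := by
    intro I i v hI he hv
    obtain ⟨h₁, h₂⟩ := single hI rfl (fun _ _ _ => rfl) h.bounded he hv
    exact ⟨_, h₁, rfl, h₂⟩
  have hreg := h.bounded_state.1
  subst hp
  cases o with
  | bit i b =>
    rw [code, codeAt_cons] at hP
    exact single' hP.1 rfl (by cases b <;> simp)
  | mov i j =>
    rw [code, codeAt_cons] at hP
    exact single' hP.1 (by rw [← h.reg j]; rfl) (hreg j)
  | sub i j k =>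
    rw [code, codeAt_cons] at hP
    exact single' hP.1 (by rw [← h.reg j, ← h.reg k]; rfl) ((Nat.sub_le _ _).trans (hreg j))
  | inc i j =>
    simp only [code, codeAt_cons] at hP
    obtain ⟨h₁, h₂, h₃, h₄, -⟩ := hP
    have hj := hreg j
    have b₁ : ((Instr.sub 3 1 (j + 8)).exec s).Bounded (wordBound n Q) :=
      h.bounded.update _ ((Nat.sub_le _ _).trans (h.bounded 1).1)
    have l₁ := Leads.exec h₁ h.bounded b₁
    have b₂ : ((Instr.sub 3 6 3).exec ((Instr.sub 3 1 (j + 8)).exec s)).Bounded (wordBound n Q) :=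
      b₁.update _ ((Nat.sub_le _ _).trans (b₁ 6).1)
    have l₂ := Leads.exec (s := (Instr.sub 3 1 (j + 8)).exec s) h₂ b₁ b₂
    have b₃ : ((Instr.sub 3 6 3).exec ((Instr.sub 3 6 3).exec
        ((Instr.sub 3 1 (j + 8)).exec s))).Bounded (wordBound n Q) :=
      b₂.update _ ((Nat.sub_le _ _).trans (b₂ 6).1)
    have l₃ := Leads.exec (s := (Instr.sub 3 6 3).exec ((Instr.sub 3 1 (j + 8)).exec s)) h₃ b₂ b₃
    obtain ⟨l₄, hR⟩ := single (I := .add (i + 8) (j + 8) 3)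
      (s₁ := (Instr.sub 3 6 3).exec ((Instr.sub 3 6 3).exec ((Instr.sub 3 1 (j + 8)).exec s)))
      (i := i) (v := if S.reg j < n + 1 then S.reg j + 1 else S.reg j) h₄ rfl
      (fun i h₃ h₄ => by simp [Instr.exec, h₃]) b₃ (by
        simp only [Instr.exec]
        congr 2
        simp [h.cap, h.one, h.reg]
        split_ifs <;> omega) (by split_ifs <;> omega)
    exact ⟨_, l₁.trans (l₂.trans (l₃.trans l₄)), rfl, hR⟩
  | ld i a j =>
    rw [code, codeAt_append, codeAt_cons] at hP
    obtain ⟨s₁, l₁, hpc, hm, h3, hr⟩ := leads_addrCode h rfl hP.1 ho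
    rw [← hpc] at hP
    obtain ⟨l₂, hR⟩ := single (s₁ := s₁) (i := i) (v := S.arr a (S.reg j)) hP.2.1 hm hr l₁.bounded (by
        simp only [Instr.exec, h3, hm, h.arr _ _ (hreg j)]) (h.bounded_state.2 _ _)
    refine ⟨_, ?_, ?_, hR⟩
    · simpa [code] using l₁.trans l₂
    · simp [hpc, code]; omega
  | st a i j =>
    rw [code, codeAt_append, codeAt_cons] at hP
    obtain ⟨s₁, l₁, hpc, hm, h3, hr⟩ := leads_addrCode h rfl hP.1 ho
    rw [← hpc] at hP
    have hR := h.set_mem hm hr l₁.bounded (s₁.pc + 1) a (hreg i) (hreg j)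
    have he : (Instr.store 3 (j + 8)).exec s₁ =
        ⟨s₁.pc + 1, s₁.reg, Function.update s₁.mem (cellAddr n a (S.reg i)) (S.reg j)⟩ := by
      simp only [Instr.exec, h3, hr (j + 8) (by omega) (by omega), h.reg]
    have l₂ := he ▸ Leads.exec hP.2.1 l₁.bounded (he ▸ hR.bounded)
    refine ⟨_, ?_, ?_, hR⟩
    · simpa [code] using l₁.trans l₂
    · simp [hpc, code]; omega

theorem Represents.jump {n Q m : ℕ} {S : State} {s : Config} (h : Represents n Q m S s) (p : ℕ) :
    Represents n Q m S ⟨p, s.reg, s.mem⟩ :=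
  ⟨h.size, h.cap, h.stride, h.counter, h.one, h.reg, h.arr, h.bounded, h.bounded_state⟩

/-- The code only jumps forward, so each of its instructions is executed at most once and its length
bounds the time. -/
theorem Cmd.leads {n Q m p : ℕ} {P : Program} {S : State} {s : Config} (c : Cmd)
    (h : Represents n Q m S s) (hp : s.pc = p) (hP : CodeAt P p (c.code p)) (hc : c.block ≤ Q) :
    ∃ s' k, k ≤ c.len ∧ Leads P (wordBound n Q) s s' k ∧ s'.pc = p + c.len ∧
      Represents n Q m (c.eval n S) s' := by
  induction c generalizing S s p with
  | skip => exact ⟨s, 0, le_rfl, Leads.refl h.bounded, hp, h⟩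
  | op o =>
    obtain ⟨s', h₁, h₂, h₃⟩ := o.leads h hp hP hc
    exact ⟨s', _, le_rfl, h₁, h₂, h₃⟩
  | seq c₁ c₂ ih₁ ih₂ =>
    rw [code, codeAt_append, c₁.length_code] at hP
    rw [block, max_le_iff] at hc
    obtain ⟨s₁, k₁, hk₁, l₁, hp₁, hR₁⟩ := ih₁ h hp hP.1 hc.1
    obtain ⟨s₂, k₂, hk₂, l₂, hp₂, hR₂⟩ := ih₂ hR₁ hp₁ hP.2 hc.2
    exact ⟨s₂, k₁ + k₂, add_le_add hk₁ hk₂, l₁.trans l₂, by rw [hp₂, len, add_assoc], hR₂⟩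
  | ite j k c₁ c₂ ih₁ ih₂ =>
    rw [code, codeAt_cons, codeAt_append, codeAt_cons, c₂.length_code] at hP
    rw [block, max_le_iff] at hc
    obtain ⟨hi, hP₂, hj, hP₁⟩ := hP
    subst hp
    by_cases hlt : S.reg j < S.reg k
    · have hR := h.jump (s.pc + c₂.len + 2)
      have he : (Instr.jumpLt (j + 8) (k + 8) (s.pc + c₂.len + 2)).exec s =
          ⟨s.pc + c₂.len + 2, s.reg, s.mem⟩ := by simp [Instr.exec, h.reg, hlt]
      have l := Leads.exec hi h.bounded (he ▸ hR.bounded)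
      rw [he] at l
      obtain ⟨s₁, k₁, hk₁, l₁, hp₁, hR₁⟩ := ih₁ hR rfl (by
        rwa [show s.pc + c₂.len + 2 = s.pc + 1 + c₂.len + 1 by omega] at hP₁ ⊢) hc.1
      refine ⟨s₁, 1 + k₁, by rw [len]; omega, l.trans l₁, by rw [hp₁, len]; dsimp only; omega, ?_⟩
      rwa [eval, if_pos hlt]
    · have hR := h.jump (s.pc + 1)
      have he : (Instr.jumpLt (j + 8) (k + 8) (s.pc + c₂.len + 2)).exec s =
          ⟨s.pc + 1, s.reg, s.mem⟩ := by simp [Instr.exec, h.reg, hlt]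
      have l := Leads.exec hi h.bounded (he ▸ hR.bounded)
      rw [he] at l
      obtain ⟨s₁, k₁, hk₁, l₁, hp₁, hR₁⟩ := ih₂ hR rfl hP₂ hc.2
      have hR' := hR₁.jump (s.pc + c₁.len + c₂.len + 2)
      have l' : Leads P (wordBound n Q) s₁ ⟨s.pc + c₁.len + c₂.len + 2, s₁.reg, s₁.mem⟩ 1 :=
        Leads.exec (I := .jump (s.pc + c₁.len + c₂.len + 2)) (hp₁ ▸ hj) hR₁.bounded hR'.bounded
      refine ⟨_, 1 + (k₁ + 1), by rw [len]; omega, l.trans (l₁.trans l'), by rw [len]; simp; omega, ?_⟩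
      rwa [eval, if_neg hlt]

theorem Represents.set_counter {n Q m : ℕ} {S : State} {s : Config} (h : Represents n Q m S s)
    (p : ℕ) {v : ℕ} (hv : v ≤ n) :
    Represents n Q v S ⟨p, Function.update s.reg 5 v, s.mem⟩ where
  size := by simp [h.size]
  cap := by simp [h.cap]
  stride := by simp [h.stride]
  counter := by simp
  one := by simp [h.one]
  reg j := by simp [h.reg]
  arr a j hj := h.arr a j hj
  bounded := h.bounded.update p (le_wordBound (by omega))
  bounded_state := h.bounded_state

/-- Besides its body, an iteration costs four steps: test, copy of the counter, increment and jump
back. The remaining step initializes the counter. -/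
theorem Cmd.leads_iter {n Q m₀ p : ℕ} {P : Program} {S : State} {s : Config} (c : Cmd)
    (h : Represents n Q m₀ S s) (hp : s.pc = p) (hP : CodeAt P p ((Stm.loop c).code p))
    (hc : c.block ≤ Q) {m : ℕ} (hm : m ≤ n) :
    ∃ s' k, k ≤ (c.len + 4) * m + 1 ∧ Leads P (wordBound n Q) s s' k ∧ s'.pc = p + 1 ∧
      Represents n Q m (c.iter n S m) s' := by
  simp only [Stm.code, codeAt_cons, codeAt_append, c.length_code] at hP
  obtain ⟨h₁, h₂, -, h₄, h₅, h₆, h₇, -⟩ := hP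
  subst hp
  induction m with
  | zero =>
    have hR := h.set_counter (s.pc + 1) (Nat.zero_le n)
    exact ⟨_, 1, by omega, Leads.exec (I := .const 5 0) h₁ h.bounded hR.bounded, rfl, hR⟩
  | succ m ih =>
    obtain ⟨s₁, k₁, hk₁, l₁, hp₁, hR₁⟩ := ih (by omega)
    have hR₂ := hR₁.jump (s.pc + 3)
    have he : (Instr.jumpLt 5 0 (s.pc + 3)).exec s₁ = ⟨s.pc + 3, s₁.reg, s₁.mem⟩ := by
      simp [Instr.exec, hR₁.counter, hR₁.size, show m < n by omega]
    have l₂ := Leads.exec (hp₁ ▸ h₂) hR₁.bounded (he ▸ hR₂.bounded)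
    rw [he] at l₂
    have hR₃ := hR₂.set_reg rfl (fun _ _ _ => rfl) hR₂.bounded (s.pc + 4) 0
      (v := m) (by omega)
    have he₃ : (Instr.copy 8 5).exec ⟨s.pc + 3, s₁.reg, s₁.mem⟩ =
        ⟨s.pc + 4, Function.update s₁.reg (0 + 8) m, s₁.mem⟩ := by simp [Instr.exec, hR₁.counter]
    have l₃ := Leads.exec (s := ⟨s.pc + 3, s₁.reg, s₁.mem⟩) h₄ hR₂.bounded (he₃ ▸ hR₃.bounded)
    rw [he₃] at l₃
    obtain ⟨s₄, k₄, hk₄, l₄, hp₄, hR₄⟩ := c.leads hR₃ rfl h₅ hc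
    have hR₅ := hR₄.set_counter (s₄.pc + 1) (v := m + 1) hm
    have he₅ : (Instr.add 5 5 6).exec s₄ = ⟨s₄.pc + 1, Function.update s₄.reg 5 (m + 1), s₄.mem⟩ := by
      simp [Instr.exec, hR₄.counter, hR₄.one]
    have l₅ := Leads.exec (s := s₄) (hp₄ ▸ h₆) hR₄.bounded (he₅ ▸ hR₅.bounded)
    rw [he₅] at l₅
    have hR₆ := hR₅.jump (s.pc + 1)
    have l₆ := Leads.exec (s := ⟨s₄.pc + 1, Function.update s₄.reg 5 (m + 1), s₄.mem⟩)
      (I := .jump (s.pc + 1)) (hp₄ ▸ h₇) hR₅.bounded hR₆.bounded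
    refine ⟨_, _, ?_, l₁.trans (l₂.trans (l₃.trans (l₄.trans (l₅.trans l₆)))), rfl, hR₆⟩
    have : (c.len + 4) * (m + 1) = (c.len + 4) * m + (c.len + 4) := by ring
    omega

theorem Stm.leads {n Q m p : ℕ} {P : Program} {S : State} {s : Config} (c : Stm)
    (h : Represents n Q m S s) (hp : s.pc = p) (hP : CodeAt P p (c.code p)) (hc : c.block ≤ Q) :
    ∃ s' k m', k ≤ c.len * (n + 1) ∧ Leads P (wordBound n Q) s s' k ∧ s'.pc = p + c.len ∧
      Represents n Q m' (c.eval n S) s' := by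
  cases c with
  | cmd c =>
    obtain ⟨s', k, hk, h₁, h₂, h₃⟩ := c.leads h hp hP hc
    exact ⟨s', k, m, hk.trans (Nat.le_mul_of_pos_right _ (by omega)), h₁, h₂, h₃⟩
  | loop c =>
    obtain ⟨s', k, hk, l₁, hp', hR⟩ := c.leads_iter h hp hP hc le_rfl
    simp only [Stm.code, codeAt_cons] at hP
    obtain ⟨-, h₂, h₃, -⟩ := hP
    have hR₂ := hR.jump (p + 2)
    have he : (Instr.jumpLt 5 0 (p + 3)).exec s' = ⟨p + 2, s'.reg, s'.mem⟩ := by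
      simp [Instr.exec, hR.counter, hR.size, hp']
    have l₂ := Leads.exec (hp' ▸ h₂) hR.bounded (he ▸ hR₂.bounded)
    rw [he] at l₂
    have hR₃ := hR₂.jump (p + c.len + 6)
    have l₃ := Leads.exec (s := ⟨p + 2, s'.reg, s'.mem⟩) (I := .jump (p + c.len + 6)) h₃ hR₂.bounded
      hR₃.bounded
    refine ⟨_, _, n, ?_, l₁.trans (l₂.trans l₃), ?_, hR₃⟩
    · rw [len]
      nlinarith
    · rw [len]; rfl

/-- The length of the code of a list of statements. -/
def lenList (l : List Stm) : ℕ := (l.map Stm.len).sum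

theorem length_codeList (l : List Stm) (p : ℕ) : (codeList l p).length = lenList l := by
  induction l generalizing p with
  | nil => rfl
  | cons s l ih => simp [codeList, lenList, ih, s.length_code]

theorem leads_list {n Q m p : ℕ} {P : Program} {S : State} {s : Config} (l : List Stm)
    (h : Represents n Q m S s) (hp : s.pc = p) (hP : CodeAt P p (codeList l p))
    (hc : ∀ c ∈ l, c.block ≤ Q) :
    ∃ s' k m', k ≤ lenList l * (n + 1) ∧ Leads P (wordBound n Q) s s' k ∧
      s'.pc = p + lenList l ∧ Represents n Q m' (evalList n l S) s' := by
  induction l generalizing S s m p with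
  | nil => exact ⟨s, 0, m, Nat.zero_le _, Leads.refl h.bounded, hp, h⟩
  | cons c l ih =>
    rw [codeList, codeAt_append, c.length_code] at hP
    obtain ⟨s₁, k₁, m₁, hk₁, l₁, hp₁, hR₁⟩ := c.leads h hp hP.1 (hc c (by simp))
    obtain ⟨s₂, k₂, m₂, hk₂, l₂, hp₂, hR₂⟩ :=
      ih hR₁ hp₁ hP.2 fun c' hc' => hc c' (by simp [hc'])
    have hlen : lenList (c :: l) = c.len + lenList l := by simp [lenList]
    refine ⟨s₂, k₁ + k₂, m₂, ?_, l₁.trans l₂, by omega, hR₂⟩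
    rw [hlen, add_mul]
    omega

/-- The initial state: register `1` holds `n`, the arrays `0, …, 3` hold the input table. -/
def initState {n : ℕ} (H : Shape n) : State :=
  ⟨Function.update (fun _ => 0) 1 n, fun a i => if i ≤ n + 1 then inputTable H (cellAddr n a i) else 0⟩

/-- The machine program for a list of statements; the answer is read off from register `2`. -/
def compile (l : List Stm) : Program :=
  [.const 6 1, .add 1 0 6, .add 2 1 6, .copy 9 0] ++ (codeList l 4 ++
    [.const 3 0, .jumpLt 3 10 (4 + lenList l + 3), .halt false, .halt true])

theorem inputTable_le {n : ℕ} (H : Shape n) (a : ℕ) : inputTable H a ≤ n := by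
  unfold inputTable
  split_ifs
  · split <;> omega
  · omega

theorem leads_init {n : ℕ} (H : Shape n) (l : List Stm) (Q : ℕ) :
    ∃ s, Leads (compile l) (wordBound n Q) (inputConfig H) s 4 ∧ s.pc = 4 ∧
      Represents n Q 0 (initState H) s := by
  have hW : n + 2 ≤ wordBound n Q := by unfold wordBound; nlinarith
  have b₀ : (inputConfig H).Bounded (wordBound n Q) := fun i =>
    ⟨by simp only [inputConfig]; split_ifs <;> omega,
      (inputTable_le H i).trans (by omega)⟩
  have b₁ : ((Instr.const 6 1).exec (inputConfig H)).Bounded (wordBound n Q) :=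
    b₀.update _ (by omega)
  have b₂ : ((Instr.add 1 0 6).exec ((Instr.const 6 1).exec (inputConfig H))).Bounded
      (wordBound n Q) := b₁.update _ (by simp [Instr.exec, inputConfig]; omega)
  have b₃ : ((Instr.add 2 1 6).exec ((Instr.add 1 0 6).exec ((Instr.const 6 1).exec
      (inputConfig H)))).Bounded (wordBound n Q) :=
    b₂.update _ (by simp [Instr.exec, inputConfig]; omega)
  have b₄ : ((Instr.copy 9 0).exec ((Instr.add 2 1 6).exec ((Instr.add 1 0 6).exec
      ((Instr.const 6 1).exec (inputConfig H))))).Bounded (wordBound n Q) := b₃.update _ (b₃ 0).1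
  have l₁ := Leads.exec (P := compile l) (s := inputConfig H) (I := .const 6 1) rfl b₀ b₁
  have l₂ := Leads.exec (P := compile l) (I := .add 1 0 6) rfl b₁ b₂
  have l₃ := Leads.exec (P := compile l) (I := .add 2 1 6) rfl b₂ b₃
  have l₄ := Leads.exec (P := compile l) (I := .copy 9 0) rfl b₃ b₄
  refine ⟨_, l₁.trans (l₂.trans (l₃.trans l₄)), rfl, ?_⟩
  refine ⟨?_, ?_, ?_, ?_, ?_, fun i => ?_, fun a i hi => ?_, b₄, ⟨fun i => ?_, fun a i => ?_⟩⟩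
  · simp [Instr.exec, inputConfig]
  · simp [Instr.exec, inputConfig]
  · simp [Instr.exec, inputConfig]
  · simp [Instr.exec, inputConfig]
  · simp [Instr.exec, inputConfig]
  · simp [Instr.exec, inputConfig, initState, Function.update_apply]
  · simp [Instr.exec, inputConfig, initState, hi]
  · simp only [initState, Function.update_apply]
    split_ifs <;> omega
  · simp only [initState]
    split_ifs
    · exact (inputTable_le H _).trans (by omega)
    · omega

/-- The compiled program gives the answer of the structured program, with linear bounds. -/
theorem decidesWithin_compile {Q : ℕ} (l : List Stm) (hl : ∀ c ∈ l, c.block ≤ Q) :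
    ∃ C : ℕ, ∀ (n : ℕ) (H : Shape n), 0 < n →
      DecidesWithin (compile l) (inputConfig H) (C * n) (C * n)
        (0 < (evalList n l (initState H)).reg 2) := by
  -- Since `n ≥ 1`, the word bound `4 (Q + 1) (n + 2)` is at most `12 (Q + 1) n`, the loops take at
  -- most `2 * lenList l * n` steps, and six steps are spent at the start and the end.
  refine ⟨12 * (Q + 1) + 2 * lenList l + 6, fun n H hn => ?_⟩
  have hcode : CodeAt (compile l) 0 (compile l) := fun i I h => by simpa using h
  nth_rw 2 [compile] at hcode
  rw [codeAt_append, codeAt_append, length_codeList] at hcode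
  obtain ⟨-, h₁, h₂⟩ := hcode
  simp only [codeAt_cons, List.length_cons, List.length_nil] at h₂
  obtain ⟨h₂, h₃, h₄, h₅, -⟩ := h₂
  obtain ⟨s₁, l₁, hp₁, hR₁⟩ := leads_init H l Q
  obtain ⟨s₂, k₂, m, hk₂, l₂, hp₂, hR₂⟩ := leads_list l hR₁ hp₁ h₁ hl
  have b₃ : ((Instr.const 3 0).exec s₂).Bounded (wordBound n Q) := hR₂.bounded.update _ (by omega)
  have l₃ := Leads.exec (P := compile l) (s := s₂) (I := .const 3 0) (hp₂ ▸ h₂) hR₂.bounded b₃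
  have b₄ : ((Instr.jumpLt 3 10 (4 + lenList l + 3)).exec ((Instr.const 3 0).exec s₂)).Bounded
      (wordBound n Q) := b₃
  have l₄ := Leads.exec (P := compile l) (s := (Instr.const 3 0).exec s₂) (hp₂ ▸ h₃) b₃ b₄
  have L := l₁.trans (l₂.trans (l₃.trans l₄))
  obtain ⟨b, hb, hbQ⟩ : ∃ b, (compile l)[((Instr.jumpLt 3 10 (4 + lenList l + 3)).exec
      ((Instr.const 3 0).exec s₂)).pc]? = some (.halt b) ∧
        (b = true ↔ 0 < (evalList n l (initState H)).reg 2) := by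
    have h10 := hR₂.reg 2
    by_cases hpos : 0 < (evalList n l (initState H)).reg 2
    · refine ⟨true, ?_, by simp [hpos]⟩
      simp only [Instr.exec, Function.update_apply]
      rw [← h₅]
      congr 1
      simp [h10, hpos]
    · refine ⟨false, ?_, by simp [hpos]⟩
      simp only [Instr.exec, Function.update_apply]
      simpa [h10, hpos, hp₂, add_assoc, add_comm] using h₄
  have hn1 : n + 1 ≤ 2 * n := by omega
  have hT : 4 + (k₂ + (1 + 1)) ≤ (12 * (Q + 1) + 2 * lenList l + 6) * n := by
    have : lenList l * (n + 1) ≤ lenList l * (2 * n) := Nat.mul_le_mul_left _ hn1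
    nlinarith
  have hW : wordBound n Q ≤ (12 * (Q + 1) + 2 * lenList l + 6) * n := by
    unfold wordBound
    nlinarith
  refine ⟨⟨_, hT, b, by rw [L.1]; exact hb, hbQ⟩, fun t i => ?_⟩
  suffices (run (compile l) (inputConfig H) t).Bounded (wordBound n Q) from
    ⟨(this i).1.trans hW, (this i).2.trans hW⟩
  rcases le_total t (4 + (k₂ + (1 + 1))) with ht | ht
  · exact L.2 t ht
  · obtain ⟨d, rfl⟩ := Nat.exists_eq_add_of_le ht
    rw [run_add, L.1]
    -- The halting configuration is a fixed point, so the bounds persist for all later times.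
    have hstay : ∀ d, run (compile l) ((Instr.jumpLt 3 10 (4 + lenList l + 3)).exec
        ((Instr.const 3 0).exec s₂)) d = (Instr.jumpLt 3 10 (4 + lenList l + 3)).exec
        ((Instr.const 3 0).exec s₂) := by
      intro d
      induction d with
      | zero => rfl
      | succ d ih =>
        rw [run_add, ih]
        simp only [run, Function.iterate_one, step, hb]
        rfl
    rw [hstay]
    exact b₄

/-! ### Reasoning about structured programs -/

namespace State

variable {S : State} {a b i j v : ℕ}

@[simp] theorem set_reg_self : (S.set i v).reg i = v := by simp [set]

@[simp] theorem set_reg_ne (h : j ≠ i) : (S.set i v).reg j = S.reg j := by simp [set, h]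

@[simp] theorem set_arr : (S.set i v).arr = S.arr := rfl

@[simp] theorem put_reg : (S.put a i v).reg = S.reg := rfl

@[simp] theorem put_arr_self : (S.put a i v).arr a = Function.update (S.arr a) i v := by simp [put]

@[simp] theorem put_arr_ne (h : b ≠ a) : (S.put a i v).arr b = S.arr b := by simp [put, h]

end State

/-- The states agree outside of the given registers and arrays. -/
def Agree (R A : List ℕ) (S T : State) : Prop :=
  (∀ i, i ∉ R → T.reg i = S.reg i) ∧ ∀ a, a ∉ A → T.arr a = S.arr a

theorem Agree.refl (R A : List ℕ) (S : State) : Agree R A S S := ⟨fun _ _ => rfl, fun _ _ => rfl⟩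

theorem Agree.trans {R A : List ℕ} {S T U : State} (h : Agree R A S T) (h' : Agree R A T U) :
    Agree R A S U :=
  ⟨fun i hi => (h'.1 i hi).trans (h.1 i hi), fun a ha => (h'.2 a ha).trans (h.2 a ha)⟩

theorem Agree.mono {R A R' A' : List ℕ} {S T : State} (h : Agree R A S T) (hR : R ⊆ R')
    (hA : A ⊆ A') : Agree R' A' S T :=
  ⟨fun i hi => h.1 i fun h => hi (hR h), fun a ha => h.2 a fun h => ha (hA h)⟩

/-- The registers that an operation changes. -/
def Op.regs : Op → List ℕ
  | .bit i _ => [i]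
  | .mov i _ => [i]
  | .inc i _ => [i]
  | .sub i _ _ => [i]
  | .ld i _ _ => [i]
  | .st _ _ _ => []

/-- The arrays that an operation changes. -/
def Op.arrs : Op → List ℕ
  | .st a _ _ => [a]
  | _ => []

/-- The registers that a command changes. -/
def Cmd.regs : Cmd → List ℕ
  | .skip => []
  | .op o => o.regs
  | .seq c₁ c₂ => c₁.regs ++ c₂.regs
  | .ite _ _ c₁ c₂ => c₁.regs ++ c₂.regs

/-- The arrays that a command changes. -/
def Cmd.arrs : Cmd → List ℕ
  | .skip => []
  | .op o => o.arrs
  | .seq c₁ c₂ => c₁.arrs ++ c₂.arrs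
  | .ite _ _ c₁ c₂ => c₁.arrs ++ c₂.arrs

theorem Op.agree (n : ℕ) (o : Op) (S : State) : Agree o.regs o.arrs S (o.eval n S) := by
  cases o <;> refine ⟨fun i hi => ?_, fun a ha => ?_⟩ <;>
    simp_all [regs, arrs, eval]

theorem Cmd.agree (n : ℕ) (c : Cmd) (S : State) : Agree c.regs c.arrs S (c.eval n S) := by
  induction c generalizing S with
  | skip => exact .refl _ _ _
  | op o => exact o.agree n S
  | seq c₁ c₂ ih₁ ih₂ =>
    exact ((ih₁ S).mono (by simp [regs]) (by simp [arrs])).trans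
      ((ih₂ _).mono (by simp [regs]) (by simp [arrs]))
  | ite j k c₁ c₂ ih₁ ih₂ =>
    unfold eval
    split_ifs
    · exact (ih₁ S).mono (by simp [regs]) (by simp [arrs])
    · exact (ih₂ S).mono (by simp [regs]) (by simp [arrs])

theorem Cmd.agree_iter (n : ℕ) (c : Cmd) (S : State) (m : ℕ) :
    Agree (0 :: c.regs) c.arrs S (c.iter n S m) := by
  induction m with
  | zero => exact .refl _ _ _
  | succ m ih =>
    refine ih.trans (Agree.trans (T := (c.iter n S m).set 0 m) ⟨fun i hi => ?_, fun _ _ => rfl⟩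
      ((c.agree n _).mono (by simp) fun _ h => h))
    exact State.set_reg_ne fun h => hi (by simp [h])

/-- The invariant rule for loops. `Agree` supplies everything that the body leaves untouched, so
invariants only mention what changes. -/
theorem Cmd.iter_induction {n : ℕ} {c : Cmd} {S : State} (I : ℕ → State → Prop) (h₀ : I 0 S)
    (hs : ∀ m < n, ∀ T, Agree (0 :: c.regs) c.arrs S T → I m T → I (m + 1) (c.eval n (T.set 0 m))) :
    I n (c.iter n S n) := by
  suffices ∀ m ≤ n, I m (c.iter n S m) from this n le_rfl
  intro m hm
  induction m with
  | zero => exact h₀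
  | succ m ih => exact hs m hm _ (c.agree_iter n S m) (ih (by omega))

/-! ### The lowest vertices of the lines -/

namespace Shape

variable {n : ℕ} {H : Shape n} {x y : Fin n → ℝ} {e r : Dir}

/-- The code of a neighbour in the input table. -/
def enc : Option (Fin n) → ℕ
  | some v => v + 1
  | none => 0

theorem enc_pos {o : Option (Fin n)} : 0 < enc o ↔ o ≠ none := by
  cases o <;> simp [enc]

/-- `bot` maps every vertex to the lowest vertex on its line of direction `r`. -/
structure IsBottomMap (H : Shape n) (r : Dir) (bot : Fin n → Fin n) : Prop where
  none : ∀ v, H.nbr (bot v) r.opp = none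
  chain : ∀ v, Relation.ReflTransGen (H.Step r) (bot v) v

theorem Frame.exists_isBottomMap (F : Frame H x y e r) : ∃ bot, H.IsBottomMap r bot := by
  suffices ∀ v, ∃ b, H.nbr b r.opp = none ∧ Relation.ReflTransGen (H.Step r) b v by
    choose bot h₁ h₂ using this
    exact ⟨bot, h₁, h₂⟩
  intro v
  induction v using (wellFounded_lt_comp y).induction with
  | _ v ih =>
    rcases hv : H.nbr v r.opp with _ | u
    · exact ⟨v, hv, .refl⟩
    · have hs : H.Step r u v := step_opp_iff.1 hv
      obtain ⟨b, hb, hbu⟩ := ih u (F.up hs).2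
      exact ⟨b, hb, hbu.tail hs⟩

variable {bot : Fin n → Fin n}

namespace IsBottomMap

theorem sameLine (hb : H.IsBottomMap r bot) (v : Fin n) : H.SameLine r (bot v) v := .inl (hb.chain v)

theorem eq_of_sameLine {b b' : Fin n} (hb : H.nbr b r.opp = Option.none)
    (hb' : H.nbr b' r.opp = Option.none) (h : H.SameLine r b b') : b = b' := by
  have key : ∀ {b b' : Fin n}, H.nbr b' r.opp = Option.none →
      Relation.ReflTransGen (H.Step r) b b' → b = b' := by
    intro b b' hb' h
    rcases h.cases_tail with h | ⟨c, -, hc⟩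
    · exact h.symm
    · have := hc.opp
      simp [Step, hb'] at this
  rcases h with h | h
  · exact key hb' h
  · exact (key hb h).symm

theorem eq_iff (hb : H.IsBottomMap r bot) (u v : Fin n) : bot u = bot v ↔ H.SameLine r u v := by
  constructor
  · intro h
    have := hb.sameLine v
    rw [← h] at this
    exact (hb.sameLine u).symm.trans this
  · intro h
    exact eq_of_sameLine (hb.none u) (hb.none v)
      ((hb.sameLine u).trans (h.trans (hb.sameLine v).symm))

theorem self_iff (hb : H.IsBottomMap r bot) (v : Fin n) :
    bot v = v ↔ H.nbr v r.opp = Option.none := by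
  constructor
  · intro h
    rw [← h]
    exact hb.none v
  · intro h
    exact eq_of_sameLine (hb.none v) h (hb.sameLine v)

theorem step (hb : H.IsBottomMap r bot) {u v : Fin n} (h : H.Step r u v) : bot v = bot u :=
  (hb.eq_iff v u).2 h.sameLine.symm

theorem le (hb : H.IsBottomMap r bot) (F : Frame H x y e r) (v : Fin n) : y (bot v) ≤ y v :=
  (F.le_of_chain (hb.chain v)).2

/-- Passing from `v` to its successor enlarges the set of lower vertices of the line by exactly `v`,
so that counting this set counts steps. -/
theorem lt_step_iff (hb : H.IsBottomMap r bot) (F : Frame H x y e r) {u v w : Fin n}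
    (h : H.Step r v w) (hu : bot u = bot v) : y u < y w ↔ u = v ∨ y u < y v := by
  constructor
  · intro hlt
    by_contra hne
    push Not at hne
    have hl := (hb.eq_iff v u).1 hu.symm
    obtain ⟨w', hw', hle⟩ := F.exists_step hl (hne.2.lt_of_ne fun he =>
      hne.1 (F.eq_of_eq hl he).symm)
    rw [hw'.right_unique h] at hle
    linarith
  · rintro (rfl | hlt)
    · exact (F.up h).2
    · exact hlt.trans (F.up h).2

theorem le_of_none (hb : H.IsBottomMap r bot) (F : Frame H x y e r) {u v : Fin n}
    (h : H.nbr v r = Option.none) (hu : bot u = bot v) : u = v ∨ y u < y v := by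
  by_contra hne
  push Not at hne
  have hl := (hb.eq_iff v u).1 hu.symm
  obtain ⟨w', hw', -⟩ := F.exists_step hl (hne.2.lt_of_ne fun he => hne.1 (F.eq_of_eq hl he).symm)
  simp [Step, h] at hw'

end IsBottomMap

end Shape

open Shape

/-! ### Computing the lowest vertices of the lines

The registers `1`, `3` and `13` hold the numbers `n`, `0` and `1`. -/

/-- The array `a` holds the neighbours in direction `d`. -/
def HoldsNbr {n : ℕ} (H : Shape n) (S : State) (a : ℕ) (d : Dir) : Prop :=
  ∀ v : Fin n, S.arr a v = enc (H.nbr v d)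

/-- The constants are in their registers. -/
structure Consts (n : ℕ) (S : State) : Prop where
  size : S.reg 1 = n
  zero : S.reg 3 = 0
  one : S.reg 13 = 1

theorem Consts.agree {n : ℕ} {S T : State} {R A : List ℕ} (h : Consts n S) (hT : Agree R A S T)
    (hR : 1 ∉ R ∧ 3 ∉ R ∧ 13 ∉ R) : Consts n T :=
  ⟨(hT.1 _ hR.1).trans h.size, (hT.1 _ hR.2.1).trans h.zero, (hT.1 _ hR.2.2).trans h.one⟩

theorem HoldsNbr.agree {n : ℕ} {H : Shape n} {S T : State} {R A : List ℕ} {a : ℕ} {d : Dir}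
    (h : HoldsNbr H S a d) (hT : Agree R A S T) (ha : a ∉ A) : HoldsNbr H T a d := fun v => by
  rw [hT.2 a ha]; exact h v

/-- One step of the walk along the lines: register `5` holds the current vertex, if any, register `6`
the lowest vertex of its line, and register `7` the next vertex at which a line may start. -/
def walkStep (aN aS aB : ℕ) : Cmd :=
  .ite 3 5
    (.seq (.op (.sub 8 5 13)) <| .seq (.op (.st aB 8 6)) <| .op (.ld 5 aN 8))
    (.ite 7 1
      (.seq (.op (.ld 9 aS 7)) <| .ite 3 9
        (.op (.inc 7 7))
        (.seq (.op (.inc 7 7)) <| .seq (.op (.mov 5 7)) <| .op (.mov 6 7)))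
      .skip)

/-- The invariant of the walk along the lines, after `t` steps. -/
def WalkInv {n : ℕ} (y : Fin n → ℝ) (bot : Fin n → Fin n) (aB t : ℕ) (S : State) : Prop :=
  (S.reg 5 = 0 ∧ S.reg 7 ≤ n ∧ (∀ v, (bot v : ℕ) < S.reg 7 → S.arr aB v = bot v + 1) ∧
    (t = S.reg 7 + Nat.card {v // (bot v : ℕ) < S.reg 7} ∨ S.reg 7 = n)) ∨
  ∃ w : Fin n, S.reg 5 = (w : ℕ) + 1 ∧ S.reg 6 = bot w + 1 ∧ S.reg 7 = bot w + 1 ∧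
    (∀ v, (bot v < bot w ∨ bot v = bot w ∧ y v < y w) → S.arr aB v = bot v + 1) ∧
    t = S.reg 7 + Nat.card {v // bot v < bot w ∨ bot v = bot w ∧ y v < y w}

theorem card_insert_lt {ι : Type*} [Finite ι] {p q : ι → Prop} (w : ι) (hw : ¬ p w)
    (h : ∀ v, q v ↔ v = w ∨ p v) : Nat.card {v // q v} = Nat.card {v // p v} + 1 := by
  classical
  have := Fintype.ofFinite ι
  rw [Nat.card_eq_fintype_card, Nat.card_eq_fintype_card, Fintype.card_subtype, Fintype.card_subtype,
    ← Finset.card_insert_of_notMem (a := w) (s := Finset.univ.filter p) (by simpa using hw)]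
  congr 1
  ext v
  simp [h]

section

variable {n : ℕ} {H : Shape n} {x y : Fin n → ℝ} {e r : Dir} {bot : Fin n → Fin n} {aN aS aB : ℕ}

/-- Each step before the end either advances the pointer in register `7` or labels one vertex, so
the elapsed time is the pointer plus the number of labelled vertices. Vertices are labelled in the
order of their bottoms and, on one line, upwards. -/
theorem WalkInv.step (F : Frame H x y e r) (hb : H.IsBottomMap r bot) {t : ℕ} {S : State}
    (hc : Consts n S) (hN : HoldsNbr H S aN r) (hS : HoldsNbr H S aS r.opp) (hNB : aN ≠ aB)
    (h : WalkInv y bot aB t S) : WalkInv y bot aB (t + 1) ((walkStep aN aS aB).eval n S) := by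
  rcases h with ⟨h5, h7, hB, ht⟩ | ⟨w, h5, h6, h7, hB, ht⟩
  · rcases h7.eq_or_lt with h7' | h7'
    · have : (walkStep aN aS aB).eval n S = S := by
        simp [walkStep, Cmd.eval, hc.zero, hc.size, h5, h7']
      rw [this]
      exact .inl ⟨h5, h7, hB, .inr h7'⟩
    · obtain ⟨s, hs⟩ : ∃ s : Fin n, S.reg 7 = s := ⟨⟨S.reg 7, h7'⟩, rfl⟩
      have hs9 := hS s
      rw [hs] at ht hB
      have ht : t = s + Nat.card {v // (bot v : ℕ) < s} := ht.resolve_right (by omega)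
      rcases hu : H.nbr s r.opp with _ | u
      · rw [hu, enc] at hs9
        have hbs : bot s = s := (hb.self_iff s).2 hu
        have hev : (walkStep aN aS aB).eval n S =
            (((S.set 9 0).set 7 (s + 1)).set 5 (s + 1)).set 6 (s + 1) := by
          simp [walkStep, Cmd.eval, Op.eval, hc.zero, hc.size, h5, hs, hs9]
        rw [hev]
        have hiff : ∀ v, (bot v < bot s ∨ bot v = bot s ∧ y v < y s) ↔ (bot v : ℕ) < s := by
          intro v
          rw [hbs, Fin.lt_def]
          constructor
          · rintro (h | ⟨h₁, h₂⟩)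
            · exact h
            · have := hb.le F v
              rw [h₁] at this
              linarith
          · exact .inl
        refine .inr ⟨s, by simp, by simp [hbs], by simp [hbs], fun v hv => ?_, ?_⟩
        · simpa using hB v ((hiff v).1 hv)
        · simp only [hiff, ne_eq, Nat.reduceEqDiff, not_false_eq_true, State.set_reg_ne,
            State.set_reg_self]
          omega
      · rw [hu, enc] at hs9
        have hbs : bot s ≠ s := fun h => by rw [hb.self_iff, hu] at h; simp at h
        have hev : (walkStep aN aS aB).eval n S = (S.set 9 (u + 1)).set 7 (s + 1) := by
          simp [walkStep, Cmd.eval, Op.eval, hc.zero, hc.size, h5, hs, hs9]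
        rw [hev]
        have hiff : ∀ v, (bot v : ℕ) < s + 1 ↔ (bot v : ℕ) < s := by
          intro v
          have : bot v ≠ s := fun h => by
            have := hb.none v
            rw [h, hu] at this
            simp at this
          rw [Ne, Fin.ext_iff] at this
          omega
        refine .inl ⟨by simpa using h5, by simp, fun v hv => ?_, .inl ?_⟩
        · simp only [State.set_reg_self, hiff] at hv
          simpa using hB v hv
        · simp only [State.set_reg_self, hiff]
          omega
  · have hw := hN w
    have hev : (walkStep aN aS aB).eval n S =
        ((S.set 8 w).put aB w (bot w + 1)).set 5 (enc (H.nbr w r)) := by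
      simp [walkStep, Cmd.eval, Op.eval, hc.zero, hc.one, h5, h6, hw, hNB]
    rw [hev]
    have hnot : ¬ (bot w < bot w ∨ bot w = bot w ∧ y w < y w) := by simp
    rcases hu : H.nbr w r with _ | u
    · have hiff : ∀ v, (bot v : ℕ) < bot w + 1 ↔
          v = w ∨ (bot v < bot w ∨ bot v = bot w ∧ y v < y w) := by
        intro v
        rw [Nat.lt_succ_iff, ← Fin.le_def, le_iff_lt_or_eq]
        constructor
        · rintro (h | h)
          · exact .inr (.inl h)
          · rcases hb.le_of_none F hu h with h' | h'
            exacts [.inl h', .inr (.inr ⟨h, h'⟩)]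
        · rintro (rfl | h | h)
          exacts [.inr rfl, .inl h, .inr h.1]
      have hcard := card_insert_lt w hnot hiff
      refine .inl ⟨by simp [enc], by simp [h7], fun v hv => ?_, .inl ?_⟩
      · simp only [ne_eq, Nat.reduceEqDiff, not_false_eq_true, State.set_reg_ne, State.put_reg, h7,
          hiff] at hv
        rcases hv with rfl | hv
        · simp
        · have hvw : (v : ℕ) ≠ w := fun h => hnot (by rwa [Fin.ext h] at hv)
          simpa [hvw] using hB v hv
      · simp only [ne_eq, Nat.reduceEqDiff, not_false_eq_true, State.set_reg_ne, State.put_reg, h7]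
        omega
    · have hbu := hb.step hu
      have hiff : ∀ v, (bot v < bot u ∨ bot v = bot u ∧ y v < y u) ↔
          v = w ∨ (bot v < bot w ∨ bot v = bot w ∧ y v < y w) := by
        intro v
        rw [hbu]
        constructor
        · rintro (h | ⟨h, h'⟩)
          · exact .inr (.inl h)
          · rcases (hb.lt_step_iff F hu h).1 h' with h' | h'
            exacts [.inl h', .inr (.inr ⟨h, h'⟩)]
        · rintro (rfl | h | ⟨h, h'⟩)
          exacts [.inr ⟨rfl, (F.up hu).2⟩, .inl h, .inr ⟨h, (hb.lt_step_iff F hu h).2 (.inr h')⟩]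
      have hcard := card_insert_lt w hnot hiff
      refine .inr ⟨u, by simp [enc], by simp [h6, hbu], by simp [h7, hbu], fun v hv => ?_, ?_⟩
      · rw [hiff] at hv
        rcases hv with rfl | hv
        · simp
        · have hvw : (v : ℕ) ≠ w := fun h => hnot (by rwa [Fin.ext h] at hv)
          simpa [hvw] using hB v hv
      · simp only [ne_eq, Nat.reduceEqDiff, not_false_eq_true, State.set_reg_ne, State.put_reg, h7]
        omega

/-- The computation of the lowest vertices of all lines. -/
def bottomStms (aN aS aB : ℕ) : List Stm :=
  [.cmd (.seq (.op (.bit 5 false)) (.op (.bit 7 false))),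
    .loop (.seq (walkStep aN aS aB) (walkStep aN aS aB))]

/-- The pointer and the number of labelled vertices are at most `n`, so at time `2 n` both equal
`n`. The walk cannot be inside a line, since its current vertex is still unlabelled. -/
theorem WalkInv.final {S : State} (h : WalkInv y bot aB (2 * n) S) (v : Fin n) :
    S.arr aB v = bot v + 1 := by
  have hcard : ∀ p : Fin n → Prop, Nat.card {v // p v} ≤ n := fun p => by
    simpa using Finite.card_subtype_le p
  rcases h with ⟨-, h7, hB, ht⟩ | ⟨w, -, -, h7, -, ht⟩
  · refine hB v ?_
    have := hcard fun v => (bot v : ℕ) < S.reg 7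
    have h := (bot v).2
    omega
  · have h := card_insert_lt (p := fun v => bot v < bot w ∨ bot v = bot w ∧ y v < y w)
      (q := fun v => v = w ∨ (bot v < bot w ∨ bot v = bot w ∧ y v < y w)) w (by simp)
      fun _ => Iff.rfl
    have := hcard fun v => v = w ∨ (bot v < bot w ∨ bot v = bot w ∧ y v < y w)
    have := (bot w).2
    omega

theorem bottomStms_spec (F : Frame H x y e r) (hb : H.IsBottomMap r bot) {S : State}
    (hc : Consts n S) (hN : HoldsNbr H S aN r) (hS : HoldsNbr H S aS r.opp) (hNB : aN ≠ aB)
    (hSB : aS ≠ aB) (v : Fin n) :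
    (evalList n (bottomStms aN aS aB) S).arr aB v = bot v + 1 := by
  refine WalkInv.final (y := y) (n := n) (bot := bot) ?_ v
  set S₁ := Cmd.eval n (.seq (.op (.bit 5 false)) (.op (.bit 7 false))) S with hS₁
  have hag : Agree [5, 7] [] S S₁ :=
    Cmd.agree n (.seq (.op (.bit 5 false)) (.op (.bit 7 false))) S
  have hc₁ := hc.agree hag (by simp)
  have hN₁ := hN.agree hag (by simp)
  have hS₁' := hS.agree hag (by simp)
  -- The loop runs `n` times; two walk steps per iteration give the `2 n` steps that are needed.
  refine Cmd.iter_induction (c := .seq (walkStep aN aS aB) (walkStep aN aS aB))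
    (fun m T => WalkInv y bot aB (2 * m) T) ?_ fun m hm T hT hI => ?_
  · refine .inl ⟨by simp [Stm.eval, Cmd.eval, Op.eval],
      by simp [Stm.eval, Cmd.eval, Op.eval], ?_, .inl ?_⟩
    · simp [Stm.eval, Cmd.eval, Op.eval]
    · simp [Stm.eval, Cmd.eval, Op.eval]
  · have hT' : Agree (0 :: (walkStep aN aS aB).regs) [aB] S₁ (T.set 0 m) :=
      Agree.trans (T := T) (hT.mono (by simp [Cmd.regs]) (by simp [Cmd.arrs, walkStep, Op.arrs]))
        ⟨fun i hi => State.set_reg_ne fun h => hi (by simp [h]), fun _ _ => rfl⟩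
    have hT'' := hT'.trans (((walkStep aN aS aB).agree n (T.set 0 m)).mono
      (R' := 0 :: (walkStep aN aS aB).regs) (A' := [aB]) (by simp)
      (by simp [Cmd.arrs, walkStep, Op.arrs]))
    have hreg : 1 ∉ 0 :: (walkStep aN aS aB).regs ∧ 3 ∉ 0 :: (walkStep aN aS aB).regs ∧
        13 ∉ 0 :: (walkStep aN aS aB).regs := by simp [walkStep, Cmd.regs, Op.regs]
    have hI' : WalkInv y bot aB (2 * m) (T.set 0 m) := by simpa [WalkInv] using hI
    exact (hI'.step F hb (hc₁.agree hT' hreg) (hN₁.agree hT' (by simpa using hNB))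
      (hS₁'.agree hT' (by simpa using hSB)) hNB).step F hb (hc₁.agree hT'' hreg)
      (hN₁.agree hT'' (by simpa using hNB)) (hS₁'.agree hT'' (by simpa using hSB)) hNB

end
/-! ### Effects of lists of statements -/

/-- The registers that a statement changes. -/
def Stm.regs : Stm → List ℕ
  | .cmd c => c.regs
  | .loop c => 0 :: c.regs

/-- The arrays that a statement changes. -/
def Stm.arrs : Stm → List ℕ
  | .cmd c => c.arrs
  | .loop c => c.arrs

theorem Stm.agree (n : ℕ) (s : Stm) (S : State) : Agree s.regs s.arrs S (s.eval n S) := by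
  cases s with
  | cmd c => exact c.agree n S
  | loop c => exact c.agree_iter n S n

theorem agree_evalList (n : ℕ) (l : List Stm) (S : State) :
    Agree (l.flatMap Stm.regs) (l.flatMap Stm.arrs) S (evalList n l S) := by
  induction l generalizing S with
  | nil => exact .refl _ _ _
  | cons s l ih =>
    exact ((s.agree n S).mono (by simp) (by simp)).trans ((ih _).mono (by simp) (by simp))

theorem evalList_append (n : ℕ) (l l' : List Stm) (S : State) :
    evalList n (l ++ l') S = evalList n l' (evalList n l S) := List.foldl_append

theorem Agree.set_zero (R A : List ℕ) {S T : State} (h : Agree (0 :: R) A S T) (m : ℕ) :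
    Agree (0 :: R) A S (T.set 0 m) :=
  h.trans ⟨fun i hi => State.set_reg_ne fun h => hi (by simp [h]), fun _ _ => rfl⟩

theorem card_lt_succ {n m : ℕ} (hm : m < n) (p : Fin n → Prop) [DecidablePred p] :
    Nat.card {u : Fin n // (u : ℕ) < m + 1 ∧ p u} =
      Nat.card {u : Fin n // (u : ℕ) < m ∧ p u} + if p ⟨m, hm⟩ then 1 else 0 := by
  have hiff : ∀ u : Fin n, (u : ℕ) < m + 1 ↔ u = ⟨m, hm⟩ ∨ (u : ℕ) < m := by
    intro u
    rw [Fin.ext_iff]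
    simp only
    omega
  split_ifs with h
  · refine card_insert_lt (⟨m, hm⟩ : Fin n) (by simp) fun u => ?_
    rw [hiff]
    constructor
    · rintro ⟨rfl | h₁, h₂⟩
      exacts [.inl rfl, .inr ⟨h₁, h₂⟩]
    · rintro (rfl | ⟨h₁, h₂⟩)
      exacts [⟨.inl rfl, h⟩, ⟨.inr h₁, h₂⟩]
  · refine Nat.card_congr (Equiv.subtypeEquivRight fun u => ?_)
    rw [hiff]
    constructor
    · rintro ⟨rfl | h₁, h₂⟩
      exacts [absurd h₂ h, ⟨h₁, h₂⟩]
    · rintro ⟨h₁, h₂⟩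
      exact ⟨.inr h₁, h₂⟩

theorem card_subtype_le {n : ℕ} (p : Fin n → Prop) : Nat.card {v // p v} ≤ n := by
  simpa using Finite.card_subtype_le p

section

variable {n : ℕ} {H : Shape n} {x y : Fin n → ℝ} {e r : Dir} {bot : Fin n → Fin n}
  {aN aE aW aS aB aC aK : ℕ}

/-! ### Counting the edges that enter the lines from the left -/

/-- The array `aC` counts the entering edges of each line. -/
def countStm (aW aB aC : ℕ) : Stm :=
  .loop (.seq (.op (.ld 8 aW 0)) <| .ite 3 8
    (.seq (.op (.ld 9 aB 0)) <| .seq (.op (.ld 10 aC 9)) <| .seq (.op (.inc 10 10)) <|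
      .op (.st aC 9 10)) .skip)

theorem countStm_spec {S : State} (hc : Consts n S) (hW : HoldsNbr H S aW e.opp)
    (hB : ∀ v : Fin n, S.arr aB v = bot v + 1) (hC : ∀ i, S.arr aC i = 0) (hWC : aW ≠ aC)
    (hBC : aB ≠ aC) (b : Fin n) : ((countStm aW aB aC).eval n S).arr aC (b + 1) =
      Nat.card {u // bot u = b ∧ H.nbr u e.opp ≠ none} := by
  classical
  have key := Cmd.iter_induction (n := n) (S := S)
    (c := .seq (.op (.ld 8 aW 0)) <| .ite 3 8
      (.seq (.op (.ld 9 aB 0)) <| .seq (.op (.ld 10 aC 9)) <| .seq (.op (.inc 10 10)) <|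
        .op (.st aC 9 10)) .skip)
    (fun m T => ∀ b : Fin n, T.arr aC (b + 1) =
      Nat.card {u : Fin n // (u : ℕ) < m ∧ bot u = b ∧ H.nbr u e.opp ≠ none}) ?_
    fun m hm T hT hI b => ?_
  · have := key b
    rw [countStm, Stm.eval, this]
    exact Nat.card_congr (Equiv.subtypeEquivRight fun u => by simp)
  · intro b
    simp [hC]
  · have hT' := hT.set_zero _ _ m
    have hcT := hc.agree hT' (by simp [Cmd.regs, Op.regs])
    have hWT := hW.agree hT' (by simpa [Cmd.arrs, Op.arrs] using hWC) ⟨m, hm⟩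
    have hBT : T.arr aB m = bot ⟨m, hm⟩ + 1 := by
      have := hT'.2 aB (by simpa [Cmd.arrs, Op.arrs] using hBC)
      simp only [State.set_arr] at this
      rw [this, hB ⟨m, hm⟩]
    have h3 : T.reg 3 = 0 := by simpa using hcT.zero
    simp only [State.set_arr] at hWT
    rw [card_lt_succ hm, ← hI]
    rcases hu : H.nbr ⟨m, hm⟩ e.opp with _ | u
    · rw [hu, enc] at hWT
      simp [Cmd.eval, Op.eval, hWT, h3]
    · rw [hu, enc] at hWT
      -- The counts before the increment are at most `n`, so the cap in `inc` has no effect.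
      have hle := card_subtype_le
        fun u : Fin n => (u : ℕ) < m ∧ bot u = bot ⟨m, hm⟩ ∧ H.nbr u e.opp ≠ none
      rw [← hI] at hle
      by_cases hb : bot ⟨m, hm⟩ = b
      · subst hb
        simp [Cmd.eval, Op.eval, hWT, h3, hBT, hle]
      · have hb' : (b : ℕ) ≠ bot ⟨m, hm⟩ := fun h => hb (Fin.ext h.symm)
        simp [Cmd.eval, Op.eval, hWT, h3, hBT, hb, hb']

/-! ### The number of lines and a line without entering edges -/

/-- Register `4` counts the lines, and register `5` holds the lowest vertex of a line without
entering edges. -/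
def sourceStms (aS aC : ℕ) : List Stm :=
  [.cmd (.seq (.op (.bit 4 false)) (.op (.bit 5 false))),
    .loop (.seq (.op (.ld 8 aS 0)) <| .ite 3 8 .skip <|
      .seq (.op (.inc 4 4)) <| .seq (.op (.inc 9 0)) <| .seq (.op (.ld 10 aC 9)) <|
        .ite 3 10 .skip (.op (.mov 5 9)))]

/-- In the first alternative nothing is claimed about register `5`. This is harmless: the line of
rank `0` has no entering edges, so that alternative rules out a ranking. -/
theorem sourceStms_spec {S : State} (hc : Consts n S) (hS : HoldsNbr H S aS r.opp) :
    (evalList n (sourceStms aS aC) S).reg 4 = Nat.card {v // H.nbr v r.opp = none} ∧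
    ((∀ b : Fin n, H.nbr b r.opp = none → S.arr aC (b + 1) ≠ 0) ∨
      ∃ b : Fin n, (evalList n (sourceStms aS aC) S).reg 5 = b + 1 ∧ H.nbr b r.opp = none ∧
        S.arr aC (b + 1) = 0) := by
  classical
  set S₁ := Cmd.eval n (.seq (.op (.bit 4 false)) (.op (.bit 5 false))) S with hS₁
  have hag : Agree [4, 5] [] S S₁ :=
    Cmd.agree n (.seq (.op (.bit 4 false)) (.op (.bit 5 false))) S
  have hc₁ := hc.agree hag (by simp)
  have hS' := hS.agree hag (by simp)
  have key := Cmd.iter_induction (n := n) (S := S₁)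
    (c := .seq (.op (.ld 8 aS 0)) <| .ite 3 8 .skip <|
      .seq (.op (.inc 4 4)) <| .seq (.op (.inc 9 0)) <| .seq (.op (.ld 10 aC 9)) <|
        .ite 3 10 .skip (.op (.mov 5 9)))
    (fun m T => T.reg 4 = Nat.card {v : Fin n // (v : ℕ) < m ∧ H.nbr v r.opp = none} ∧
      ((∀ b : Fin n, (b : ℕ) < m → H.nbr b r.opp = none → S.arr aC (b + 1) ≠ 0) ∨
      ∃ b : Fin n, T.reg 5 = b + 1 ∧ H.nbr b r.opp = none ∧ S.arr aC (b + 1) = 0)) ?_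
    fun m hm T hT hI => ?_
  · refine ⟨key.1.trans (Nat.card_congr (Equiv.subtypeEquivRight fun u => by simp)), ?_⟩
    rcases key.2 with h | h
    · exact .inl fun b => h b b.2
    · exact .inr h
  · simp [hS₁, Cmd.eval, Op.eval]
  · have hT' := hT.set_zero _ _ m
    have h3 : T.reg 3 = 0 := by
      simpa using (hc₁.agree hT' (by simp [Cmd.regs, Op.regs])).zero
    have hST := hS'.agree hT' (by simp [Cmd.arrs, Op.arrs]) ⟨m, hm⟩
    have hCT : T.arr aC = S.arr aC := (hT.2 aC (by simp [Cmd.arrs, Op.arrs])).trans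
      (hag.2 aC (by simp))
    simp only [State.set_arr] at hST
    rw [card_lt_succ hm, ← hI.1]
    have hlt : ∀ b : Fin n, (b : ℕ) < m + 1 → b = ⟨m, hm⟩ ∨ (b : ℕ) < m := fun b h => by
      rw [Fin.ext_iff]
      simp only
      omega
    rcases hu : H.nbr ⟨m, hm⟩ r.opp with _ | u
    · rw [hu, enc] at hST
      have hle := card_subtype_le fun u : Fin n => (u : ℕ) < m ∧ H.nbr u r.opp = none
      rw [← hI.1] at hle
      rcases Nat.eq_zero_or_pos (S.arr aC (m + 1)) with h0 | h0
      · refine ⟨?_, .inr ⟨⟨m, hm⟩, ?_, hu, h0⟩⟩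
        · simp [Cmd.eval, Op.eval, hST, h3, hCT, h0, hle, hm.le]
        · simp [Cmd.eval, Op.eval, hST, h3, hCT, h0, hm.le]
      · refine ⟨?_, ?_⟩
        · simp [Cmd.eval, Op.eval, hST, h3, hCT, h0, hle, hm.le]
        · refine hI.2.imp (fun h b hb => ?_) fun ⟨b, hb⟩ => ⟨b, ?_⟩
          · rcases hlt b hb with rfl | hb
            exacts [fun _ => h0.ne', h b hb]
          · simpa [Cmd.eval, Op.eval, hST, h3, hCT, h0, hm.le] using hb
    · rw [hu, enc] at hST
      refine ⟨?_, ?_⟩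
      · simp [Cmd.eval, Op.eval, hST, h3]
      · refine hI.2.imp (fun h b hb hb' => ?_) fun ⟨b, hb⟩ => ⟨b, ?_⟩
        · rcases hlt b hb with rfl | hb
          · rw [hu] at hb'
            exact absurd hb' (by simp)
          · exact h b hb hb'
        · simpa [Cmd.eval, Op.eval, hST, h3] using hb

end
section

variable {n : ℕ} {H : Shape n} {x y : Fin n → ℝ} {e r : Dir} {bot : Fin n → Fin n}
  {X : Fin n → ℕ} {k : ℕ} {aN aE aB aC aK : ℕ}

/-! ### Topological sorting -/

theorem Shape.Ranking.size_le (R : H.Ranking e r X k) : k ≤ n := by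
  choose f hf using fun i : Fin k => R.surj i i.2
  have hinj : Function.Injective f := fun i j h => by
    rw [Fin.ext_iff, ← hf i, ← hf j, h]
  simpa using Fintype.card_le_of_injective f hinj

theorem Shape.Ranking.bot_eq_iff (R : H.Ranking e r X k) (hb : H.IsBottomMap r bot) (u v : Fin n) :
    bot u = bot v ↔ X u = X v := by
  rw [hb.eq_iff, R.eq_iff]

theorem Shape.Ranking.rank_bot (R : H.Ranking e r X k) (hb : H.IsBottomMap r bot) (v : Fin n) :
    X (bot v) = X v :=
  (R.eq_iff _ _).2 (hb.sameLine v)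

/-- The visit of the vertex in register `5`, which is copied to register `8`: it gets the rank in
register `7`, and its edge to the right is deleted. If no edge enters the line of the other end any
more, the lowest vertex of this line is put into register `6`. -/
def visit (aE aB aC aK : ℕ) : Cmd :=
  .seq (.op (.sub 8 5 13)) <| .seq (.op (.st aK 8 7)) <| .seq (.op (.ld 9 aE 8)) <| .ite 3 9
    (.seq (.op (.sub 9 9 13)) <| .seq (.op (.ld 10 aB 9)) <| .seq (.op (.ld 11 aC 10)) <|
      .seq (.op (.sub 11 11 13)) <| .seq (.op (.st aC 10 11)) <| .ite 3 11 .skip (.op (.mov 6 10)))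
    .skip

/-- The choice of the next vertex: the next one on the line, or the lowest vertex of the line that
has been found. -/
def advance (aN : ℕ) : Cmd :=
  .seq (.op (.ld 5 aN 8)) <| .ite 3 5 .skip <|
    .seq (.op (.mov 5 6)) <| .seq (.op (.bit 6 false)) (.op (.inc 7 7))

/-- The vertices with the property `P` have their ranks, and their edges to the right are deleted. -/
structure Processed (H : Shape n) (e : Dir) (X : Fin n → ℕ) (bot : Fin n → Fin n) (aC aK : ℕ)
    (P : Fin n → Prop) (S : State) : Prop where
  rank : ∀ u, P u → S.arr aK u = X u
  count : ∀ b : Fin n,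
    S.arr aC (b + 1) = Nat.card {u // bot u = b ∧ ∃ w, H.Step e w u ∧ ¬ P w}

/-- Register `6` holds the lowest vertex of the next line, if no edge enters this line any more. -/
structure Found (H : Shape n) (r : Dir) (X : Fin n → ℕ) (aC i : ℕ) (S : State) : Prop where
  complete : ∀ b : Fin n, H.nbr b r.opp = none → X b = i + 1 → S.arr aC (b + 1) = 0 →
    S.reg 6 = b + 1
  sound : S.reg 6 = 0 ∨ ∃ b : Fin n, S.reg 6 = b + 1 ∧ X b = i + 1

/-- If a ranking exists, every line of positive rank has an entering edge from the preceding line.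
So while the line of rank `X v` is processed, only the line of rank `X v + 1` can lose its last
entering edge, and one register replaces the usual queue. -/
theorem visit_spec (F : Frame H x y e r) (hb : H.IsBottomMap r bot) (R : H.Ranking e r X k)
    {S : State} (hc : Consts n S) (hE : HoldsNbr H S aE e)
    (hB : ∀ v : Fin n, S.arr aB v = bot v + 1) (hEK : aE ≠ aK) (hBK : aB ≠ aK) (hCK : aC ≠ aK)
    {P : Fin n → Prop} {v : Fin n} (h5 : S.reg 5 = v + 1) (h7 : S.reg 7 = X v)
    (hP : Processed H e X bot aC aK P S) (hv : ¬ P v) (hlt : ∀ u, P u → X u ≤ X v)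
    (h : Found H r X aC (X v) S) :
    Processed H e X bot aC aK (fun u => u = v ∨ P u) ((visit aE aB aC aK).eval n S) ∧
      Found H r X aC (X v) ((visit aE aB aC aK).eval n S) ∧
      ((visit aE aB aC aK).eval n S).reg 8 = v := by
  have hEv := hE v
  have hrank : ∀ T : State, T.arr aK = Function.update (S.arr aK) v (X v) →
      ∀ u, u = v ∨ P u → T.arr aK u = X u := by
    intro T hT u hu
    rw [hT]
    by_cases huv : u = v
    · simp [huv]
    · have : (u : ℕ) ≠ v := fun h => huv (Fin.ext h)
      simp [this, hP.rank u (hu.resolve_left huv)]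
  rcases hw : H.nbr v e with _ | w
  · rw [hw, enc] at hEv
    have hev : (visit aE aB aC aK).eval n S = ((S.set 8 v).put aK v (X v)).set 9 0 := by
      simp [visit, Cmd.eval, Op.eval, hc.one, hc.zero, h5, h7, hEv, hEK]
    rw [hev]
    refine ⟨⟨hrank _ (by simp), fun b => ?_⟩, ⟨fun b hb hb' => ?_, ?_⟩, by simp⟩
    · have : ∀ u w, H.Step e w u → ((w = v ∨ P w) ↔ P w) := by
        intro u w hs
        have : w ≠ v := by
          rintro rfl
          simp [Step, hw] at hs
        simp [this]
      simp only [State.set_arr, ne_eq, hCK, not_false_eq_true, State.put_arr_ne, hP.count]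
      refine Nat.card_congr (Equiv.subtypeEquivRight fun u => and_congr_right fun _ =>
        exists_congr fun w => and_congr_right fun hs => ?_)
      rw [this u w hs]
    · simpa [hCK] using h.complete b hb hb'
    · simpa using h.sound
  · rw [hw, enc] at hEv
    set c := S.arr aC (bot w + 1) with hcdef
    set T := (visit aE aB aC aK).eval n S with hT
    have hrest : T.arr aK = Function.update (S.arr aK) v (X v) ∧
        T.arr aC = Function.update (S.arr aC) (bot w + 1) (c - 1) ∧ T.reg 8 = v ∧
        T.reg 6 = if 0 < c - 1 then S.reg 6 else bot w + 1 := by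
      rw [hT]
      by_cases h0 : 0 < c - 1
      · simp [visit, Cmd.eval, Op.eval, hc.one, hc.zero, h5, h7, hEv, hEK, hB, hBK, hCK,
          ← hcdef, h0, hCK.symm]
      · simp [visit, Cmd.eval, Op.eval, hc.one, hc.zero, h5, h7, hEv, hEK, hB, hBK, hCK,
          ← hcdef, h0, hCK.symm]
    obtain ⟨hK, hC, h8, h6⟩ := hrest
    have hcount : Processed H e X bot aC aK (fun u => u = v ∨ P u) T := by
      refine ⟨hrank _ hK, fun b => ?_⟩
      rw [hC]
      by_cases hbw : b = bot w
      · subst hbw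
        simp only [Function.update_self]
        rw [hcdef, hP.count, card_insert_lt (p := fun u => bot u = bot w ∧
          ∃ w, H.Step e w u ∧ ¬ (w = v ∨ P w)) w, Nat.add_sub_cancel]
        · rintro ⟨-, w', hs, hne⟩
          exact hne (.inl (hs.left_unique hw))
        · intro u
          constructor
          · rintro ⟨hu, w', hs, hne⟩
            by_cases hw' : w' = v
            · subst hw'
              exact .inl (hs.right_unique hw)
            · exact .inr ⟨hu, w', hs, fun h => h.elim hw' hne⟩
          · rintro (rfl | ⟨hu, w', hs, hne⟩)
            · exact ⟨rfl, v, hw, hv⟩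
            · exact ⟨hu, w', hs, fun h => hne (.inr h)⟩
      · have hbw' : (b : ℕ) ≠ bot w := fun h => hbw (Fin.ext h)
        simp only [ne_eq, Nat.add_right_cancel_iff, hbw', not_false_eq_true,
          Function.update_of_ne, hP.count]
        refine Nat.card_congr (Equiv.subtypeEquivRight fun u => and_congr_right fun hu =>
          exists_congr fun w' => and_congr_right fun hs => ?_)
        have : w' ≠ v := by
          rintro rfl
          exact hbw (hu.symm.trans (congrArg bot (hs.right_unique hw)))
        simp [this]
    -- If the rank of `w` exceeded `X v + 1`, the ranking edge from the line of rank `X w - 1` would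
    -- still be undeleted and the count positive.
    have hnext : c - 1 = 0 → X w = X v + 1 := by
      intro h0
      by_contra hne
      have hvw := (R.lt_iff F v w).2 (F.right hw).1
      obtain ⟨u, w', hs, hu, hw'⟩ := R.next (X w - 1) (by have := R.lt w; omega)
      have hcb := hcount.count (bot w)
      rw [hC, Function.update_self, h0] at hcb
      have hcb' := (Finite.card_eq_zero_iff.1 hcb.symm).false
      refine hcb' ⟨w', (R.bot_eq_iff hb _ _).2 (by omega), u, hs, ?_⟩
      rintro (rfl | hu')
      · omega
      · have := hlt u hu'
        omega
    refine ⟨hcount, ⟨fun b hbot hbX hb0 => ?_, ?_⟩, h8⟩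
    · rw [h6]
      by_cases hbw : b = bot w
      · subst hbw
        rw [hC, Function.update_self] at hb0
        simp [hb0]
      · have hbw' : (b : ℕ) ≠ bot w := fun h => hbw (Fin.ext h)
        rw [hC, Function.update_of_ne (by simpa using hbw')] at hb0
        have hpos : 0 < c - 1 := by
          by_contra h0
          refine hbw ?_
          rw [← (hb.self_iff b).2 hbot, R.bot_eq_iff hb, hbX, hnext (by omega)]
        rw [if_pos hpos]
        exact h.complete b hbot hbX hb0
    · rw [h6]
      split_ifs with h0
      · exact h.sound
      · exact .inr ⟨bot w, rfl, by rw [R.rank_bot hb, hnext (by omega)]⟩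

/-- The invariant of the sorting after `t` steps. -/
structure SortInv (H : Shape n) (e r : Dir) (y : Fin n → ℝ) (X : Fin n → ℕ) (bot : Fin n → Fin n)
    (aC aK t : ℕ) (v : Fin n) (S : State) : Prop where
  current : S.reg 5 = v + 1
  level : S.reg 7 = X v
  time : t = Nat.card {u // X u < X v ∨ X u = X v ∧ y u < y v}
  processed : Processed H e X bot aC aK (fun u => X u < X v ∨ X u = X v ∧ y u < y v) S
  found : Found H r X aC (X v) S

/-- When a line is begun, the ranking edge from it to the next line is not yet deleted, so register
`6` is rightly empty. This covers the first line, with empty `P`, as well as every change of lines.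
-/
theorem SortInv.start (F : Frame H x y e r) (hb : H.IsBottomMap r bot) (R : H.Ranking e r X k)
    {P : Fin n → Prop} {b : Fin n} (hbot : H.nbr b r.opp = none) (hP : ∀ u, P u ↔ X u < X b)
    {S : State} (h5 : S.reg 5 = b + 1) (h6 : S.reg 6 = 0) (h7 : S.reg 7 = X b)
    (h : Processed H e X bot aC aK P S) :
    SortInv H e r y X bot aC aK (Nat.card {u // P u}) b S := by
  have hiff : (fun u => X u < X b ∨ X u = X b ∧ y u < y b) = P := by
    ext u
    rw [hP]
    constructor
    · rintro (h | ⟨h, h'⟩)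
      · exact h
      · have := hb.le F u
        rw [(R.bot_eq_iff hb u b).2 h, (hb.self_iff b).2 hbot] at this
        linarith
    · exact .inl
  refine ⟨h5, h7, by rw [← hiff], by rwa [hiff], ⟨fun b' hb' hX h0 => ?_, .inl h6⟩⟩
  rw [h.count] at h0
  obtain ⟨u, w, hs, hu, hw⟩ := R.next (X b) (by have := R.lt b'; omega)
  refine ((Finite.card_eq_zero_iff.1 h0).false ⟨w, ?_, u, hs, ?_⟩).elim
  · rw [← (hb.self_iff b').2 hb', R.bot_eq_iff hb]
    omega
  · rw [hP]
    omega

/-- One step of the sorting. -/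
def sortStep (aN aE aB aC aK : ℕ) : Cmd :=
  .ite 3 5 (.seq (visit aE aB aC aK) (advance aN)) .skip

/-- The processed vertices are an initial segment of the order by rank and then by height. Every
step adds the current vertex, so the size of the segment is the time. After the last line register
`6` is empty, register `5` becomes `0`, and the loop idles. -/
theorem sortStep_spec (F : Frame H x y e r) (hb : H.IsBottomMap r bot) (R : H.Ranking e r X k)
    {S : State} (hc : Consts n S) (hE : HoldsNbr H S aE e) (hN : HoldsNbr H S aN r)
    (hB : ∀ v : Fin n, S.arr aB v = bot v + 1) (hEK : aE ≠ aK) (hBK : aB ≠ aK) (hCK : aC ≠ aK)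
    (hNK : aN ≠ aK) (hNC : aN ≠ aC)
    {t : ℕ} {v : Fin n} (h : SortInv H e r y X bot aC aK t v S) :
    (∃ w, SortInv H e r y X bot aC aK (t + 1) w ((sortStep aN aE aB aC aK).eval n S)) ∨
      (((sortStep aN aE aB aC aK).eval n S).reg 5 = 0 ∧
        ∀ u : Fin n, ((sortStep aN aE aB aC aK).eval n S).arr aK u = X u) := by
  have hnot : ¬ (X v < X v ∨ X v = X v ∧ y v < y v) := by simp
  obtain ⟨hP, hfound, h8⟩ := visit_spec F hb R hc hE hB hEK hBK hCK h.current h.level h.processed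
    hnot (fun u hu => hu.elim le_of_lt fun h => h.1.le) h.found
  set T := (visit aE aB aC aK).eval n S with hT
  have hag : Agree [8, 9, 10, 11, 6] [aK, aC] S T := ((visit aE aB aC aK).agree n S).mono
    (by simp [visit, Cmd.regs, Op.regs]) (by simp [visit, Cmd.arrs, Op.arrs])
  have hcT := hc.agree hag (by simp)
  have hNT := hN.agree hag (by simp [hNK, hNC]) v
  have h7 : T.reg 7 = X v := (hag.1 7 (by simp)).trans h.level
  have hev : (sortStep aN aE aB aC aK).eval n S = (advance aN).eval n T := by
    simp [sortStep, Cmd.eval, hc.zero, h.current, hT]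
  have hcard := card_insert_lt v hnot
    (q := fun u => u = v ∨ (X u < X v ∨ X u = X v ∧ y u < y v)) fun _ => Iff.rfl
  rw [← h.time] at hcard
  rw [hev]
  rcases hw : H.nbr v r with _ | w
  · have hiff : ∀ u, (u = v ∨ (X u < X v ∨ X u = X v ∧ y u < y v)) ↔ X u < X v + 1 := by
      intro u
      rw [Nat.lt_succ_iff, le_iff_lt_or_eq]
      constructor
      · rintro (rfl | h | h)
        exacts [.inr rfl, .inl h, .inr h.1]
      · rintro (h | h)
        · exact .inr (.inl h)
        · exact (hb.le_of_none F hw ((R.bot_eq_iff hb u v).2 h)).imp id fun h' => .inr ⟨h, h'⟩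
    rw [hw, enc] at hNT
    have hXv : X v ≤ n := (R.lt v).le.trans R.size_le
    have hadv : (advance aN).eval n T = ((((T.set 5 0).set 5 (T.reg 6)).set 6 0).set 7 (X v + 1)) := by
      simp [advance, Cmd.eval, Op.eval, hcT.zero, h8, hNT, h7, hXv]
    rw [hadv]
    by_cases hk : X v + 1 < k
    · obtain ⟨b', hb'⟩ := R.surj _ hk
      obtain ⟨b, hbot, hbX⟩ : ∃ b, H.nbr b r.opp = none ∧ X b = X v + 1 :=
        ⟨bot b', hb.none b', (R.rank_bot hb b').trans hb'⟩
      have h6 : T.reg 6 = b + 1 := by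
        -- Edges into the next line come from lines of smaller rank, which are all processed, so its
        -- count is zero.
        refine hfound.complete b hbot hbX ?_
        rw [hP.count]
        refine Finite.card_eq_zero_iff.2 ⟨?_⟩
        rintro ⟨u, hu, w, hs, hne⟩
        rw [hiff] at hne
        have := (R.lt_iff F w u).2 (F.right hs).1
        have := (R.bot_eq_iff hb u b).1 (by rw [hu, (hb.self_iff b).2 hbot])
        omega
      left
      refine ⟨b, ?_⟩
      rw [← hcard]
      exact SortInv.start F hb R hbot (fun u => by rw [hiff, hbX]) (by simp [h6]) (by simp)
        (by simp [hbX]) ⟨hP.rank, hP.count⟩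
    · right
      refine ⟨?_, fun u => hP.rank u ((hiff u).2 ?_)⟩
      · rcases hfound.sound with h6 | ⟨b, -, hb⟩
        · simp [h6]
        · have := R.lt b
          omega
      · have := R.lt u
        omega
  · rw [hw, enc] at hNT
    have hadv : (advance aN).eval n T = T.set 5 (w + 1) := by
      simp [advance, Cmd.eval, Op.eval, hcT.zero, h8, hNT]
    rw [hadv]
    have hXw : X w = X v := (R.bot_eq_iff hb w v).1 (hb.step hw)
    have hiff : (fun u => X u < X w ∨ X u = X w ∧ y u < y w) =
        fun u => u = v ∨ (X u < X v ∨ X u = X v ∧ y u < y v) := by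
      ext u
      rw [hXw]
      constructor
      · rintro (h | ⟨h, h'⟩)
        · exact .inr (.inl h)
        · exact ((hb.lt_step_iff F hw ((R.bot_eq_iff hb u v).2 h)).1 h').imp id
            fun h' => .inr ⟨h, h'⟩
      · rintro (rfl | h | ⟨h, h'⟩)
        · exact .inr ⟨rfl, (F.up hw).2⟩
        · exact .inl h
        · exact .inr ⟨h, (hb.lt_step_iff F hw ((R.bot_eq_iff hb u v).2 h)).2 (.inr h')⟩
    refine .inl ⟨w, by simp, by simp [h7, hXw], ?_, ?_, ?_⟩
    · rw [← hcard, hiff]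
    · rw [hiff]
      exact ⟨hP.rank, hP.count⟩
    · rw [hXw]
      exact ⟨fun b h₁ h₂ h₃ => by simpa using hfound.complete b h₁ h₂ h₃, by simpa using hfound.sound⟩

/-- The sorting of the lines, starting from the line in register `5`. -/
def sortStms (aN aE aB aC aK : ℕ) : List Stm :=
  [.cmd (.seq (.op (.bit 6 false)) (.op (.bit 7 false))), .loop (sortStep aN aE aB aC aK)]

theorem sortStms_spec (F : Frame H x y e r) (hb : H.IsBottomMap r bot) (R : H.Ranking e r X k)
    {S : State} (hc : Consts n S) (hE : HoldsNbr H S aE e) (hN : HoldsNbr H S aN r)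
    (hB : ∀ v : Fin n, S.arr aB v = bot v + 1) (hEK : aE ≠ aK) (hBK : aB ≠ aK) (hCK : aC ≠ aK)
    (hNK : aN ≠ aK) (hNC : aN ≠ aC) (hEC : aE ≠ aC) (hBC : aB ≠ aC)
    (hC : ∀ b : Fin n, S.arr aC (b + 1) = Nat.card {u // bot u = b ∧ H.nbr u e.opp ≠ none})
    {b : Fin n} (h5 : S.reg 5 = b + 1) (hbot : H.nbr b r.opp = none)
    (h0 : S.arr aC (b + 1) = 0) (u : Fin n) :
    (evalList n (sortStms aN aE aB aC aK) S).arr aK u = X u := by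
  set S₁ := Cmd.eval n (.seq (.op (.bit 6 false)) (.op (.bit 7 false))) S with hS₁
  have hag : Agree [6, 7] [] S S₁ :=
    Cmd.agree n (.seq (.op (.bit 6 false)) (.op (.bit 7 false))) S
  -- A line of positive rank is entered from the preceding one, so a line without entering edges is
  -- the first.
  have hX : X b = 0 := by
    by_contra hne
    obtain ⟨u, w, hs, hu, hw⟩ := R.next (X b - 1) (by have := R.lt b; omega)
    rw [hC] at h0
    refine (Finite.card_eq_zero_iff.1 h0).false ⟨w, ?_, ?_⟩
    · rw [← (hb.self_iff b).2 hbot, R.bot_eq_iff hb]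
      omega
    · rw [show H.nbr w e.opp = some u from hs.opp]
      simp
  have key := Cmd.iter_induction (n := n) (S := S₁) (c := sortStep aN aE aB aC aK)
    (fun t T => (∃ v, SortInv H e r y X bot aC aK t v T) ∨
      (T.reg 5 = 0 ∧ ∀ u : Fin n, T.arr aK u = X u)) ?_ fun m hm T hT hI => ?_
  · rcases key with ⟨v, hv⟩ | ⟨-, h⟩
    -- A current vertex at time `n` would make `n + 1` vertices together with the `n` processed
    -- ones.
    · have h := card_insert_lt (p := fun u => X u < X v ∨ X u = X v ∧ y u < y v)
        (q := fun u => u = v ∨ (X u < X v ∨ X u = X v ∧ y u < y v)) v (by simp) fun _ => Iff.rfl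
      rw [← hv.time] at h
      have := card_subtype_le fun u => u = v ∨ (X u < X v ∨ X u = X v ∧ y u < y v)
      omega
    · exact h u
  · refine .inl ⟨b, ?_⟩
    have : Nat.card {u : Fin n // False} = 0 := by simp
    rw [← this]
    refine SortInv.start (P := fun _ => False) F hb R hbot (by simp [hX])
      ((hag.1 5 (by simp)).trans h5) (by simp [hS₁, Cmd.eval, Op.eval])
      (by simp [hS₁, Cmd.eval, Op.eval, hX]) ⟨by simp, fun b => ?_⟩
    rw [hag.2 aC (by simp), hC]
    refine Nat.card_congr (Equiv.subtypeEquivRight fun u => and_congr_right fun _ => ?_)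
    rw [Option.ne_none_iff_exists']
    simp only [not_false_eq_true, and_true]
    exact exists_congr fun w => step_opp_iff (d := e)
  · have hT' : Agree (0 :: (sortStep aN aE aB aC aK).regs) [aK, aC] S (T.set 0 m) :=
      Agree.set_zero _ _ ((hag.mono (by simp [sortStep, visit, advance, Cmd.regs, Op.regs])
        (by simp)).trans (hT.mono (by simp)
          (by simp [sortStep, visit, advance, Cmd.arrs, Op.arrs]))) m
    rcases hI with ⟨v, hv⟩ | hI
    · exact sortStep_spec F hb R (hc.agree hT' (by simp [sortStep, visit, advance, Cmd.regs, Op.regs]))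
        (hE.agree hT' (by simp [hEK, hEC])) (hN.agree hT' (by simp [hNK, hNC]))
        (fun v => by rw [hT'.2 aB (by simp [hBK, hBC]), hB]) hEK hBK hCK hNK hNC
        (t := m) (v := v) ⟨by simpa using hv.current, by simpa using hv.level, hv.time,
          ⟨hv.processed.rank, hv.processed.count⟩, ⟨by simpa using hv.found.complete,
            by simpa using hv.found.sound⟩⟩
    · right
      have h3 : T.reg 3 = 0 := by
        simpa using (hc.agree hT' (by simp [sortStep, visit, advance, Cmd.regs, Op.regs])).zero
      simpa [sortStep, Cmd.eval, h3, hI.1] using hI.2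

end
section

variable {n : ℕ} {H : Shape n} {x y : Fin n → ℝ} {e r : Dir} {bot : Fin n → Fin n}
  {X : Fin n → ℕ} {k : ℕ} {aN aW aK aM : ℕ}

/-! ### A criterion for rankings -/

/-- The rank that the left neighbour demands. -/
def Shape.demand (H : Shape n) (e : Dir) (X : Fin n → ℕ) (v : Fin n) : ℕ :=
  match H.nbr v e.opp with
  | some w => X w + 1
  | none => 0

theorem Shape.Ranking.card_bottoms (R : H.Ranking e r X k) (hb : H.IsBottomMap r bot) :
    k = Nat.card {v // H.nbr v r.opp = none} := by
  rw [← Nat.card_fin k]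
  refine (Nat.card_congr (Equiv.ofBijective
    (fun b : {v // H.nbr v r.opp = none} => (⟨X b, R.lt b⟩ : Fin k)) ⟨fun b b' h => ?_, fun i => ?_⟩)).symm
  · rw [Fin.mk.injEq, ← R.bot_eq_iff hb, (hb.self_iff b).2 b.2, (hb.self_iff b').2 b'.2] at h
    exact Subtype.ext h
  · obtain ⟨u, hu⟩ := R.surj i i.2
    exact ⟨⟨bot u, hb.none u⟩, Fin.ext ((R.rank_bot hb u).trans hu)⟩

/-- If `X` is constant on lines and attains `k` values, where `k` is the number of lines, then it is
injective on lines by counting. The demands supply the edges from each rank to the next. So a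
candidate can be verified locally, regardless of how it was found. -/
theorem ranking_iff (F : Frame H x y e r) (hb : H.IsBottomMap r bot)
    (hk : k = Nat.card {v // H.nbr v r.opp = none}) :
    H.Ranking e r X k ↔ (∀ v w, H.Step r v w → X v = X w) ∧
      ∀ i < k, ∃ v, X v = i ∧ H.demand e X v = i := by
  constructor
  · intro R
    refine ⟨fun v w h => (R.eq_iff v w).2 h.sameLine, fun i hi => ?_⟩
    rcases i with _ | i
    · obtain ⟨u, hu⟩ := R.surj 0 hi
      refine ⟨u, hu, ?_⟩
      unfold demand
      split
      · rename_i w hw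
        have := (R.lt_iff F w u).2 (F.right (step_opp_iff.1 hw)).1
        omega
      · rfl
    · obtain ⟨u, w, hs, hu, hw⟩ := R.next i hi
      refine ⟨w, hw, ?_⟩
      rw [demand, show H.nbr w e.opp = some u from hs.opp]
      simpa using hu
  · rintro ⟨h₁, h₂⟩
    have hbot : ∀ v, X (bot v) = X v := by
      intro v
      have := hb.chain v
      generalize bot v = b at this
      induction this with
      | refl => rfl
      | tail _ hs ih => exact ih.trans (h₁ _ _ hs)
    have hsurj : ∀ i : Fin k, ∃ b : {v // H.nbr v r.opp = none}, X b = i := fun i => by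
      obtain ⟨v, hv, -⟩ := h₂ i i.2
      exact ⟨⟨bot v, hb.none v⟩, (hbot v).trans hv⟩
    choose f hf using hsurj
    have hinj : Function.Injective f := fun i j h => by
      rw [Fin.ext_iff, ← hf i, ← hf j, h]
    have hbij : Function.Bijective f :=
      (Nat.bijective_iff_injective_and_card f).2 ⟨hinj, by rw [Nat.card_fin, hk]⟩
    refine ⟨fun u v => ?_, fun u => ?_, fun i hi => ?_, fun i hi => ?_⟩
    · rw [← hb.eq_iff]
      constructor
      · intro h
        obtain ⟨i, hi⟩ := hbij.2 ⟨bot u, hb.none u⟩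
        obtain ⟨j, hj⟩ := hbij.2 ⟨bot v, hb.none v⟩
        have hi' := hf i
        have hj' := hf j
        rw [hi, hbot] at hi'
        rw [hj, hbot] at hj'
        have hij : i = j := Fin.ext (hi'.symm.trans (h.trans hj'))
        rw [← hij, hi] at hj
        simpa using hj
      · intro h
        rw [← hbot u, h, hbot]
    · obtain ⟨i, hi⟩ := hbij.2 ⟨bot u, hb.none u⟩
      have hi' := hf i
      rw [hi, hbot] at hi'
      rw [hi']
      exact i.2
    · obtain ⟨v, hv, -⟩ := h₂ i hi
      exact ⟨v, hv⟩
    · obtain ⟨v, hv, hd⟩ := h₂ (i + 1) hi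
      unfold demand at hd
      split at hd
      · rename_i w hw
        exact ⟨w, v, step_opp_iff.1 hw, by omega, hv⟩
      · omega

/-! ### Checking rankings -/

/-- Checks that the rank of the current vertex is the rank of the next vertex on its line. -/
def checkLine (aN aK : ℕ) : Cmd :=
  .seq (.op (.ld 8 aK 0)) <| .seq (.op (.ld 9 aN 0)) <| .ite 3 9
    (.seq (.op (.sub 9 9 13)) <| .seq (.op (.ld 9 aK 9)) <|
      .ite 8 9 (.op (.bit 2 false)) (.ite 9 8 (.op (.bit 2 false)) .skip))
    .skip

/-- Marks the rank of the current vertex if the left neighbour demands this rank. -/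
def markRank (aW aK aM : ℕ) : Cmd :=
  .seq (.seq (.op (.ld 9 aW 0)) <| .ite 3 9
    (.seq (.op (.sub 9 9 13)) <| .seq (.op (.ld 9 aK 9)) <| .op (.inc 9 9)) .skip) <|
  .ite 8 9 .skip (.ite 9 8 .skip (.op (.st aM 8 13)))

theorem checkLine_spec {S : State} (hc : Consts n S) (hN : HoldsNbr H S aN r)
    (hK : ∀ v : Fin n, S.arr aK v = X v) {v : Fin n} (h0 : S.reg 0 = v) :
    ((checkLine aN aK).eval n S).reg 8 = X v ∧
      (0 < ((checkLine aN aK).eval n S).reg 2 ↔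
        0 < S.reg 2 ∧ ∀ w, H.Step r v w → X v = X w) := by
  have hNv := hN v
  rcases hw : H.nbr v r with _ | w
  · rw [hw, enc] at hNv
    simp [checkLine, Cmd.eval, Op.eval, hc.zero, h0, hNv, hK, Step, hw]
  · rw [hw, enc] at hNv
    rcases lt_trichotomy (X v) (X w) with h | h | h
    · simp [checkLine, Cmd.eval, Op.eval, hc.zero, hc.one, h0, hNv, hK, Step, hw, h, h.ne]
    · simp [checkLine, Cmd.eval, Op.eval, hc.zero, hc.one, h0, hNv, hK, Step, hw, h]
    · simp [checkLine, Cmd.eval, Op.eval, hc.zero, hc.one, h0, hNv, hK, Step, hw, h, h.ne',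
        not_lt.2 h.le]

theorem markRank_spec {S : State} (hc : Consts n S) (hW : HoldsNbr H S aW e.opp)
    (hK : ∀ v : Fin n, S.arr aK v = X v) {v : Fin n} (h0 : S.reg 0 = v) (h8 : S.reg 8 = X v)
    {i : ℕ} (hi : i < n) :
    0 < ((markRank aW aK aM).eval n S).arr aM i ↔
      0 < S.arr aM i ∨ X v = i ∧ H.demand e X v = i := by
  have hWv := hW v
  set c : Cmd := .seq (.op (.ld 9 aW 0)) <| .ite 3 9
    (.seq (.op (.sub 9 9 13)) <| .seq (.op (.ld 9 aK 9)) <| .op (.inc 9 9)) .skip with hcdef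
  have hag : Agree [9] [] S (c.eval n S) := (c.agree n S).mono (by simp [hcdef, Cmd.regs, Op.regs])
    (by simp [hcdef, Cmd.arrs, Op.arrs])
  obtain ⟨p, hp, hpd⟩ : ∃ p, (c.eval n S).reg 9 = p ∧ (X v = i → (p = i ↔ H.demand e X v = i)) := by
    refine ⟨_, rfl, fun hv => ?_⟩
    rcases hw : H.nbr v e.opp with _ | w
    · rw [hw, enc] at hWv
      simp [hcdef, Cmd.eval, Op.eval, hc.zero, h0, hWv, demand, hw]
    · rw [hw, enc] at hWv
      rw [demand, hw]
      -- If the increment is capped, then `X w > n`, and neither the capped nor the true demand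
      -- equals an index `i < n`.
      by_cases hn : X w ≤ n
      · simp [hcdef, Cmd.eval, Op.eval, hc.zero, hc.one, h0, hWv, hK, hn]
      · simp [hcdef, Cmd.eval, Op.eval, hc.zero, hc.one, h0, hWv, hK, hn]
        omega
  have hev : (markRank aW aK aM).eval n S =
      (Cmd.ite 8 9 .skip (.ite 9 8 .skip (.op (.st aM 8 13)))).eval n (c.eval n S) := rfl
  rw [hev]
  have h8' : (c.eval n S).reg 8 = X v := (hag.1 8 (by simp)).trans h8
  have h13 : (c.eval n S).reg 13 = 1 := (hc.agree hag (by simp)).one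
  have hM : (c.eval n S).arr aM = S.arr aM := hag.2 aM (by simp)
  rcases lt_trichotomy (X v) p with h | h | h
  · simp [Cmd.eval, h8', hp, hM, h]
    intro hv
    rw [← hpd hv]
    omega
  · simp only [Cmd.eval, h8', hp, h, lt_irrefl, ↓reduceIte, Op.eval, h13, State.put_arr_self, hM]
    by_cases hpi : i = p
    · subst hpi
      simp [← hpd h]
    · simp [hpi, Ne.symm hpi]
  · simp [Cmd.eval, h8', hp, hM, h, not_lt.2 h.le]
    intro hv
    rw [← hpd hv]
    omega

/-- Decides whether the array `aK` is a ranking of the lines, whose number is in register `4`. -/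
def checkStms (aN aW aK aM : ℕ) : List Stm :=
  [.loop (.seq (checkLine aN aK) (markRank aW aK aM)),
    .loop (.ite 0 4 (.seq (.op (.ld 8 aM 0)) <| .ite 3 8 .skip (.op (.bit 2 false))) .skip)]

theorem checkStms_spec {S : State} (hc : Consts n S) (hN : HoldsNbr H S aN r)
    (hW : HoldsNbr H S aW e.opp) (hK : ∀ v : Fin n, S.arr aK v = X v)
    (hM : ∀ i, S.arr aM i = 0) (hNM : aN ≠ aM) (hWM : aW ≠ aM) (hKM : aK ≠ aM)
    (hk : S.reg 4 ≤ n) :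
    0 < (evalList n (checkStms aN aW aK aM) S).reg 2 ↔ 0 < S.reg 2 ∧
      (∀ v w, H.Step r v w → X v = X w) ∧ ∀ i < S.reg 4, ∃ v, X v = i ∧ H.demand e X v = i := by
  set c : Cmd := .seq (checkLine aN aK) (markRank aW aK aM) with hcdef
  set c' : Cmd := .ite 0 4 (.seq (.op (.ld 8 aM 0)) <| .ite 3 8 .skip (.op (.bit 2 false))) .skip
    with hcdef'
  have hev : evalList n (checkStms aN aW aK aM) S = c'.iter n (c.iter n S n) n := rfl
  rw [hev]
  have key := Cmd.iter_induction (n := n) (S := S) (c := c)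
    (fun m T => (0 < T.reg 2 ↔ 0 < S.reg 2 ∧ ∀ v : Fin n, (v : ℕ) < m → ∀ w, H.Step r v w →
      X v = X w) ∧ ∀ i < n, (0 < T.arr aM i ↔
        ∃ v : Fin n, (v : ℕ) < m ∧ X v = i ∧ H.demand e X v = i))
    (by simp [hM]) fun m hm T hT hI => ?_
  · have hag := c.agree_iter n S n
    set S₁ := c.iter n S n
    have h4 : S₁.reg 4 = S.reg 4 := hag.1 4 (by simp [hcdef, checkLine, markRank, Cmd.regs, Op.regs])
    have hc₁ : Consts n S₁ := hc.agree hag (by simp [hcdef, checkLine, markRank, Cmd.regs, Op.regs])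
    have key' := Cmd.iter_induction (n := n) (S := S₁) (c := c')
      (fun m T => 0 < T.reg 2 ↔ 0 < S₁.reg 2 ∧ ∀ i < m, i < S.reg 4 → 0 < S₁.arr aM i)
      (by simp) fun m hm T hT hI => ?_
    · rw [key', key.1, and_assoc]
      refine and_congr_right fun _ => and_congr ?_ ?_
      · exact ⟨fun h v => h v v.2, fun h v _ => h v⟩
      · constructor
        · intro h i hi
          obtain ⟨v, -, hv⟩ := (key.2 i (by omega)).1 (h i (by omega) hi)
          exact ⟨v, hv⟩
        · intro h i hi hi'
          obtain ⟨v, hv⟩ := h i hi'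
          exact (key.2 i hi).2 ⟨v, v.2, hv⟩
    · have h3 : T.reg 3 = 0 :=
        (hT.1 3 (by simp [hcdef', Cmd.regs, Op.regs])).trans hc₁.zero
      have h4' : T.reg 4 = S.reg 4 := (hT.1 4 (by simp [hcdef', Cmd.regs, Op.regs])).trans h4
      have hMT : T.arr aM = S₁.arr aM := hT.2 aM (by simp [hcdef', Cmd.arrs, Op.arrs])
      have hstep : 0 < (c'.eval n (T.set 0 m)).reg 2 ↔
          0 < T.reg 2 ∧ (m < S.reg 4 → 0 < S₁.arr aM m) := by
        by_cases h : m < S.reg 4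
        · rcases Nat.eq_zero_or_pos (S₁.arr aM m) with h0 | h0
          · simp [hcdef', Cmd.eval, Op.eval, h3, h4', hMT, h, h0]
          · simp [hcdef', Cmd.eval, Op.eval, h3, h4', hMT, h, h0]
        · simp [hcdef', Cmd.eval, h4', h]
      rw [hstep, hI, and_assoc]
      refine and_congr_right fun _ => ⟨fun h i hi => ?_, fun h => ⟨fun i hi => h i (by omega),
        h m (by omega)⟩⟩
      rcases Nat.lt_succ_iff_lt_or_eq.1 hi with hi | rfl
      exacts [h.1 i hi, h.2]
  · have hT' := hT.set_zero _ _ m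
    have hregs : 1 ∉ 0 :: c.regs ∧ 3 ∉ 0 :: c.regs ∧ 13 ∉ 0 :: c.regs := by
      simp [hcdef, checkLine, markRank, Cmd.regs, Op.regs]
    have harrs : ∀ a, a ≠ aM → a ∉ c.arrs := fun a ha => by
      simp [hcdef, checkLine, markRank, Cmd.arrs, Op.arrs, ha]
    have hag : Agree (checkLine aN aK).regs [] (T.set 0 m) ((checkLine aN aK).eval n (T.set 0 m)) :=
      ((checkLine aN aK).agree n _).mono (by simp) (by simp [checkLine, Cmd.arrs, Op.arrs])
    have hcT := hc.agree hT' hregs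
    have hKT : ∀ v : Fin n, (T.set 0 m).arr aK v = X v := fun v => by
      rw [hT'.2 aK (harrs aK hKM), hK]
    obtain ⟨h8, h2⟩ := checkLine_spec (r := r) (X := X) (v := ⟨m, hm⟩) hcT
      (hN.agree hT' (harrs aN hNM)) hKT (by simp)
    have hmark := fun i (hi : i < n) => markRank_spec (e := e) (X := X) (v := ⟨m, hm⟩) (aM := aM)
      (hcT.agree hag (by simp [checkLine, Cmd.regs, Op.regs]))
      ((hW.agree hT' (harrs aW hWM)).agree hag (by simp))
      (fun v => by rw [hag.2 aK (by simp), hKT])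
      ((hag.1 0 (by simp [checkLine, Cmd.regs, Op.regs])).trans (by simp)) h8 hi
    have hag' := (markRank aW aK aM).agree n ((checkLine aN aK).eval n (T.set 0 m))
    have hlt : ∀ v : Fin n, (v : ℕ) < m + 1 ↔ (v : ℕ) < m ∨ v = ⟨m, hm⟩ := fun v => by
      rw [Fin.ext_iff]
      simp only
      omega
    refine ⟨?_, fun i hi => ?_⟩
    · rw [show c.eval n (T.set 0 m) = (markRank aW aK aM).eval n
        ((checkLine aN aK).eval n (T.set 0 m)) from rfl,
        hag'.1 2 (by simp [markRank, Cmd.regs, Op.regs]), h2, State.set_reg_ne (by simp), hI.1,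
        and_assoc]
      refine and_congr_right fun _ => ⟨fun h v hv => ?_, fun h => ⟨fun v hv => h v (by omega),
        h _ (by simp)⟩⟩
      rcases (hlt v).1 hv with hv | rfl
      exacts [h.1 v hv, h.2]
    · rw [show c.eval n (T.set 0 m) = (markRank aW aK aM).eval n
        ((checkLine aN aK).eval n (T.set 0 m)) from rfl, hmark i hi, hag.2 aM (by simp),
        State.set_arr, hI.2 i hi]
      constructor
      · rintro (⟨v, hv, h⟩ | h)
        exacts [⟨v, by omega, h⟩, ⟨_, by simp, h⟩]
      · rintro ⟨v, hv, h⟩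
        rcases (hlt v).1 hv with hv | rfl
        exacts [.inl ⟨v, hv, h⟩, .inr h]

end
section

variable {n : ℕ} {H : Shape n} {x y : Fin n → ℝ} {e r : Dir} {aE aN aW aS aC aK aM B : ℕ}

/-! ### Computing and checking the ranking of the lines of one direction -/

/-- Computes the ranking of the lines of one direction in the array `B + 2` and their number in
register `4`, and checks the ranking. -/
def rankStms (aE aN aW aS B : ℕ) : List Stm :=
  bottomStms aN aS B ++ countStm aW B (B + 1) :: sourceStms aS (B + 1) ++
    sortStms aN aE B (B + 1) (B + 2) ++ checkStms aN aW (B + 2) (B + 3)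

theorem agree_bottomStms (S : State) :
    Agree [5, 7, 0, 8, 9, 6] [B] S (evalList n (bottomStms aN aS B) S) :=
  (agree_evalList n _ S).mono (by simp [bottomStms, Stm.regs, Cmd.regs, Op.regs, walkStep])
    (by simp [bottomStms, Stm.arrs, Cmd.arrs, Op.arrs, walkStep])

theorem agree_countStm (S : State) :
    Agree [0, 8, 9, 10] [aC] S ((countStm aW B aC).eval n S) :=
  ((countStm aW B aC).agree n S).mono (by simp [countStm, Stm.regs, Cmd.regs, Op.regs])
    (by simp [countStm, Stm.arrs, Cmd.arrs, Op.arrs])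

theorem agree_sourceStms (S : State) :
    Agree [4, 5, 0, 8, 9, 10] [] S (evalList n (sourceStms aS aC) S) :=
  (agree_evalList n _ S).mono (by simp [sourceStms, Stm.regs, Cmd.regs, Op.regs])
    (by simp [sourceStms, Stm.arrs, Cmd.arrs, Op.arrs])

theorem agree_sortStms (S : State) :
    Agree [6, 7, 0, 8, 9, 10, 11, 5] [aC, aK] S (evalList n (sortStms aN aE B aC aK) S) :=
  (agree_evalList n _ S).mono
    (by simp [sortStms, sortStep, visit, advance, Stm.regs, Cmd.regs, Op.regs])
    (by simp [sortStms, sortStep, visit, advance, Stm.arrs, Cmd.arrs, Op.arrs])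

theorem agree_checkStms (S : State) :
    Agree [0, 8, 9, 2] [aM] S (evalList n (checkStms aN aW aK aM) S) :=
  (agree_evalList n _ S).mono
    (by simp [checkStms, checkLine, markRank, Stm.regs, Cmd.regs, Op.regs])
    (by simp [checkStms, checkLine, markRank, Stm.arrs, Cmd.arrs, Op.arrs])

theorem evalList_rankStms (S : State) : evalList n (rankStms aE aN aW aS B) S =
    evalList n (checkStms aN aW (B + 2) (B + 3))
      (evalList n (sortStms aN aE B (B + 1) (B + 2)) (evalList n (sourceStms aS (B + 1))
        ((countStm aW B (B + 1)).eval n (evalList n (bottomStms aN aS B) S)))) := by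
  rw [rankStms, evalList_append, evalList_append, List.append_cons, evalList_append,
    evalList_append]
  rfl

theorem agree_rankStms (S : State) :
    Agree [0, 2, 4, 5, 6, 7, 8, 9, 10, 11] [B, B + 1, B + 2, B + 3] S
      (evalList n (rankStms aE aN aW aS B) S) := by
  rw [evalList_rankStms]
  exact ((((agree_bottomStms S).mono (by simp) (by simp)).trans
    ((agree_countStm _).mono (by simp) (by simp))).trans
    ((agree_sourceStms _).mono (by simp) (by simp))).trans
    (((agree_sortStms _).mono (by simp) (by simp)).trans
    ((agree_checkStms _).mono (by simp) (by simp)))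

/-- The sorting is known to be correct only if a ranking exists, but its output is verified.
Acceptance proves that the output is a ranking; if some ranking exists, the sorting finds it and the
check accepts. -/
theorem rankStms_spec (F : Frame H x y e r) {S : State} (hc : Consts n S)
    (hE : HoldsNbr H S aE e) (hN : HoldsNbr H S aN r) (hW : HoldsNbr H S aW e.opp)
    (hS : HoldsNbr H S aS r.opp) (hlt : aE < B ∧ aN < B ∧ aW < B ∧ aS < B)
    (h₁ : ∀ i, S.arr (B + 1) i = 0) (h₃ : ∀ i, S.arr (B + 3) i = 0) (hn : 0 < n) :
    (0 < (evalList n (rankStms aE aN aW aS B) S).reg 2 ↔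
      0 < S.reg 2 ∧ ∃ X k, H.Ranking e r X k) ∧
    ((∃ X k, H.Ranking e r X k) → H.Ranking e r
      (fun v => (evalList n (rankStms aE aN aW aS B) S).arr (B + 2) v)
      ((evalList n (rankStms aE aN aW aS B) S).reg 4)) := by
  obtain ⟨bot, hb⟩ := F.exists_isBottomMap
  rw [evalList_rankStms]
  have hB₁ := bottomStms_spec F hb hc hN hS (by omega : aN ≠ B) (by omega)
  set S₁ := evalList n (bottomStms aN aS B) S
  have hA₁ : Agree [5, 7, 0, 8, 9, 6] [B] S S₁ := agree_bottomStms S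
  have hc₁ := hc.agree hA₁ (by simp)
  have hC := countStm_spec hc₁ (hW.agree hA₁ (by simp; omega)) hB₁
    (by rw [hA₁.2 (B + 1) (by simp)]; exact h₁) (by omega) (by omega)
  set S₂ := (countStm aW B (B + 1)).eval n S₁
  have hA₂ : Agree [5, 7, 0, 8, 9, 6, 10] [B, B + 1] S S₂ :=
    (hA₁.mono (by simp) (by simp)).trans ((agree_countStm S₁).mono (by simp) (by simp))
  have hB₂ : ∀ v : Fin n, S₂.arr B v = bot v + 1 := fun v => by
    rw [(agree_countStm S₁).2 B (by simp), hB₁]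
  obtain ⟨h4, h5⟩ := sourceStms_spec (hc.agree hA₂ (by simp)) (hS.agree hA₂ (by simp; omega))
    (aC := B + 1)
  set S₃ := evalList n (sourceStms aS (B + 1)) S₂
  have hA₃' : Agree [4, 5, 0, 8, 9, 10] [] S₂ S₃ := agree_sourceStms S₂
  have hA₃ : Agree [4, 5, 7, 0, 8, 9, 6, 10] [B, B + 1] S S₃ :=
    (hA₂.mono (by simp) (by simp)).trans (hA₃'.mono (by simp) (by simp))
  have hsort : ∀ X k, H.Ranking e r X k → ∀ u : Fin n,
      (evalList n (sortStms aN aE B (B + 1) (B + 2)) S₃).arr (B + 2) u = X u := by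
    intro X k R
    obtain ⟨b, h5b, hbot, h0⟩ := h5.resolve_left fun h => by
      obtain ⟨u, hu⟩ := R.surj 0 ((Nat.zero_le _).trans_lt (R.lt ⟨0, hn⟩))
      refine h (bot u) (hb.none u) ?_
      rw [hC]
      refine Finite.card_eq_zero_iff.2 ⟨?_⟩
      rintro ⟨w, hw, hne⟩
      obtain ⟨z, hz⟩ := Option.ne_none_iff_exists'.1 hne
      have := (R.lt_iff F z w).2 (F.right (step_opp_iff.1 hz)).1
      have := (R.bot_eq_iff hb _ _).1 hw
      have := R.rank_bot hb u
      omega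
    refine sortStms_spec F hb R (hc.agree hA₃ (by simp)) (hE.agree hA₃ (by simp; omega))
      (hN.agree hA₃ (by simp; omega)) ?_ (by omega) (by omega) (by omega) (by omega) (by omega)
      (by omega) (by omega) ?_ h5b hbot ?_
    · rw [hA₃'.2 B (by simp)]
      exact hB₂
    · rw [hA₃'.2 (B + 1) (by simp)]
      exact hC
    · rw [hA₃'.2 (B + 1) (by simp)]
      exact h0
  set S₄ := evalList n (sortStms aN aE B (B + 1) (B + 2)) S₃
  have hA₄' : Agree [6, 7, 0, 8, 9, 10, 11, 5] [B + 1, B + 2] S₃ S₄ := agree_sortStms S₃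
  have hA₄ : Agree [4, 5, 7, 0, 8, 9, 6, 10, 11] [B, B + 1, B + 2] S S₄ :=
    (hA₃.mono (by simp) (by simp)).trans (hA₄'.mono (by simp) (by simp))
  have h4' : S₄.reg 4 = Nat.card {v // H.nbr v r.opp = none} := (hA₄'.1 4 (by simp)).trans h4
  have hcheck := checkStms_spec (X := fun v => S₄.arr (B + 2) v) (aM := B + 3)
    (hc.agree hA₄ (by simp)) (hN.agree hA₄ (by simp; omega))
    (hW.agree hA₄ (by simp; omega)) (fun _ => rfl)
    (by rw [hA₄.2 (B + 3) (by simp)]; exact h₃) (by omega) (by omega) (by omega)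
    (h4'.trans_le (card_subtype_le _))
  rw [← ranking_iff F hb h4', hA₄.1 2 (by simp)] at hcheck
  have hA₅ : Agree [0, 8, 9, 2] [B + 3] S₄ (evalList n (checkStms aN aW (B + 2) (B + 3)) S₄) :=
    agree_checkStms S₄
  have hrank : (∃ X k, H.Ranking e r X k) →
      H.Ranking e r (fun v => S₄.arr (B + 2) v) (S₄.reg 4) := by
    rintro ⟨X, k, R⟩
    rw [show (fun v : Fin n => S₄.arr (B + 2) v) = X from funext (hsort X k R), h4',
      ← R.card_bottoms hb]
    exact R
  rw [hA₅.1 4 (by simp), hA₅.2 (B + 2) (by simp), hcheck]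
  exact ⟨and_congr_right fun _ => ⟨fun h => ⟨_, _, h⟩, hrank⟩, hrank⟩

end
section

variable {n : ℕ} {H : Shape n} {x y : Fin n → ℝ} {e r d d' : Dir} {aX aY aC a a' : ℕ}
  {gx gy : Fin n → ℕ}

/-! ### Checking the corners of one kind -/

/-- Stores the height of the current vertex in the array `aC`, at the index that belongs to its
column, if the vertex has no neighbours in the two directions given by the arrays `a` and `a'`. -/
def collect (a a' aX aY aC : ℕ) : Cmd :=
  .seq (.op (.ld 8 a 0)) <| .ite 3 8 .skip <| .seq (.op (.ld 8 a' 0)) <| .ite 3 8 .skip <|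
    .seq (.op (.ld 8 aX 0)) <| .seq (.op (.ld 9 aY 0)) <| .seq (.op (.inc 9 9)) (.op (.st aC 8 9))

/-- Compares the current entry of `aC` with the last entry, which is in register `5`. -/
def scan (aC : ℕ) : Cmd :=
  .seq (.op (.ld 8 aC 0)) <| .ite 3 8
    (.seq (.ite 8 5 (.op (.bit 2 false)) .skip) (.op (.mov 5 8))) .skip

/-- Checks that the heights of the corners do not decrease. -/
def cornerStms (a a' aX aY aC : ℕ) : List Stm :=
  [.cmd (.op (.bit 5 false)), .loop (collect a a' aX aY aC), .loop (scan aC)]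

theorem agree_cornerStms (S : State) :
    Agree [5, 0, 8, 9, 2] [aC] S (evalList n (cornerStms a a' aX aY aC) S) :=
  (agree_evalList n _ S).mono (by simp [cornerStms, collect, scan, Stm.regs, Cmd.regs, Op.regs])
    (by simp [cornerStms, collect, scan, Stm.arrs, Cmd.arrs, Op.arrs])

theorem pos_of_cornerStms {S : State}
    (h : 0 < (evalList n (cornerStms a a' aX aY aC) S).reg 2) : 0 < S.reg 2 := by
  set S₁ := (collect a a' aX aY aC).iter n ((Cmd.op (.bit 5 false)).eval n S) n with hS₁
  have h₁ : S₁.reg 2 = S.reg 2 :=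
    (((collect a a' aX aY aC).agree_iter n _ n).1 2 (by simp [collect, Cmd.regs, Op.regs])).trans
      (by simp [Cmd.eval, Op.eval])
  have key := Cmd.iter_induction (n := n) (S := S₁) (c := scan aC)
    (fun _ T => 0 < T.reg 2 → 0 < S₁.reg 2) id fun m _ T _ hI h => hI ?_
  · rw [← h₁]
    exact key h
  · by_cases h₁ : T.reg 3 < T.arr aC m
    · by_cases h₂ : T.arr aC m < T.reg 5
      · simp [scan, Cmd.eval, Op.eval, h₁, h₂] at h
      · simpa [scan, Cmd.eval, Op.eval, h₁, h₂] using h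
    · simpa [scan, Cmd.eval, Op.eval, h₁] using h

/-- The vertices without neighbours in two directions. -/
def Shape.IsCorner (H : Shape n) (d d' : Dir) (v : Fin n) : Prop :=
  H.nbr v d = none ∧ H.nbr v d' = none

/-- Heights are stored plus one, so that `0` marks a column without corner. A later corner may
overwrite an earlier one of the same column; uniqueness within columns enters only in `scan_spec`.
-/
theorem collect_spec {S : State} (hc : Consts n S) (ha : HoldsNbr H S a d) (ha' : HoldsNbr H S a' d')
    (hX : ∀ v : Fin n, S.arr aX v = gx v) (hY : ∀ v : Fin n, S.arr aY v = gy v)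
    (hgy : ∀ v, gy v < n) (hC : ∀ i, S.arr aC i = 0)
    (hne : a ≠ aC ∧ a' ≠ aC ∧ aX ≠ aC ∧ aY ≠ aC) (i : ℕ) :
    (((collect a a' aX aY aC).iter n S n).arr aC i = 0 ∧ ∀ v, H.IsCorner d d' v → gx v ≠ i) ∨
      ∃ v, H.IsCorner d d' v ∧ gx v = i ∧
        ((collect a a' aX aY aC).iter n S n).arr aC i = gy v + 1 := by
  have key := Cmd.iter_induction (n := n) (S := S) (c := collect a a' aX aY aC)
    (fun m T => ∀ i, (T.arr aC i = 0 ∧ ∀ v : Fin n, (v : ℕ) < m → H.IsCorner d d' v → gx v ≠ i) ∨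
      ∃ v, H.IsCorner d d' v ∧ gx v = i ∧ T.arr aC i = gy v + 1) (by simp [hC])
    fun m hm T hT hI i => ?_
  · exact (key i).imp (fun h => ⟨h.1, fun v => h.2 v v.2⟩) id
  · have hT' := hT.set_zero _ _ m
    have harr : ∀ b, b ≠ aC → (T.set 0 m).arr b = S.arr b := fun b hb =>
      hT'.2 b (by simpa [collect, Cmd.arrs, Op.arrs] using hb)
    have h3 := (hc.agree hT' (by simp [collect, Cmd.regs, Op.regs])).zero
    set U := T.set 0 m with hU
    have hUC : U.arr aC = T.arr aC := rfl
    have h0 : U.reg 0 = m := by simp [hU]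
    have h1 : U.arr a m = enc (H.nbr ⟨m, hm⟩ d) := by rw [harr a hne.1]; exact ha ⟨m, hm⟩
    have h2 : U.arr a' m = enc (H.nbr ⟨m, hm⟩ d') := by rw [harr a' hne.2.1]; exact ha' ⟨m, hm⟩
    have hx : U.arr aX m = gx ⟨m, hm⟩ := by rw [harr aX hne.2.2.1]; exact hX ⟨m, hm⟩
    have hy : U.arr aY m = gy ⟨m, hm⟩ := by rw [harr aY hne.2.2.2]; exact hY ⟨m, hm⟩
    have hlt : ∀ v : Fin n, (v : ℕ) < m + 1 → v = ⟨m, hm⟩ ∨ (v : ℕ) < m := fun v hv => by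
      rw [Fin.ext_iff]
      simp only
      omega
    by_cases hcor : H.IsCorner d d' ⟨m, hm⟩
    · rw [hcor.1, enc] at h1
      rw [hcor.2, enc] at h2
      have hev : ((collect a a' aX aY aC).eval n U).arr aC =
          Function.update (T.arr aC) (gx ⟨m, hm⟩) (gy ⟨m, hm⟩ + 1) := by
        simp [collect, Cmd.eval, Op.eval, h3, h0, h1, h2, hx, hy, (hgy _).le, hUC]
      rw [hev]
      by_cases hi : gx ⟨m, hm⟩ = i
      · exact .inr ⟨_, hcor, hi, by simp [← hi]⟩
      · rw [Function.update_of_ne (Ne.symm hi)]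
        refine (hI i).imp (fun h => ⟨h.1, fun v hv hv' => ?_⟩) id
        rcases hlt v hv with rfl | hv
        exacts [hi, h.2 v hv hv']
    · have hev : ((collect a a' aX aY aC).eval n U).arr aC = T.arr aC := by
        by_cases h1' : H.nbr ⟨m, hm⟩ d = none
        · have h2' : H.nbr ⟨m, hm⟩ d' ≠ none := fun h => hcor ⟨h1', h⟩
          rw [h1', enc] at h1
          rw [← enc_pos, ← h2] at h2'
          simp [collect, Cmd.eval, Op.eval, h3, h0, h1, h2', hUC]
        · rw [← Ne, ← enc_pos, ← h1] at h1'
          simp [collect, Cmd.eval, Op.eval, h3, h0, h1', hUC]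
      rw [hev]
      refine (hI i).imp (fun h => ⟨h.1, fun v hv hv' => ?_⟩) id
      rcases hlt v hv with rfl | hv
      exacts [absurd hv' hcor, h.2 v hv hv']

/-- By transitivity it suffices to compare each nonempty entry with the previous nonempty one, which
register `5` remembers even after a failure. -/
theorem scan_spec {P : Fin n → Prop} {S : State} (h3 : S.reg 3 = 0) (h5 : S.reg 5 = 0)
    (hgx : ∀ v, gx v < n) (hinj : ∀ u v, P u → P v → gx u = gx v → u = v)
    (hC : ∀ i, (S.arr aC i = 0 ∧ ∀ v, P v → gx v ≠ i) ∨
      ∃ v, P v ∧ gx v = i ∧ S.arr aC i = gy v + 1) :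
    0 < ((scan aC).iter n S n).reg 2 ↔
      0 < S.reg 2 ∧ ∀ u v, P u → P v → gx u < gx v → gy u ≤ gy v := by
  have key := Cmd.iter_induction (n := n) (S := S) (c := scan aC)
    (fun m T => ((T.reg 5 = 0 ∧ ∀ v, P v → m ≤ gx v) ∨
        ∃ v, P v ∧ gx v < m ∧ T.reg 5 = gy v + 1 ∧ ∀ u, P u → gx u < m → gx u ≤ gx v) ∧
      (0 < T.reg 2 ↔ 0 < S.reg 2 ∧
        ∀ u v, P u → P v → gx u < gx v → gx v < m → gy u ≤ gy v))
    (by simp [h5]) fun m hm T hT hI => ?_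
  · rw [key.2]
    exact and_congr_right fun _ => ⟨fun h u v hu hv huv => h u v hu hv huv (hgx v),
      fun h u v hu hv huv _ => h u v hu hv huv⟩
  · have h3T : T.reg 3 = 0 := (hT.1 3 (by simp [scan, Cmd.regs, Op.regs])).trans h3
    have hCT : T.arr aC m = S.arr aC m := by rw [hT.2 aC (by simp [scan, Cmd.arrs, Op.arrs])]
    obtain ⟨hI₁, hI₂⟩ := hI
    rcases hC m with ⟨h0, hm'⟩ | ⟨w, hw, hwm, h0⟩
    · have hev : (scan aC).eval n (T.set 0 m) = (T.set 0 m).set 8 0 := by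
        simp [scan, Cmd.eval, Op.eval, h3T, hCT, h0]
      have hiff : ∀ v, P v → (gx v < m + 1 ↔ gx v < m) := fun v hv => by
        have := hm' v hv
        omega
      rw [hev]
      refine ⟨?_, ?_⟩
      · refine hI₁.imp (fun h => ⟨by simpa using h.1, fun v hv => ?_⟩) ?_
        · have := hm' v hv
          have := h.2 v hv
          omega
        · rintro ⟨v, hv, hvm, h5v, hmax⟩
          exact ⟨v, hv, by omega, by simpa using h5v, fun u hu hum => hmax u hu ((hiff u hu).1 hum)⟩
      · simp only [ne_eq, Nat.reduceEqDiff, not_false_eq_true, State.set_reg_ne, hI₂]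
        exact and_congr_right fun _ => ⟨fun h u v hu hv huv hvm => h u v hu hv huv ((hiff v hv).1 hvm),
          fun h u v hu hv huv hvm => h u v hu hv huv (by omega)⟩
    · have hev₅ : ((scan aC).eval n (T.set 0 m)).reg 5 = gy w + 1 := by
        by_cases h : gy w + 1 < T.reg 5 <;> simp [scan, Cmd.eval, Op.eval, h3T, hCT, h0, h]
      have hev₂ : 0 < ((scan aC).eval n (T.set 0 m)).reg 2 ↔ 0 < T.reg 2 ∧ T.reg 5 ≤ gy w + 1 := by
        by_cases h : gy w + 1 < T.reg 5
        · simp [scan, Cmd.eval, Op.eval, h3T, hCT, h0, h]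
        · simp [scan, Cmd.eval, Op.eval, h3T, hCT, h0, h, not_lt.1 h]
      refine ⟨.inr ⟨w, hw, by omega, hev₅, fun u hu hum => by omega⟩, ?_⟩
      rw [hev₂, hI₂, and_assoc]
      refine and_congr_right fun _ => ⟨?_, fun h => ⟨fun u v hu hv huv hvm =>
        h u v hu hv huv (by omega), ?_⟩⟩
      · rintro ⟨h, h'⟩ u v hu hv huv hvm
        rcases Nat.lt_succ_iff_lt_or_eq.1 hvm with hvm | hvm
        · exact h u v hu hv huv hvm
        · obtain rfl := hinj v w hv hw (hvm.trans hwm.symm)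
          rcases hI₁ with ⟨-, hno⟩ | ⟨z, hz, hzm, h5z, hmax⟩
          · have := hno u hu
            omega
          · rcases (hmax u hu (by omega)).lt_or_eq with huz | huz
            · have := h u z hu hz huz hzm
              omega
            · obtain rfl := hinj u z hu hz huz
              omega
      · rcases hI₁ with ⟨h5, -⟩ | ⟨z, hz, hzm, h5z, -⟩
        · omega
        · have := h z w hz hw (by omega) (by omega)
          omega

/-- From a vertex in the open quadrant of a corner, edges in directions `e` and `r` lead farther
into the quadrant. A vertex where this stops is a corner of the same kind, so comparing corners with
corners is enough. -/
theorem cornerFree_iff (F : Frame H x y e r) :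
    H.CornerFree x y e r ↔
      ∀ u v, H.IsCorner e r u → H.IsCorner e r v → x u < x v → ¬ y u < y v := by
  constructor
  · exact fun h u v hu _ hx hy => h u v hu.1 hu.2 hx hy
  · intro h u v hu hu' hx hy
    induction v using (wellFounded_lt_comp fun v => -(x v + y v)).induction with
    | _ v ih =>
      rcases he : H.nbr v e with _ | w
      · rcases hr : H.nbr v r with _ | w
        · exact h u v ⟨hu, hu'⟩ ⟨he, hr⟩ hx hy
        · have := F.up hr
          exact ih w (by linarith) (by linarith) (by linarith)
      · have := F.right he
        exact ih w (by linarith) (by linarith) (by linarith)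

/-- `aX` numbers the columns in decreasing order of `x`. Corner-freeness then says that the heights
of the corners do not decrease along the scan. -/
theorem cornerStms_spec (F : Frame H x y e r) {X : Fin n → ℕ} {k : ℕ} (R : H.Ranking e r X k)
    {S : State} (hc : Consts n S) (ha : HoldsNbr H S a e) (ha' : HoldsNbr H S a' r)
    (hgx : ∀ v : Fin n, S.arr aX v < n) (hgy : ∀ v : Fin n, S.arr aY v < n)
    (hX : ∀ u v : Fin n, S.arr aX u < S.arr aX v ↔ x v < x u)
    (hY : ∀ u v : Fin n, S.arr aY u < S.arr aY v ↔ y u < y v)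
    (hC : ∀ i, S.arr aC i = 0) (hne : a ≠ aC ∧ a' ≠ aC ∧ aX ≠ aC ∧ aY ≠ aC) :
    0 < (evalList n (cornerStms a a' aX aY aC) S).reg 2 ↔
      0 < S.reg 2 ∧ H.CornerFree x y e r := by
  set S₁ := (Cmd.op (.bit 5 false)).eval n S with hS₁
  have hA₁ : Agree [5] [] S S₁ := (Cmd.op (.bit 5 false)).agree n S
  have hcol := collect_spec (gx := fun v => S.arr aX v) (gy := fun v => S.arr aY v) (aX := aX)
    (aY := aY) (aC := aC) (hc.agree hA₁ (by simp)) (ha.agree hA₁ (by simp))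
    (ha'.agree hA₁ (by simp)) (fun v => by rw [hA₁.2 aX (by simp)])
    (fun v => by rw [hA₁.2 aY (by simp)]) hgy (fun i => by rw [hA₁.2 aC (by simp), hC]) hne
  have hA₂ := (collect a a' aX aY aC).agree_iter n S₁ n
  set S₂ := (collect a a' aX aY aC).iter n S₁ n
  have h5 : S₂.reg 5 = 0 := (hA₂.1 5 (by simp [collect, Cmd.regs, Op.regs])).trans
    (by simp [hS₁, Cmd.eval, Op.eval])
  have h3 : S₂.reg 3 = 0 := (hA₂.1 3 (by simp [collect, Cmd.regs, Op.regs])).trans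
    ((hA₁.1 3 (by simp)).trans hc.zero)
  have h2 : S₂.reg 2 = S.reg 2 := (hA₂.1 2 (by simp [collect, Cmd.regs, Op.regs])).trans
    (hA₁.1 2 (by simp))
  have hscan := scan_spec h3 h5 hgx (fun u v hu hv huv => ?_) hcol
  · refine hscan.trans ?_
    rw [h2, cornerFree_iff F]
    refine and_congr_right fun _ => ⟨fun h u v hu hv hx => ?_, fun h u v hu hv hx => ?_⟩
    · rw [← hY, not_lt]
      exact h v u hv hu ((hX v u).2 hx)
    · rw [← not_lt, hY]
      exact h v u hv hu ((hX u v).1 hx)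
  -- A corner has no edge in direction `r`, hence it is the top of its line, and each column
  -- contains at most one corner.
  · have hx : x u = x v := le_antisymm (not_lt.1 fun h => ((hX u v).2 h).ne huv)
      (not_lt.1 fun h => ((hX v u).2 h).ne' huv)
    have hl := (R.eq_iff u v).1 ((R.eq_iff_eq F u v).2 hx)
    rcases lt_trichotomy (y u) (y v) with hy | hy | hy
    · obtain ⟨w, hw, -⟩ := F.exists_step hl hy
      simp [Step, hu.2] at hw
    · exact F.eq_of_eq hl hy
    · obtain ⟨w, hw, -⟩ := F.exists_step hl.symm hy
      simp [Step, hv.2] at hw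

/-! ### Reversing a ranking -/

/-- Stores in `aR` the reversal of the ranking `aK`, where the number of lines is in register `4`. -/
def reverseStm (aK aR : ℕ) : Stm :=
  .loop (.seq (.op (.ld 8 aK 0)) <| .seq (.op (.sub 8 4 8)) <| .seq (.op (.sub 8 8 13)) <|
    .op (.st aR 0 8))

theorem agree_reverseStm {aK aR : ℕ} (S : State) :
    Agree [0, 8] [aR] S ((reverseStm aK aR).eval n S) :=
  ((reverseStm aK aR).agree n S).mono (by simp [reverseStm, Stm.regs, Cmd.regs, Op.regs])
    (by simp [reverseStm, Stm.arrs, Cmd.arrs, Op.arrs])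

theorem reverseStm_spec {aK aR : ℕ} {S : State} (hc : Consts n S) (hne : aK ≠ aR) (v : Fin n) :
    ((reverseStm aK aR).eval n S).arr aR v = S.reg 4 - S.arr aK v - 1 := by
  refine Cmd.iter_induction (n := n) (S := S) (c := .seq (.op (.ld 8 aK 0)) <|
    .seq (.op (.sub 8 4 8)) <| .seq (.op (.sub 8 8 13)) <| .op (.st aR 0 8))
    (fun m T => ∀ i < m, T.arr aR i = S.reg 4 - S.arr aK i - 1) (by simp)
    (fun m hm T hT hI i hi => ?_) v v.2
  have hT' := hT.set_zero _ _ m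
  have h13 : T.reg 13 = 1 := by
    simpa using (hc.agree hT' (by simp [Cmd.regs, Op.regs])).one
  have h4 : T.reg 4 = S.reg 4 := hT.1 4 (by simp [Cmd.regs, Op.regs])
  have hKT : T.arr aK = S.arr aK := hT.2 aK (by simpa [Cmd.arrs, Op.arrs] using hne)
  by_cases him : i = m
  · subst him
    simp [Cmd.eval, Op.eval, h13, h4, hKT]
  · simp [Cmd.eval, Op.eval, h13, h4, hKT, him, hI i (by omega)]

end
/-! ### The program -/

theorem evalList_cons (n : ℕ) (s : Stm) (l : List Stm) (S : State) :
    evalList n (s :: l) S = evalList n l (s.eval n S) := rfl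

/-- The initialization and the computation of both rankings and of their reversals. -/
def rankingStms : List Stm :=
  -- Arrays `4, …, 7` serve the horizontal ranking and arrays `8, …, 11` the vertical one; the ranks
  -- themselves end up in `6` and `10`.
  .cmd (.seq (.op (.bit 2 true)) (.op (.bit 13 true))) ::
    (rankStms 0 1 2 3 4 ++ reverseStm 6 12 :: (rankStms 1 0 3 2 8 ++ [reverseStm 10 13]))

/-- The structured program that decides universal greediness. -/
def greedyStms : List Stm :=
  -- The eastern quadrants use the reversed columns `12` and the southern ones the reversed heights
  -- `13`. Each quadrant has its own array, which is still zero.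
  rankingStms ++ (cornerStms 0 1 12 10 14 ++ (cornerStms 2 1 6 10 15 ++
    (cornerStms 0 3 12 13 16 ++ cornerStms 2 3 6 13 17)))

/-- The input table is in the arrays `0, …, 3`, and the constants are in their registers. -/
structure HoldsInput {n : ℕ} (H : Shape n) (S : State) : Prop where
  consts : Consts n S
  east : HoldsNbr H S 0 .east
  north : HoldsNbr H S 1 .north
  west : HoldsNbr H S 2 .west
  south : HoldsNbr H S 3 .south

theorem HoldsInput.agree {n : ℕ} {H : Shape n} {S T : State} {R A : List ℕ} (h : HoldsInput H S)
    (hT : Agree R A S T) (hR : 1 ∉ R ∧ 3 ∉ R ∧ 13 ∉ R) (hA : ∀ a ∈ A, 4 ≤ a) : HoldsInput H T := by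
  have key : ∀ a < 4, a ∉ A := fun a ha h => by
    have := hA a h
    omega
  exact ⟨h.consts.agree hT hR, h.east.agree hT (key 0 (by simp)), h.north.agree hT (key 1 (by simp)),
    h.west.agree hT (key 2 (by simp)), h.south.agree hT (key 3 (by simp))⟩

theorem initState_arr {n : ℕ} (H : Shape n) {a : ℕ} (ha : 4 ≤ a) (i : ℕ) :
    (initState H).arr a i = 0 := by
  simp only [initState]
  split_ifs
  · have : 1 * (n + 2) ≤ a / 4 * (n + 2) := Nat.mul_le_mul_right _ (by omega)
    rw [inputTable, dif_neg]
    unfold cellAddr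
    omega
  · rfl

theorem holdsNbr_initState {n : ℕ} (H : Shape n) {a : ℕ} (ha : a < 4) :
    HoldsNbr H (initState H) a (dirOfNat a) := by
  intro v
  have h₁ : cellAddr n a v / 4 = v := by
    have : a / 4 = 0 := by omega
    simp only [cellAddr, this]
    omega
  have h₂ : cellAddr n a v % 4 = a := by
    unfold cellAddr
    omega
  have hv : (v : ℕ) ≤ n + 1 := by omega
  simp only [initState, hv, ↓reduceIte, inputTable, h₁, h₂, Fin.is_lt, ↓reduceDIte, Fin.eta]
  cases H.nbr v (dirOfNat a) <;> rfl

variable {n : ℕ} {H : Shape n} {pos : Fin n → Plane}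

/-- The arrays `6` and `10` hold rankings, and the arrays `12` and `13` hold their reversals. -/
structure HoldsRankings (H : Shape n) (k l : ℕ) (S : State) : Prop where
  horizontal : H.Ranking .east .north (fun v => S.arr 6 v) k
  vertical : H.Ranking .north .east (fun v => S.arr 10 v) l
  horizontal_rev : ∀ v : Fin n, S.arr 12 v = k - S.arr 6 v - 1
  vertical_rev : ∀ v : Fin n, S.arr 13 v = l - S.arr 10 v - 1

theorem HoldsRankings.agree {k l : ℕ} {S T : State} {R A : List ℕ} (h : HoldsRankings H k l S)
    (hT : Agree R A S T) (hA : ∀ a ∈ A, 14 ≤ a) : HoldsRankings H k l T := by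
  have key : ∀ a < 14, T.arr a = S.arr a := fun a ha => hT.2 a fun h => by
    have := hA a h
    omega
  exact ⟨by rw [key 6 (by simp)]; exact h.horizontal, by rw [key 10 (by simp)]; exact h.vertical,
    by rw [key 6 (by simp), key 12 (by simp)]; exact h.horizontal_rev,
    by rw [key 10 (by simp), key 13 (by simp)]; exact h.vertical_rev⟩

theorem rankingStms_spec (h : H.IsDrawing pos) (hn : 0 < n) :
    HoldsInput H (evalList n rankingStms (initState H)) ∧
    (∀ a, 14 ≤ a → ∀ i, (evalList n rankingStms (initState H)).arr a i = 0) ∧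
    (0 < (evalList n rankingStms (initState H)).reg 2 ↔
      (∃ X k, H.Ranking .east .north X k) ∧ ∃ Y l, H.Ranking .north .east Y l) ∧
    ((∃ X k, H.Ranking .east .north X k) → (∃ Y l, H.Ranking .north .east Y l) →
      ∃ k l, HoldsRankings H k l (evalList n rankingStms (initState H))) := by
  have F := h.frame
  have hev : evalList n rankingStms (initState H) = (reverseStm 10 13).eval n
      (evalList n (rankStms 1 0 3 2 8) ((reverseStm 6 12).eval n (evalList n (rankStms 0 1 2 3 4)
        (Cmd.eval n (.seq (.op (.bit 2 true)) (.op (.bit 13 true))) (initState H))))) := by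
    simp only [rankingStms, evalList_cons, evalList_append]
    rfl
  rw [hev]
  set S := initState H with hS
  have hA₁ : Agree [2, 13] [] S (Cmd.eval n (.seq (.op (.bit 2 true)) (.op (.bit 13 true))) S) :=
    Cmd.agree n (.seq (.op (.bit 2 true)) (.op (.bit 13 true))) S
  set S₁ := Cmd.eval n (.seq (.op (.bit 2 true)) (.op (.bit 13 true))) S with hS₁
  have hI₁ : HoldsInput H S₁ := ⟨⟨by simp [hS₁, hS, Cmd.eval, Op.eval, initState],
    by simp [hS₁, hS, Cmd.eval, Op.eval, initState], by simp [hS₁, Cmd.eval, Op.eval]⟩,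
    (holdsNbr_initState H (by simp : 0 < 4)).agree hA₁ (by simp),
    (holdsNbr_initState H (by simp : 1 < 4)).agree hA₁ (by simp),
    (holdsNbr_initState H (by simp : 2 < 4)).agree hA₁ (by simp),
    (holdsNbr_initState H (by simp : 3 < 4)).agree hA₁ (by simp)⟩
  have h2 : S₁.reg 2 = 1 := by simp [hS₁, Cmd.eval, Op.eval]
  have hz₁ : ∀ a, 4 ≤ a → ∀ i, S₁.arr a i = 0 := fun a ha i => by
    rw [hA₁.2 a (by simp)]
    exact initState_arr H ha i
  clear_value S₁ S
  obtain ⟨h2X, hX⟩ := rankStms_spec (B := 4) F hI₁.consts hI₁.east hI₁.north hI₁.west hI₁.south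
    (by simp) (hz₁ 5 (by simp)) (hz₁ 7 (by simp)) hn
  have hA₂ := agree_rankStms (aE := 0) (aN := 1) (aW := 2) (aS := 3) (B := 4) (n := n) S₁
  set S₂ := evalList n (rankStms 0 1 2 3 4) S₁
  have hI₂ := hI₁.agree hA₂ (by simp) (by simp)
  have hr := reverseStm_spec hI₂.consts (by simp : 6 ≠ 12)
  have hA₃ := agree_reverseStm (n := n) (aK := 6) (aR := 12) S₂
  set S₃ := (reverseStm 6 12).eval n S₂
  have hI₃ := hI₂.agree hA₃ (by simp) (by simp)
  have hz₃ : ∀ a, 8 ≤ a → a ≠ 12 → ∀ i, S₃.arr a i = 0 := fun a ha ha' i => by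
    rw [hA₃.2 a (by simpa using ha'), hA₂.2 a (by simp; omega), hz₁ a (by omega)]
  obtain ⟨h2Y, hY⟩ := rankStms_spec (B := 8) F.transpose hI₃.consts hI₃.north hI₃.east hI₃.south
    hI₃.west (by simp) (hz₃ 9 (by simp) (by simp)) (hz₃ 11 (by simp) (by simp)) hn
  have hA₄ := agree_rankStms (aE := 1) (aN := 0) (aW := 3) (aS := 2) (B := 8) (n := n) S₃
  set S₄ := evalList n (rankStms 1 0 3 2 8) S₃
  have hI₄ := hI₃.agree hA₄ (by simp) (by simp)
  have hr' := reverseStm_spec hI₄.consts (by simp : 10 ≠ 13)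
  have hA₅ := agree_reverseStm (n := n) (aK := 10) (aR := 13) S₄
  set S₅ := (reverseStm 10 13).eval n S₄
  refine ⟨hI₄.agree hA₅ (by simp) (by simp), fun a ha i => ?_, ?_, fun hXk hYl => ?_⟩
  · rw [hA₅.2 a (by simp; omega), hA₄.2 a (by simp; omega), hz₃ a (by omega) (by omega)]
  · rw [hA₅.1 2 (by simp), h2Y, hA₃.1 2 (by simp), h2X, h2]
    simp
  · have h6 : S₅.arr 6 = S₂.arr 6 :=
      (hA₅.2 6 (by simp)).trans ((hA₄.2 6 (by simp)).trans (hA₃.2 6 (by simp)))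
    have h10 : S₅.arr 10 = S₄.arr 10 := hA₅.2 10 (by simp)
    refine ⟨_, _, ⟨by rw [h6]; exact hX hXk, by rw [h10]; exact hY hYl, fun v => ?_, fun v => ?_⟩⟩
    · rw [hA₅.2 12 (by simp), hA₄.2 12 (by simp), hr, h6]
    · rw [hr', h10]

theorem greedyStms_spec {H : RectilinearRep n} (h : H.IsDrawing pos) (hn : 0 < n) :
    0 < (evalList n greedyStms (initState H.toShape)).reg 2 ↔ H.UniversalGreedy := by
  obtain ⟨hI, hz, h2, hR⟩ := rankingStms_spec h hn
  rw [RectilinearRep.universalGreedy_iff_of_isDrawing h, greedyStms, evalList_append,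
    evalList_append, evalList_append, evalList_append]
  set S := evalList n rankingStms (initState H.toShape)
  by_cases hXY : (∃ X k, H.Ranking .east .north X k) ∧ ∃ Y l, H.Ranking .north .east Y l
  swap
  -- Without both rankings register `2` is already `0`, and the corner checks never set it again.
  · refine ⟨fun h' => absurd (h2.1 ?_) hXY, fun h' => absurd ⟨h'.1, h'.2.1⟩ hXY⟩
    exact pos_of_cornerStms (pos_of_cornerStms (pos_of_cornerStms (pos_of_cornerStms h')))
  obtain ⟨k, l, hkl⟩ := hR hXY.1 hXY.2
  have F := h.frame
  have hXk : ∀ T : State, HoldsRankings H.toShape k l T → (∀ v : Fin n, T.arr 6 v < n) ∧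
      (∀ v : Fin n, T.arr 10 v < n) ∧ (∀ v : Fin n, T.arr 12 v < n) ∧
      (∀ v : Fin n, T.arr 13 v < n) ∧
      (∀ u v : Fin n, T.arr 6 u < T.arr 6 v ↔ -pos v 0 < -pos u 0) ∧
      (∀ u v : Fin n, T.arr 10 u < T.arr 10 v ↔ pos u 1 < pos v 1) ∧
      (∀ u v : Fin n, T.arr 12 u < T.arr 12 v ↔ pos v 0 < pos u 0) ∧
      ∀ u v : Fin n, T.arr 13 u < T.arr 13 v ↔ -pos u 1 < -pos v 1 := by
    intro T hT
    have hX : ∀ v : Fin n, T.arr 6 v < k := hT.horizontal.lt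
    have hY : ∀ v : Fin n, T.arr 10 v < l := hT.vertical.lt
    have hk := hT.horizontal.size_le
    have hl := hT.vertical.size_le
    have hX' : ∀ u v : Fin n, T.arr 6 u < T.arr 6 v ↔ pos u 0 < pos v 0 := hT.horizontal.lt_iff F
    have hY' : ∀ u v : Fin n, T.arr 10 u < T.arr 10 v ↔ pos u 1 < pos v 1 :=
      hT.vertical.lt_iff F.transpose
    refine ⟨fun v => (hX v).trans_le hk, fun v => (hY v).trans_le hl, fun v => ?_, fun v => ?_,
      fun u v => ?_, hY', fun u v => ?_, fun u v => ?_⟩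
    · rw [hT.horizontal_rev]
      have := hX v
      omega
    · rw [hT.vertical_rev]
      have := hY v
      omega
    · rw [neg_lt_neg_iff, hX']
    · rw [hT.horizontal_rev, hT.horizontal_rev, ← hX']
      have := hX u
      have := hX v
      omega
    · rw [hT.vertical_rev, hT.vertical_rev, neg_lt_neg_iff, ← hY']
      have := hY u
      have := hY v
      omega
  obtain ⟨b6, b10, b12, b13, m6, m10, m12, m13⟩ := hXk S hkl
  have c₁ := cornerStms_spec F hkl.horizontal hI.consts hI.east hI.north b12 b10 m12 m10
    (hz 14 (by simp)) (by simp)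
  have A₁ := agree_cornerStms (n := n) (a := 0) (a' := 1) (aX := 12) (aY := 10) (aC := 14) S
  set S₁ := evalList n (cornerStms 0 1 12 10 14) S
  have hI₁ := hI.agree A₁ (by simp) (by simp)
  have hkl₁ := hkl.agree A₁ (by simp)
  obtain ⟨b6, b10, b12, b13, m6, m10, m12, m13⟩ := hXk S₁ hkl₁
  have c₂ := cornerStms_spec F.flip hkl₁.horizontal.opp_left hI₁.consts hI₁.west hI₁.north b6 b10
    m6 m10 (aC := 15) (by rw [A₁.2 15 (by simp)]; exact hz 15 (by simp)) (by simp)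
  have A₂ := agree_cornerStms (n := n) (a := 2) (a' := 1) (aX := 6) (aY := 10) (aC := 15) S₁
  set S₂ := evalList n (cornerStms 2 1 6 10 15) S₁
  have hI₂ := hI₁.agree A₂ (by simp) (by simp)
  have hkl₂ := hkl₁.agree A₂ (by simp)
  obtain ⟨b6, b10, b12, b13, m6, m10, m12, m13⟩ := hXk S₂ hkl₂
  have c₃ := cornerStms_spec F.transpose.flip.transpose hkl₂.horizontal.opp_right hI₂.consts hI₂.east
    hI₂.south b12 b13 m12 m13 (aC := 16)
    (by rw [A₂.2 16 (by simp), A₁.2 16 (by simp)]; exact hz 16 (by simp)) (by simp)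
  have A₃ := agree_cornerStms (n := n) (a := 0) (a' := 3) (aX := 12) (aY := 13) (aC := 16) S₂
  set S₃ := evalList n (cornerStms 0 3 12 13 16) S₂
  have hI₃ := hI₂.agree A₃ (by simp) (by simp)
  have hkl₃ := hkl₂.agree A₃ (by simp)
  obtain ⟨b6, b10, b12, b13, m6, m10, m12, m13⟩ := hXk S₃ hkl₃
  have c₄ := cornerStms_spec F.transpose.flip.transpose.flip hkl₃.horizontal.opp_right.opp_left
    hI₃.consts hI₃.west hI₃.south b6 b13 m6 m13 (aC := 17)
    (by rw [A₃.2 17 (by simp), A₂.2 17 (by simp), A₁.2 17 (by simp)]; exact hz 17 (by simp)) (by simp)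
  rw [c₄, c₃, c₂, c₁, h2]
  constructor
  · rintro ⟨⟨⟨⟨h₀, h₁⟩, h₂⟩, h₃⟩, h₄⟩
    exact ⟨h₀.1, h₀.2, h₁, h₂, h₃, h₄⟩
  · rintro ⟨h₀, h₀', h₁⟩
    exact ⟨⟨⟨⟨⟨h₀, h₀'⟩, h₁.ne⟩, h₁.nw⟩, h₁.se⟩, h₁.sw⟩

/-- The highest array is `17`, and `17 / 4 = 4`. -/
theorem block_greedyStms : ∀ s ∈ greedyStms, s.block ≤ 4 := by decide

end GreedyRectilinear

theorem mainTheorem4 :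
    (∀ (n : ℕ) (H : GreedyRectilinear.RectilinearRep n),
      GreedyRectilinear.IsBiconnected H.graph →
        (H.UniversalGreedy ↔
          H.IsConvex ∧ GreedyRectilinear.HasHamiltonianPath H.dagX ∧
            GreedyRectilinear.HasHamiltonianPath H.dagY)) ∧
    ∃ P : GreedyRectilinear.Program,
      GreedyRectilinear.DecidesInLinearTime P (fun _ H => H.UniversalGreedy) := by
  refine ⟨fun n H hbi => H.universalGreedy_iff_isConvex hbi.1, ?_⟩
  obtain ⟨C, hC⟩ := GreedyRectilinear.decidesWithin_compile GreedyRectilinear.greedyStms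
    GreedyRectilinear.block_greedyStms
  refine ⟨GreedyRectilinear.compile GreedyRectilinear.greedyStms, C, fun n H hbi => ?_⟩
  -- A connected graph has a vertex, and `0 < n` lets `C * n` absorb the constant costs.
  obtain ⟨v⟩ := hbi.1.nonempty
  have hn : 0 < n := v.pos
  obtain ⟨pos, hpos⟩ := H.exists_drawing
  have h := hC n H.toShape hn
  rwa [GreedyRectilinear.greedyStms_spec hpos hn] at h
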